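/- Let $\mathcal B=\{(\mathbf y,y_3):\mathbf y\in\mathbb R^2,\ y_3\ge 0\}$ be an isotropic elastic half-space with shear modulus $\mu>0$ and Poisson ratio $\nu\in(-1,\tfrac12)$, and let $\mathbf G^k(\mathbf y-\mathbf x,x_3,y_3)$, $k=1,2,3$, be the Mindlin fundamental solution: the displacement at $(\mathbf y,y_3)$ due to a unit point force $\mathbf e_k$ at $(\mathbf x,x_3)$ when the surface $y_3=0$ is traction-free. Write $(\nabla\mathbf G)_{kij}=\partial_{y_j}G^k_i$ and $(\nabla \mathbf G:\mathbf w)_k=\sum_{i,j}\partial_{y_j}G^k_i\,w_{ij}$. Its partial Fourier transform is $$\widehat{\nabla \mathbf G}(\mathbf q,x_3,y_3)=\int_{\mathbb R^2}\nabla \mathbf G(\mathbf z,x_3,y_3)\,e^{-i\mathbf q\cdot\mathbf z}\,d\mathbf z=\lim_{R\to\infty}\int_{|\mathbf z|<R}\nabla \mathbf G(\mathbf z,x_3,y_3)\,e^{-i\mathbf q\cdot\mathbf z}\,d\mathbf z\qquad(\mathbf q\in\mathbb R^2,\ y_3\ne x_3),$$ and the Mindlin volume operator is $$\mathcal N[\mathbf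 w](\mathbf x,x_3)=\lim_{R\to\infty}\int_0^\infty\Big\{\int_{|\mathbf y|<R}\nabla \mathbf G(\mathbf y-\mathbf x,x_3,y_3):\mathbf w(\mathbf y,y_3)\,d\mathbf y\Big\}dy_3 .$$ Let $L_1,L_2>0$ and let $\mathbf w:\mathcal B\to\mathbb R^{3\times3}$ be measurable and $\mathcal B_p$-periodic, i.e. $L_1$-periodic in $y_1$ and $L_2$-periodic in $y_2$, with $|w_{ij}(\mathbf y,y_3)|\le m(y_3)$ almost everywhere for some bounded integrable $m$ on $(0,\infty)$. For $\mathbf k\in\mathbb Z^2$ put $\bar{\mathbf k}=(k_1/L_1,k_2/L_2)$, and let $\widehat{\mathrm w}(\mathbf k,y_3)$ be the coefficients of the Fourier series $\mathbf w(\mathbf y,y_3)=\sum_{\mathbf k}\widehat{\mathrm w}(\mathbf k,y_3)e^{2\pi i\bar{\mathbf k}\cdot\mathbf y}$. Then: (i) the limits defining $\widehat{\nabla \mathbf G}$ (for $x_3\ge0$, $y_3>0$, $y_3\neq x_3$) and $\mathcal N[\mathbf w]$ (on $\mathcal B$) exist, all the integrals involved converging absolutely; (ii) $\mathcal N[\mathbf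 w]$ is $\mathcal B_p$-periodic, and $\mathcal N[\mathbf w](\cdot,x_3)$ is continuous for each $x_3\ge0$; (iii) for each $x_3\ge 0$, $$\mathcal N[\mathbf w](\mathbf x,x_3)=\sum_{\mathbf k\in\mathbb Z^2}\Big(\int_0^\infty\widehat{\nabla \mathbf G}(-2\pi\bar{\mathbf k},x_3,y_3):\widehat{\mathrm w}(\mathbf k,y_3)\,dy_3\Big)e^{2\pi i\bar{\mathbf k}\cdot\mathbf x},$$ that is: the integrals in parentheses converge absolutely and are the Fourier coefficients of $\mathcal N[\mathbf w](\cdot,x_3)$, the series converges to $\mathcal N[\mathbf w](\cdot,x_3)$ in $L^2$ of the horizontal cell, and it converges to it at every point $\mathbf x$ whenever the coefficients are absolutely summable. -/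

import Mathlib

open Real Set Filter Topology MeasureTheory

noncomputable section

/-- The horizontal plane; points of the half-space are pairs `(y, y₃)` with `y₃ ≥ 0` the depth. -/
abbrev Plane := EuclideanSpace ℝ (Fin 2)

/-- Mindlin's displacement tensor for the isotropic half-space `y₃ ≥ 0` with traction-free surface
(shear modulus `μ`, Poisson ratio `ν`): the entry `k i` is the `i`-th component of the displacement
at `(x + z, t)` created by a unit point force in the direction `e_k` applied at `(x, c)`.
Here `R₁`, `R₂` are the distances to the source and to its mirror image. -/
def mindlinG (μ ν : ℝ) (z : Plane) (c t : ℝ) : Matrix (Fin 3) (Fin 3) ℝ :=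
  let R₁ : ℝ := √(‖z‖ ^ 2 + (t - c) ^ 2)
  let R₂ : ℝ := √(‖z‖ ^ 2 + (t + c) ^ 2)
  let K : ℝ := 1 / (16 * π * μ * (1 - ν))
  let κ : ℝ := 3 - 4 * ν
  let γ : ℝ := 4 * (1 - ν) * (1 - 2 * ν)
  -- isotropic and deviatoric horizontal profiles (horizontal force, horizontal displacement)
  let a : ℝ := κ / R₁ + 1 / R₂ + 2 * c * t / R₂ ^ 3 + γ / (R₂ + t + c)
  let b : ℝ := 1 / R₁ ^ 3 + κ / R₂ ^ 3 - 6 * c * t / R₂ ^ 5 - γ / (R₂ * (R₂ + t + c) ^ 2)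
  -- horizontal force, vertical displacement
  let d : ℝ := (t - c) / R₁ ^ 3 + κ * (t - c) / R₂ ^ 3 - 6 * c * t * (t + c) / R₂ ^ 5
    + γ / (R₂ * (R₂ + t + c))
  -- vertical force, horizontal displacement
  let e : ℝ := (t - c) / R₁ ^ 3 + κ * (t - c) / R₂ ^ 3 + 6 * c * t * (t + c) / R₂ ^ 5
    - γ / (R₂ * (R₂ + t + c))
  -- vertical force, vertical displacement
  let f : ℝ := κ / R₁ + (8 * (1 - ν) ^ 2 - κ) / R₂ + (t - c) ^ 2 / R₁ ^ 3
    + (κ * (t + c) ^ 2 - 2 * c * t) / R₂ ^ 3 + 6 * c * t * (t + c) ^ 2 / R₂ ^ 5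
  K • !![a + z 0 * z 0 * b, z 0 * z 1 * b, z 0 * d;
         z 1 * z 0 * b, a + z 1 * z 1 * b, z 1 * d;
         z 0 * e, z 1 * e, f]

/-- `∇G`: the entry `k i j` is `∂G^k_i / ∂y_j`, the derivative in the field point. -/
def mindlinGradG (μ ν : ℝ) (z : Plane) (c t : ℝ) (k i j : Fin 3) : ℝ :=
  ![deriv (fun s : ℝ => mindlinG μ ν (z + s • EuclideanSpace.single 0 1) c t k i) 0,
    deriv (fun s : ℝ => mindlinG μ ν (z + s • EuclideanSpace.single 1 1) c t k i) 0,
    deriv (fun s : ℝ => mindlinG μ ν z c s k i) t] j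

/-- The integrand `(∇G(y - x, x₃, y₃) : w(y, y₃))_k`. -/
def volumeIntegrand (μ ν : ℝ) (w : Plane → ℝ → Matrix (Fin 3) (Fin 3) ℝ)
    (x : Plane) (x₃ : ℝ) (k : Fin 3) (y : Plane) (t : ℝ) : ℝ :=
  ∑ i, ∑ j, mindlinGradG μ ν (y - x) x₃ t k i j * w y t i j

/-- The Mindlin volume integral
`𝒩[w](x, x₃) = ∫₀^∞ { ∫_{ℝ²} ∇G(y - x, x₃, y₃) : w(y, y₃) dy } dy₃`
(meaningful where the integral converges absolutely). -/
def mindlinIntegral (μ ν : ℝ) (w : Plane → ℝ → Matrix (Fin 3) (Fin 3) ℝ)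
    (x : Plane) (x₃ : ℝ) (k : Fin 3) : ℝ :=
  ∫ t in Ioi (0 : ℝ), ∫ y : Plane, volumeIntegrand μ ν w x x₃ k y t

/-- Horizontal truncation of an eigenstress to the disc of radius `R` about the origin. -/
def truncateTo (R : ℝ) (w : Plane → ℝ → Matrix (Fin 3) (Fin 3) ℝ) :
    Plane → ℝ → Matrix (Fin 3) (Fin 3) ℝ :=
  fun y t => (Metric.ball (0 : Plane) R).indicator (fun y' => w y' t) y

/-- `u = 𝒩[w]` in the half-space, for densities that need not decay horizontally: every horizontal
truncation of `w` has an absolutely convergent volume integral, and `u` is the limit of these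
integrals as the truncation radius tends to infinity. -/
structure IsMindlinVolume (μ ν : ℝ) (w : Plane → ℝ → Matrix (Fin 3) (Fin 3) ℝ)
    (u : Plane → ℝ → Fin 3 → ℝ) : Prop where
  integrable : ∀ (R : ℝ) (x : Plane) (x₃ : ℝ), 0 ≤ x₃ → ∀ k,
    IntegrableOn (fun p : Plane × ℝ => volumeIntegrand μ ν (truncateTo R w) x x₃ k p.1 p.2)
      {p | 0 < p.2}
  tendsto : ∀ (x : Plane) (x₃ : ℝ), 0 ≤ x₃ → ∀ k,
    Tendsto (fun R : ℝ => mindlinIntegral μ ν (truncateTo R w) x x₃ k) atTop (𝓝 (u x x₃ k))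

/-- The Fourier integral `∫_{|z| < R} H(z) e^{-i q·z} dz` over a disc. -/
def discFourier (H : Plane → ℝ) (q : Plane) (R : ℝ) : ℂ :=
  ∫ z in Metric.ball (0 : Plane) R, (H z : ℂ) * Complex.exp (-(Complex.I * (inner ℝ q z : ℝ)))

/-- `a = Ĥ(q) = ∫_{ℝ²} H(z) e^{-i q·z} dz`, the integral being improper over growing discs. -/
structure HasPlaneFourier (H : Plane → ℝ) (q : Plane) (a : ℂ) : Prop where
  integrable : ∀ R : ℝ, IntegrableOn H (Metric.ball (0 : Plane) R)
  tendsto : Tendsto (discFourier H q) atTop (𝓝 a)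

/-- The partial Fourier transform of `∇G`, component `k i j`, at the wave vector `q`. -/
def mindlinGradGHat (μ ν : ℝ) (q : Plane) (x₃ t : ℝ) (k i j : Fin 3) : ℂ :=
  limUnder atTop (discFourier (fun z => mindlinGradG μ ν z x₃ t k i j) q)

/-- `ℬ_p`-periodicity of a field on the half-space, with horizontal periods `L 0`, `L 1`. -/
def CellPeriodic {α : Type*} (L : Fin 2 → ℝ) (f : Plane → ℝ → α) : Prop :=
  ∀ (y : Plane) (t : ℝ), 0 ≤ t → ∀ b : Fin 2, f (y + EuclideanSpace.single b (L b)) t = f y t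

/-- The horizontal section of the periodic cell. -/
def cell (L : Fin 2 → ℝ) : Set Plane :=
  {y | ∀ b, y b ∈ Ioo (-(L b / 2)) (L b / 2)}

/-- `k̄ = (k₁ / L₁, k₂ / L₂)`. -/
def kbar (L : Fin 2 → ℝ) (k : Fin 2 → ℤ) : Plane :=
  !₂[(k 0 : ℝ) / L 0, (k 1 : ℝ) / L 1]

/-- `exp (2πi k̄·x)`. -/
def cellExp (L : Fin 2 → ℝ) (k : Fin 2 → ℤ) (x : Plane) : ℂ :=
  Complex.exp (2 * π * Complex.I * (inner ℝ (kbar L k) x : ℝ))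

/-- The `k`-th coefficient of the Fourier series `f(x) = ∑ₖ cₖ exp (2πi k̄·x)`. -/
def cellCoeff (L : Fin 2 → ℝ) (f : Plane → ℂ) (k : Fin 2 → ℤ) : ℂ :=
  (1 / (L 0 * L 1 : ℝ) : ℂ) * ∫ y in cell L, f y * cellExp L (-k) y

/-- The integrand `(∇Ĝ(-2π k̄, x₃, y₃) : ŵ(k, y₃))_p`, with `ŵ(k, y₃)` the Fourier series
coefficient of `w(·, y₃)`. -/
def modeIntegrand (μ ν : ℝ) (L : Fin 2 → ℝ) (w : Plane → ℝ → Matrix (Fin 3) (Fin 3) ℝ)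
    (k : Fin 2 → ℤ) (x₃ : ℝ) (p : Fin 3) (t : ℝ) : ℂ :=
  ∑ i, ∑ j, mindlinGradGHat μ ν (-(2 * π) • kbar L k) x₃ t p i j
    * cellCoeff L (fun y => (w y t i j : ℂ)) k

/-- `∫₀^∞ ∇Ĝ(-2π k̄, x₃, y₃) : ŵ(k, y₃) dy₃`. -/
def modeCoeff (μ ν : ℝ) (L : Fin 2 → ℝ) (w : Plane → ℝ → Matrix (Fin 3) (Fin 3) ℝ)
    (k : Fin 2 → ℤ) (x₃ : ℝ) (p : Fin 3) : ℂ :=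
  ∫ t in Ioi (0 : ℝ), modeIntegrand μ ν L w k x₃ p t

end

/-! Horizontally, `∇G` decays only like the inverse square of the distance, so neither its plane
integral nor its integral against a periodic density converges absolutely. Everything rests on two
cancellations, proved for an abstract class of kernels (`IsHalfSpaceKernel`) to which all 27
components of `∇G` belong.

The first is angular. Summing a component over the four rotations by right angles leaves either zero
(components odd in `z`) or terms bounded by `|h| / (‖z‖² + h²)^{3/2}` with `h = t - c` or `h = t +
c`. The plane integral of this Poisson-type kernel does not depend on `h`. Since discs are invariant
under the rotations, integrals of the kernel over discs are bounded uniformly in depth and converge,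
to `kernelMean`. The angular bound comes from explicit formulas: after elimination of `‖z‖²` and of
the logarithmic term, every surviving term carries a factor `t - c`, `t + c` or `c`.

The second is translational. Kernels are symbols of order `-2`: a horizontal shift by `a` changes
them by `O(‖a‖ R⁻³)`. Hence the kernel minus its average over the cell (`kernelOsc`) is integrable
over the plane. In the averaged part the shifts can be moved onto the density `g`, replacing it by
its mean. The error lives in an annulus of bounded width at radius `R`, of area `O(R)`, where the
kernel is `O(R⁻²)`, so it is `O(1/R)` (`exists_norm_setIntegral_ball_sub_le`). Thus the disc
integrals of `H(y - x) g(y)` converge to `kernelPairing`, the integral of the oscillation against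
`g` plus `kernelMean` times the mean of `g`.

In depth, `R⁻² ≤ |t - c|^{-1/2} ‖z‖^{-3/2}` separates the singularity at the source into two locally
integrable factors, and dominated convergence with weight `1 + |t - c|^{-1/2}` against the majorant
of the density yields the volume integral, its periodicity and its continuity.

Finally the pairing commutes with horizontal translations, so it is diagonal on characters. The
multiplier is the pairing with the character itself, which is the improper Fourier integral of `∇G`
at `-2π k̄`. Fubini in depth gives the Fourier coefficients of the volume integral, and Fourier
theory on the torus gives both modes of convergence. -/

/-! ### Distances to a point at given height difference -/

/-- The distance `√(‖z‖² + h²)` from a horizontal offset `z` at height difference `h`. -/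
noncomputable def slant (h : ℝ) (z : Plane) : ℝ := √(‖z‖ ^ 2 + h ^ 2)

theorem slant_pos {h : ℝ} (hh : h ≠ 0) (z : Plane) : 0 < slant h z :=
  Real.sqrt_pos.2 (by positivity)

theorem sq_slant (h : ℝ) (z : Plane) : slant h z ^ 2 = ‖z‖ ^ 2 + h ^ 2 :=
  Real.sq_sqrt (by positivity)

theorem norm_le_slant (h : ℝ) (z : Plane) : ‖z‖ ≤ slant h z :=
  Real.le_sqrt_of_sq_le (by nlinarith [sq_nonneg h])

theorem abs_le_slant (h : ℝ) (z : Plane) : |h| ≤ slant h z :=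
  Real.le_sqrt_of_sq_le (by rw [sq_abs]; nlinarith [sq_nonneg ‖z‖])

theorem slant_mono {h h' : ℝ} (hh : |h| ≤ |h'|) (z : Plane) : slant h z ≤ slant h' z :=
  Real.sqrt_le_sqrt (by have := sq_le_sq.2 hh; linarith)

theorem abs_slant_add_sub_le (h : ℝ) (z a : Plane) : |slant h (z + a) - slant h z| ≤ ‖a‖ := by
  have h1 := sq_slant h (z + a)
  have h2 := sq_slant h z
  have p1 : 0 ≤ slant h (z + a) := Real.sqrt_nonneg _
  have p2 : 0 ≤ slant h z := Real.sqrt_nonneg _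
  have n1 : ‖z + a‖ ≤ ‖z‖ + ‖a‖ := norm_add_le _ _
  have n2 : ‖z‖ ≤ ‖z + a‖ + ‖a‖ := by simpa using norm_sub_le (z + a) a
  have := norm_le_slant h z
  have := norm_le_slant h (z + a)
  have := norm_nonneg a
  have := norm_nonneg z
  have := norm_nonneg (z + a)
  rw [abs_le]
  constructor
  · by_contra! hc
    nlinarith
  · by_contra! hc
    nlinarith

theorem half_slant_le {h : ℝ} {z a : Plane} (ha : 2 * ‖a‖ ≤ ‖z‖) :
    slant h z / 2 ≤ slant h (z + a) := by
  have h1 := abs_le.1 (abs_slant_add_sub_le h z a)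
  have h2 := norm_le_slant h z
  linarith [h1.1]

theorem measurable_slant {h : ℝ → ℝ} (hh : Measurable h) :
    Measurable (fun q : Plane × ℝ => slant (h q.2) q.1) := by
  unfold slant
  fun_prop

theorem zpow_le_zpow_of_nonpos {p : ℤ} (hp : p ≤ 0) {x y : ℝ} (hx : 0 < x) (hxy : x ≤ y) :
    y ^ p ≤ x ^ p := by
  obtain ⟨n, rfl⟩ := Int.exists_eq_neg_ofNat hp
  rw [zpow_neg, zpow_neg, zpow_natCast, zpow_natCast]
  gcongr

/-! ### Calculus of symbols -/

/-- `F` behaves like a symbol of order `p` with respect to the distance `√(‖z‖² + h(t)²)`,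
uniformly over `t ∈ D`. -/
structure IsSymbol (D : Set ℝ) (h : ℝ → ℝ) (p : ℤ) (F : Plane → ℝ → ℝ) : Prop where
  measurable : Measurable (fun q : Plane × ℝ => F q.1 q.2)
  exists_bound : ∃ C, 0 ≤ C ∧ ∀ t ∈ D, (∀ z, |F z t| ≤ C * slant (h t) z ^ p) ∧
    ∀ z a, 2 * ‖a‖ ≤ ‖z‖ → |F (z + a) t - F z t| ≤ C * ‖a‖ * slant (h t) z ^ (p - 1)

namespace IsSymbol

variable {D : Set ℝ} {h : ℝ → ℝ} {p q : ℤ} {F G : Plane → ℝ → ℝ}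

theorem const (x : ℝ) : IsSymbol D h 0 (fun _ _ => x) := by
  refine ⟨measurable_const, |x|, abs_nonneg _, fun t _ => ⟨fun z => by simp, fun z a _ => ?_⟩⟩
  have : 0 ≤ slant (h t) z := Real.sqrt_nonneg _
  simp only [sub_self, abs_zero]
  positivity

theorem add (hF : IsSymbol D h p F) (hG : IsSymbol D h p G) :
    IsSymbol D h p (fun z t => F z t + G z t) := by
  obtain ⟨C, hC, hFb⟩ := hF.exists_bound
  obtain ⟨C', hC', hGb⟩ := hG.exists_bound
  refine ⟨hF.measurable.add hG.measurable, C + C', by positivity, fun t ht => ⟨fun z => ?_,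
    fun z a ha => ?_⟩⟩
  · have := (hFb t ht).1 z
    have := (hGb t ht).1 z
    have := abs_add_le (F z t) (G z t)
    linarith
  · have h1 := (hFb t ht).2 z a ha
    have h2 := (hGb t ht).2 z a ha
    have h3 := abs_add_le (F (z + a) t - F z t) (G (z + a) t - G z t)
    rw [show F (z + a) t + G (z + a) t - (F z t + G z t)
      = F (z + a) t - F z t + (G (z + a) t - G z t) by ring]
    linarith

/-- Discrete Leibniz rule. Shifts with `2‖a‖ ≤ ‖z‖` are at most half the distance, so the shifted
factor `F (z + a)` is still at most `2C` times the size `r ^ p`. The two terms of the rule then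
contribute `2` and `1` to the constant `3`. -/
theorem mul (hD : ∀ t ∈ D, h t ≠ 0) (hF : IsSymbol D h p F) (hG : IsSymbol D h q G) :
    IsSymbol D h (p + q) (fun z t => F z t * G z t) := by
  obtain ⟨C, hC, hFb⟩ := hF.exists_bound
  obtain ⟨C', hC', hGb⟩ := hG.exists_bound
  refine ⟨hF.measurable.mul hG.measurable, 3 * C * C', by positivity, fun t ht => ⟨fun z => ?_,
    fun z a ha => ?_⟩⟩
  · have hpos := slant_pos (hD t ht) z
    rw [abs_mul, zpow_add₀ hpos.ne']
    have h1 := (hFb t ht).1 z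
    have h2 := (hGb t ht).1 z
    have h3 := mul_le_mul h1 h2 (abs_nonneg _) (by positivity)
    have : 0 ≤ C * C' * (slant (h t) z ^ p * slant (h t) z ^ q) := by positivity
    linarith
  · have hpos := slant_pos (hD t ht) z
    have h1 := (hFb t ht).1 z
    have h2 := (hGb t ht).1 z
    have h3 := (hFb t ht).2 z a ha
    have h4 := (hGb t ht).2 z a ha
    set r := slant (h t) z with hr
    -- One power of `r` absorbs `‖a‖`, turning the difference bound of order `p - 1` into a size
    -- bound of order `p`.
    have hz : ‖a‖ ≤ r / 2 := by have := norm_le_slant (h t) z; linarith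
    have hp : r ^ (p - 1) * r = r ^ p := by rw [← zpow_add_one₀ hpos.ne']; simp
    have hpq : r ^ (p + q - 1) = r ^ p * r ^ (q - 1) := by
      rw [← zpow_add₀ hpos.ne']; ring_nf
    have hpq' : r ^ (p + q - 1) = r ^ (p - 1) * r ^ q := by
      rw [← zpow_add₀ hpos.ne']; ring_nf
    have h5 : |F (z + a) t| ≤ 2 * C * r ^ p := by
      have e : F (z + a) t = (F (z + a) t - F z t) + F z t := by ring
      have h6 := abs_add_le (F (z + a) t - F z t) (F z t)
      rw [← e] at h6
      have h7 : C * ‖a‖ * r ^ (p - 1) ≤ C * (r / 2) * r ^ (p - 1) := by gcongr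
      have h8 : C * (r / 2) * r ^ (p - 1) = C * r ^ p / 2 := by rw [← hp]; ring
      have : 0 ≤ C * r ^ p := by positivity
      linarith
    have e : F (z + a) t * G (z + a) t - F z t * G z t
      = F (z + a) t * (G (z + a) t - G z t) + (F (z + a) t - F z t) * G z t := by ring
    rw [e]
    refine (abs_add_le _ _).trans ?_
    rw [abs_mul, abs_mul]
    have h9 := mul_le_mul h5 h4 (abs_nonneg _) (by positivity)
    have h10 := mul_le_mul h3 h2 (abs_nonneg _) (by positivity)
    calc _ ≤ _ := add_le_add h9 h10
      _ = 2 * C * C' * ‖a‖ * (r ^ p * r ^ (q - 1)) + C * C' * ‖a‖ * (r ^ (p - 1) * r ^ q) := by ring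
      _ = _ := by rw [← hpq, ← hpq']; ring

theorem pow (hD : ∀ t ∈ D, h t ≠ 0) (hF : IsSymbol D h p F) (n : ℕ) :
    IsSymbol D h (n * p) (fun z t => F z t ^ n) := by
  induction n with
  | zero => simpa using const (D := D) (h := h) 1
  | succ n ih =>
    have := ih.mul hD hF
    simpa [pow_succ, add_mul] using this

theorem const_mul (hD : ∀ t ∈ D, h t ≠ 0) (x : ℝ) (hF : IsSymbol D h p F) :
    IsSymbol D h p (fun z t => x * F z t) := by
  simpa using (const (D := D) (h := h) x).mul hD hF

theorem coord (i : Fin 2) : IsSymbol D h 1 (fun z _ => z i) := by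
  refine ⟨by fun_prop, 1, zero_le_one, fun t _ => ⟨fun z => ?_, fun z a _ => ?_⟩⟩
  · simpa using (PiLp.norm_apply_le z i).trans (norm_le_slant (h t) z)
  · simpa using PiLp.norm_apply_le a i

/-- A function of the depth alone that is bounded by the height difference has order one. -/
theorem depth {φ : ℝ → ℝ} (hφ : Measurable φ) (hb : ∀ t ∈ D, |φ t| ≤ |h t|) :
    IsSymbol D h 1 (fun _ t => φ t) := by
  refine ⟨by fun_prop, 1, zero_le_one, fun t ht => ⟨fun z => ?_, fun z a _ => ?_⟩⟩
  · simpa using (hb t ht).trans (abs_le_slant (h t) z)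
  · simp

/-- The difference of two reciprocals is the difference of the distances, at most `‖a‖`, over their
product. The shifted distance is at least half the original, whence the constant `2`. The
nonnegative shift `φ` covers both `1 / R` and the term `1 / (R₂ + t + c)`. -/
theorem inv_slant_add (hD : ∀ t ∈ D, h t ≠ 0) (hh : Measurable h) {φ : ℝ → ℝ} (hφ : Measurable φ)
    (h0 : ∀ t ∈ D, 0 ≤ φ t) :
    IsSymbol D h (-1) (fun z t => (slant (h t) z + φ t)⁻¹) := by
  refine ⟨((measurable_slant hh).add (hφ.comp measurable_snd)).inv, 2, zero_le_two,
    fun t ht => ⟨fun z => ?_, fun z a ha => ?_⟩⟩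
  · have := slant_pos (hD t ht) z
    have h0 := h0 t ht
    rw [abs_of_nonneg (by positivity), zpow_neg_one]
    have : (slant (h t) z + φ t)⁻¹ ≤ (slant (h t) z)⁻¹ := by
      gcongr; linarith
    have : 0 ≤ (slant (h t) z)⁻¹ := by positivity
    linarith
  · have p1 := slant_pos (hD t ht) z
    have p2 := slant_pos (hD t ht) (z + a)
    have p3 := half_slant_le (h := h t) ha
    have p4 := abs_slant_add_sub_le (h t) z a
    have h0 := h0 t ht
    rw [inv_sub_inv (by positivity) (by positivity), abs_div, abs_of_nonneg (a := (_ * _))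
      (by positivity), show (-1 - 1 : ℤ) = -2 by norm_num, zpow_neg, div_le_iff₀ (by positivity)]
    have e : |slant (h t) z + φ t - (slant (h t) (z + a) + φ t)| ≤ ‖a‖ := by
      rw [abs_sub_comm]; simpa using p4
    refine e.trans ?_
    have : slant (h t) z ^ 2 / 2 ≤ (slant (h t) (z + a) + φ t) * (slant (h t) z + φ t) := by
      nlinarith
    calc ‖a‖ = 2 * ‖a‖ * (slant (h t) z ^ (2 : ℕ))⁻¹ * (slant (h t) z ^ 2 / 2) := by
          field_simp
      _ ≤ _ := by
          have e2 : slant (h t) z ^ (2 : ℤ) = slant (h t) z ^ (2 : ℕ) := by norm_cast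
          rw [e2]
          gcongr

theorem inv_slant (hD : ∀ t ∈ D, h t ≠ 0) (hh : Measurable h) :
    IsSymbol D h (-1) (fun z t => (slant (h t) z)⁻¹) := by
  simpa using inv_slant_add hD hh (φ := fun _ => 0) measurable_const (fun _ _ => le_rfl)

/-- A symbol of negative order with respect to a larger distance is one for a smaller distance. -/
theorem mono {h' : ℝ → ℝ} (hD : ∀ t ∈ D, h t ≠ 0) (hp : p ≤ 0) (hh : ∀ t ∈ D, |h t| ≤ |h' t|)
    (hF : IsSymbol D h' p F) : IsSymbol D h p F := by
  obtain ⟨C, hC, hb⟩ := hF.exists_bound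
  refine ⟨hF.measurable, C, hC, fun t ht => ⟨fun z => ((hb t ht).1 z).trans ?_,
    fun z a ha => ((hb t ht).2 z a ha).trans ?_⟩⟩
  · exact mul_le_mul_of_nonneg_left
      (zpow_le_zpow_of_nonpos hp (slant_pos (hD t ht) z) (slant_mono (hh t ht) z)) hC
  · exact mul_le_mul_of_nonneg_left
      (zpow_le_zpow_of_nonpos (by omega) (slant_pos (hD t ht) z) (slant_mono (hh t ht) z))
      (by positivity)

end IsSymbol

/-! ### Poisson-type bounds -/

/-- `F` is bounded by `|h| / (‖z‖² + h²)^{3/2}`, whose plane integral does not depend on `h`. -/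
def IsPoissonBounded (D : Set ℝ) (h : ℝ → ℝ) (F : Plane → ℝ → ℝ) : Prop :=
  ∃ C, 0 ≤ C ∧ ∀ t ∈ D, ∀ z, |F z t| ≤ C * (|h t| / slant (h t) z ^ 3)

namespace IsPoissonBounded

variable {D : Set ℝ} {h : ℝ → ℝ} {F G : Plane → ℝ → ℝ}

theorem add (hF : IsPoissonBounded D h F) (hG : IsPoissonBounded D h G) :
    IsPoissonBounded D h (fun z t => F z t + G z t) := by
  obtain ⟨C, hC, hFb⟩ := hF
  obtain ⟨C', hC', hGb⟩ := hG
  refine ⟨C + C', by positivity, fun t ht z => ?_⟩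
  have := hFb t ht z
  have := hGb t ht z
  have := abs_add_le (F z t) (G z t)
  linarith

theorem const_mul (x : ℝ) (hF : IsPoissonBounded D h F) :
    IsPoissonBounded D h (fun z t => x * F z t) := by
  obtain ⟨C, hC, hFb⟩ := hF
  refine ⟨|x| * C, by positivity, fun t ht z => ?_⟩
  rw [abs_mul, mul_assoc]
  exact mul_le_mul_of_nonneg_left (hFb t ht z) (abs_nonneg _)

/-- The source of all angular bounds: a depth factor gains one power of the distance in the form of
`|h|`. -/
theorem of_depth_mul {φ : ℝ → ℝ} (hb : ∀ t ∈ D, |φ t| ≤ |h t|) (hG : IsSymbol D h (-3) G) :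
    IsPoissonBounded D h (fun z t => φ t * G z t) := by
  obtain ⟨C, hC, hGb⟩ := hG.exists_bound
  refine ⟨C, hC, fun t ht z => ?_⟩
  have h1 := (hGb t ht).1 z
  rw [abs_mul]
  have h2 := mul_le_mul (hb t ht) h1 (abs_nonneg _) (abs_nonneg _)
  refine h2.trans (le_of_eq ?_)
  rw [zpow_neg]
  norm_cast
  ring

end IsPoissonBounded

/-! ### Rotational averages and half-space kernels -/

/-- The depths at which the kernel with source depth `c` is regular. -/
def regularDepths (c : ℝ) : Set ℝ := {t | 0 < t ∧ t ≠ c}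

theorem sub_ne_zero_of_regular {c : ℝ} : ∀ t ∈ regularDepths c, t - c ≠ 0 :=
  fun _ ht => sub_ne_zero.2 ht.2

theorem add_ne_zero_of_regular {c : ℝ} (hc : 0 ≤ c) : ∀ t ∈ regularDepths c, t + c ≠ 0 :=
  fun t ht => by have : 0 < t := ht.1; positivity

/-- Rotation by a right angle. -/
noncomputable def rot (z : Plane) : Plane := !₂[-z 1, z 0]

@[simp] theorem rot_zero (z : Plane) : rot z 0 = -z 1 := rfl
@[simp] theorem rot_one (z : Plane) : rot z 1 = z 0 := rfl

theorem norm_sq_plane (z : Plane) : ‖z‖ ^ 2 = z 0 ^ 2 + z 1 ^ 2 := by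
  simp [EuclideanSpace.norm_sq_eq]

@[simp] theorem norm_rot (z : Plane) : ‖rot z‖ = ‖z‖ := by
  rw [← sq_eq_sq₀ (norm_nonneg _) (norm_nonneg _), norm_sq_plane, norm_sq_plane]
  simp [add_comm]

/-- The sum over the four rotations by right angles. -/
noncomputable def rotSum (F : Plane → ℝ → ℝ) (z : Plane) (t : ℝ) : ℝ :=
  F z t + F (rot z) t + F (rot (rot z)) t + F (rot (rot (rot z))) t

/-- Sum of a function bounded by the Poisson-type kernel at height difference `t - c` and one
bounded by the Poisson-type kernel at height difference `t + c`. -/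
def IsPoissonPair (c : ℝ) (F : Plane → ℝ → ℝ) : Prop :=
  ∃ F₁ F₂ : Plane → ℝ → ℝ, IsPoissonBounded (regularDepths c) (fun t => t - c) F₁ ∧
    IsPoissonBounded (regularDepths c) (fun t => t + c) F₂ ∧
    ∀ z, ∀ t ∈ regularDepths c, F z t = F₁ z t + F₂ z t

/-- Kernels of order `-2` singular at depth `c`, with small rotational averages. -/
structure IsHalfSpaceKernel (c : ℝ) (H : Plane → ℝ → ℝ) : Prop where
  symbol : IsSymbol (regularDepths c) (fun t => t - c) (-2) H
  rotSum : IsPoissonPair c (rotSum H)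

section PoissonPair

variable {c : ℝ} {F G : Plane → ℝ → ℝ}

theorem IsPoissonPair.add (hF : IsPoissonPair c F) (hG : IsPoissonPair c G) :
    IsPoissonPair c (fun z t => F z t + G z t) := by
  obtain ⟨F₁, F₂, h1, h2, h⟩ := hF
  obtain ⟨G₁, G₂, h3, h4, h'⟩ := hG
  exact ⟨_, _, h1.add h3, h2.add h4, fun z t ht => by
    simp only [h z t ht, h' z t ht]; ring⟩

theorem IsPoissonPair.const_mul (x : ℝ) (hF : IsPoissonPair c F) :
    IsPoissonPair c (fun z t => x * F z t) := by
  obtain ⟨F₁, F₂, h1, h2, h⟩ := hF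
  exact ⟨_, _, h1.const_mul x, h2.const_mul x, fun z t ht => by
    simp only [h z t ht]; ring⟩

theorem IsPoissonPair.congr (hF : IsPoissonPair c F)
    (h : ∀ z, ∀ t ∈ regularDepths c, G z t = F z t) : IsPoissonPair c G := by
  obtain ⟨F₁, F₂, h1, h2, h'⟩ := hF
  exact ⟨_, _, h1, h2, fun z t ht => by rw [h z t ht, h' z t ht]⟩

theorem IsPoissonBounded.zero {D : Set ℝ} {h : ℝ → ℝ} : IsPoissonBounded D h (fun _ _ => 0) :=
  ⟨0, le_rfl, by simp⟩

theorem IsPoissonPair.zero : IsPoissonPair c (fun _ _ => 0) :=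
  ⟨_, _, IsPoissonBounded.zero, IsPoissonBounded.zero, by simp⟩

theorem IsPoissonPair.ite (P : Prop) [Decidable P] (hF : IsPoissonPair c F) :
    IsPoissonPair c (fun z t => if P then F z t else 0) := by
  split_ifs
  · exact hF
  · exact .zero

end PoissonPair

/-! ### Homogeneous monomials in depths and reciprocal distances -/

/-- The reciprocal distance to the source. -/
noncomputable def invR₁ (c : ℝ) (z : Plane) (t : ℝ) : ℝ := (slant (t - c) z)⁻¹

/-- The reciprocal distance to the mirror image of the source. -/
noncomputable def invR₂ (c : ℝ) (z : Plane) (t : ℝ) : ℝ := (slant (t + c) z)⁻¹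

/-- The derivative in depth of the logarithmic potential of the mirror image. -/
noncomputable def invLog (c : ℝ) (z : Plane) (t : ℝ) : ℝ := (slant (t + c) z + (t + c))⁻¹

section Monomials

variable {c : ℝ}

theorem IsSymbol.congr {D : Set ℝ} {h : ℝ → ℝ} {p q : ℤ} {F G : Plane → ℝ → ℝ}
    (hF : IsSymbol D h p F) (hpq : p = q) (hGF : ∀ z t, G z t = F z t) : IsSymbol D h q G := by
  obtain rfl : G = F := by ext; apply hGF
  exact hpq ▸ hF

theorem isSymbol_source_monomial (m n : ℕ) (p : ℤ) (hp : (m : ℤ) - n = p) :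
    IsSymbol (regularDepths c) (fun t => t - c) p (fun z t => (t - c) ^ m * invR₁ c z t ^ n) := by
  have hD := sub_ne_zero_of_regular (c := c)
  have h1 : IsSymbol (regularDepths c) (fun t => t - c) 1 (fun _ t => t - c) :=
    IsSymbol.depth (by fun_prop) (fun t _ => le_rfl)
  exact ((h1.pow hD m).mul hD ((IsSymbol.inv_slant hD (by fun_prop)).pow hD n)).congr
    (by linarith) (fun _ _ => rfl)

/-- Orders are counted by homogeneity. Since `c ≥ 0` and `t > 0`, each of `c`, `t` and `t + c` is
bounded by the height difference `t + c` to the image and so has order one. -/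
theorem isSymbol_image_monomial (hc : 0 ≤ c) (n₁ n₂ n₃ n₄ n₅ : ℕ) (p : ℤ)
    (hp : (n₁ : ℤ) + n₂ + n₃ - n₄ - n₅ = p) :
    IsSymbol (regularDepths c) (fun t => t + c) p
      (fun z t => c ^ n₁ * t ^ n₂ * (t + c) ^ n₃ * invR₂ c z t ^ n₄ * invLog c z t ^ n₅) := by
  have hD := add_ne_zero_of_regular hc
  have h1 : IsSymbol (regularDepths c) (fun t => t + c) 1 (fun _ _ => c) :=
    IsSymbol.depth (by fun_prop) (fun t ht => by
      have : 0 < t := ht.1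
      rw [abs_of_nonneg hc, abs_of_nonneg (by positivity)]; linarith)
  have h2 : IsSymbol (regularDepths c) (fun t => t + c) 1 (fun _ t => t) :=
    IsSymbol.depth (by fun_prop) (fun t ht => by
      have : 0 < t := ht.1
      rw [abs_of_pos this, abs_of_nonneg (by positivity)]; linarith)
  have h3 : IsSymbol (regularDepths c) (fun t => t + c) 1 (fun _ t => t + c) :=
    IsSymbol.depth (by fun_prop) (fun t _ => le_rfl)
  have h5 : IsSymbol (regularDepths c) (fun t => t + c) (-1) (invLog c) :=
    IsSymbol.inv_slant_add hD (by fun_prop) (by fun_prop) (fun t ht => by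
      have : 0 < t := ht.1
      positivity)
  exact (((((h1.pow hD n₁).mul hD (h2.pow hD n₂)).mul hD (h3.pow hD n₃)).mul hD
    ((IsSymbol.inv_slant hD (by fun_prop)).pow hD n₄)).mul hD (h5.pow hD n₅)).congr
    (by linarith) (fun _ _ => rfl)

theorem abs_sub_le_abs_add (hc : 0 ≤ c) : ∀ t ∈ regularDepths c, |t - c| ≤ |t + c| := by
  intro t ht
  have : 0 < t := ht.1
  rw [abs_of_nonneg (a := t + c) (by positivity), abs_le]
  constructor <;> linarith

/-- The source is closer than its image, so terms of nonpositive order in the image distance may be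
measured by the source distance, which is the common scale for a whole component of `∇G`. -/
theorem isSymbol_image_monomial' (hc : 0 ≤ c) (n₁ n₂ n₃ n₄ n₅ : ℕ) (p : ℤ)
    (hp : (n₁ : ℤ) + n₂ + n₃ - n₄ - n₅ = p) (h0 : p ≤ 0) :
    IsSymbol (regularDepths c) (fun t => t - c) p
      (fun z t => c ^ n₁ * t ^ n₂ * (t + c) ^ n₃ * invR₂ c z t ^ n₄ * invLog c z t ^ n₅) :=
  (isSymbol_image_monomial hc n₁ n₂ n₃ n₄ n₅ p hp).mono sub_ne_zero_of_regular h0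
    (abs_sub_le_abs_add hc)

theorem isPoissonPair_source (m n : ℕ) (hp : (m : ℤ) - n = -3) :
    IsPoissonPair c (fun z t => (t - c) * ((t - c) ^ m * invR₁ c z t ^ n)) :=
  ⟨_, _, IsPoissonBounded.of_depth_mul (fun _ _ => le_rfl) (isSymbol_source_monomial m n _ hp),
    IsPoissonBounded.zero, by simp⟩

theorem isPoissonPair_image_add (hc : 0 ≤ c) (n₁ n₂ n₃ n₄ n₅ : ℕ)
    (hp : (n₁ : ℤ) + n₂ + n₃ - n₄ - n₅ = -3) :
    IsPoissonPair c (fun z t => (t + c) *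
      (c ^ n₁ * t ^ n₂ * (t + c) ^ n₃ * invR₂ c z t ^ n₄ * invLog c z t ^ n₅)) :=
  ⟨_, _, IsPoissonBounded.zero, IsPoissonBounded.of_depth_mul (fun _ _ => le_rfl)
    (isSymbol_image_monomial hc n₁ n₂ n₃ n₄ n₅ _ hp), by simp⟩

theorem isPoissonPair_image_const (hc : 0 ≤ c) (n₁ n₂ n₃ n₄ n₅ : ℕ)
    (hp : (n₁ : ℤ) + n₂ + n₃ - n₄ - n₅ = -3) :
    IsPoissonPair c (fun z t => c *
      (c ^ n₁ * t ^ n₂ * (t + c) ^ n₃ * invR₂ c z t ^ n₄ * invLog c z t ^ n₅)) :=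
  ⟨_, _, IsPoissonBounded.zero, IsPoissonBounded.of_depth_mul (fun t ht => by
      have : 0 < t := ht.1
      rw [abs_of_nonneg hc, abs_of_nonneg (by positivity)]; linarith)
    (isSymbol_image_monomial hc n₁ n₂ n₃ n₄ n₅ _ hp), by simp⟩

end Monomials

/-! ### Algebraic relations between the reciprocal distances -/

section Relations

variable {c : ℝ} {t : ℝ}

theorem normSq_mul_invR₁ (z : Plane) (ht : t ∈ regularDepths c) :
    ‖z‖ ^ 2 * invR₁ c z t ^ 2 = 1 - (t - c) ^ 2 * invR₁ c z t ^ 2 := by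
  have h := slant_pos (sub_ne_zero_of_regular t ht) z
  have h2 := sq_slant (t - c) z
  unfold invR₁
  field_simp
  linarith

theorem normSq_mul_invR₂ (hc : 0 ≤ c) (z : Plane) (ht : t ∈ regularDepths c) :
    ‖z‖ ^ 2 * invR₂ c z t ^ 2 = 1 - (t + c) ^ 2 * invR₂ c z t ^ 2 := by
  have h := slant_pos (add_ne_zero_of_regular hc t ht) z
  have h2 := sq_slant (t + c) z
  unfold invR₂
  field_simp
  linarith

/-- This is the factorisation `‖z‖² = (R₂ - (t + c)) (R₂ + (t + c))`. -/
theorem normSq_mul_invLog (hc : 0 ≤ c) (z : Plane) (ht : t ∈ regularDepths c) :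
    ‖z‖ ^ 2 * invR₂ c z t * invLog c z t = 1 - (t + c) * invR₂ c z t := by
  have h := slant_pos (add_ne_zero_of_regular hc t ht) z
  have h2 := sq_slant (t + c) z
  have : 0 < t := ht.1
  have h3 : slant (t + c) z + (t + c) ≠ 0 := by positivity
  unfold invR₂ invLog
  field_simp
  linarith

theorem invLog_mul (hc : 0 ≤ c) (z : Plane) (ht : t ∈ regularDepths c) :
    invLog c z t * (1 + (t + c) * invR₂ c z t) = invR₂ c z t := by
  have h := slant_pos (add_ne_zero_of_regular hc t ht) z
  have : 0 < t := ht.1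
  have h3 : slant (t + c) z + (t + c) ≠ 0 := by positivity
  unfold invR₂ invLog
  field_simp

end Relations

/-! ### Derivatives of the reciprocal distances -/

section Derivatives

theorem hasDerivAt_slant_line {h : ℝ} (hh : h ≠ 0) (z : Plane) (j : Fin 2) :
    HasDerivAt (fun s : ℝ => slant h (z + s • EuclideanSpace.single j 1))
      (z j * (slant h z)⁻¹) 0 := by
  have e : (fun s : ℝ => slant h (z + s • EuclideanSpace.single j 1))
      = fun s : ℝ => √(‖z‖ ^ 2 + 2 * s * z j + s ^ 2 + h ^ 2) := by
    ext s
    unfold slant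
    congr 2
    rw [norm_sq_plane, norm_sq_plane]
    fin_cases j <;> simp <;> ring
  rw [e]
  have h1 : HasDerivAt (fun s : ℝ => ‖z‖ ^ 2 + 2 * s * z j + s ^ 2 + h ^ 2) (2 * z j) 0 := by
    have := (((((hasDerivAt_id' (0 : ℝ)).const_mul 2).mul_const (z j)).const_add (‖z‖ ^ 2)).fun_add
      ((hasDerivAt_id' (0 : ℝ)).fun_pow 2)).add_const (h ^ 2)
    exact this.congr_deriv (by simp)
  refine (h1.sqrt (by simp only [mul_zero, zero_mul, add_zero]; positivity)).congr_deriv ?_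
  simp only [mul_zero, zero_mul, add_zero, ne_eq, OfNat.ofNat_ne_zero, not_false_eq_true, zero_pow]
  unfold slant
  field_simp

theorem hasDerivAt_slant_depth {h : ℝ} (hh : h ≠ 0) (z : Plane) :
    HasDerivAt (fun s : ℝ => slant s z) (h * (slant h z)⁻¹) h := by
  have h1 : HasDerivAt (fun s : ℝ => ‖z‖ ^ 2 + s ^ 2) (2 * h) h := by
    exact (((hasDerivAt_id' h).fun_pow 2).const_add (‖z‖ ^ 2)).congr_deriv (by simp)
  refine (h1.sqrt (by positivity)).congr_deriv ?_
  unfold slant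
  field_simp

variable {c t : ℝ}

theorem hasDerivAt_invR₁_line (ht : t ∈ regularDepths c) (z : Plane) (j : Fin 2) :
    HasDerivAt (fun s : ℝ => invR₁ c (z + s • EuclideanSpace.single j 1) t)
      (-(z j * invR₁ c z t ^ 3)) 0 := by
  have hh := sub_ne_zero_of_regular t ht
  have hp := slant_pos hh z
  have := (hasDerivAt_slant_line hh z j).fun_inv (by simpa using hp.ne')
  refine this.congr_deriv ?_
  simp only [zero_smul, add_zero, invR₁]
  field_simp

theorem hasDerivAt_invR₂_line (hc : 0 ≤ c) (ht : t ∈ regularDepths c) (z : Plane) (j : Fin 2) :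
    HasDerivAt (fun s : ℝ => invR₂ c (z + s • EuclideanSpace.single j 1) t)
      (-(z j * invR₂ c z t ^ 3)) 0 := by
  have hh := add_ne_zero_of_regular hc t ht
  have hp := slant_pos hh z
  have := (hasDerivAt_slant_line hh z j).fun_inv (by simpa using hp.ne')
  refine this.congr_deriv ?_
  simp only [zero_smul, add_zero, invR₂]
  field_simp

theorem hasDerivAt_invLog_line (hc : 0 ≤ c) (ht : t ∈ regularDepths c) (z : Plane) (j : Fin 2) :
    HasDerivAt (fun s : ℝ => invLog c (z + s • EuclideanSpace.single j 1) t)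
      (-(z j * (invR₂ c z t * invLog c z t ^ 2))) 0 := by
  have hh := add_ne_zero_of_regular hc t ht
  have hp := slant_pos hh z
  have h0 : 0 < t := ht.1
  have h3 : 0 < slant (t + c) z + (t + c) := by positivity
  have := ((hasDerivAt_slant_line hh z j).add_const (t + c)).fun_inv (by simpa using h3.ne')
  refine this.congr_deriv ?_
  simp only [zero_smul, add_zero, invR₂, invLog]
  field_simp

theorem hasDerivAt_invR₁_depth (ht : t ∈ regularDepths c) (z : Plane) :
    HasDerivAt (fun s : ℝ => invR₁ c z s) (-((t - c) * invR₁ c z t ^ 3)) t := by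
  have hh := sub_ne_zero_of_regular t ht
  have hp := slant_pos hh z
  have := ((hasDerivAt_slant_depth hh z).comp_sub_const t c).fun_inv hp.ne'
  refine this.congr_deriv ?_
  simp only [invR₁]
  field_simp

theorem hasDerivAt_invR₂_depth (hc : 0 ≤ c) (ht : t ∈ regularDepths c) (z : Plane) :
    HasDerivAt (fun s : ℝ => invR₂ c z s) (-((t + c) * invR₂ c z t ^ 3)) t := by
  have hh := add_ne_zero_of_regular hc t ht
  have hp := slant_pos hh z
  have := ((hasDerivAt_slant_depth hh z).comp_add_const t c).fun_inv hp.ne'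
  refine this.congr_deriv ?_
  simp only [invR₂]
  field_simp

/-- The depth derivative of `R₂ + t + c` is `(R₂ + t + c) / R₂`, so one factor of the squared
reciprocal cancels. -/
theorem hasDerivAt_invLog_depth (hc : 0 ≤ c) (ht : t ∈ regularDepths c) (z : Plane) :
    HasDerivAt (fun s : ℝ => invLog c z s) (-(invR₂ c z t * invLog c z t)) t := by
  have hh := add_ne_zero_of_regular hc t ht
  have hp := slant_pos hh z
  have h0 : 0 < t := ht.1
  have h3 : 0 < slant (t + c) z + (t + c) := by positivity
  have := (((hasDerivAt_slant_depth hh z).comp_add_const t c).fun_add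
    ((hasDerivAt_id t).add_const c)).fun_inv h3.ne'
  refine this.congr_deriv ?_
  simp only [invR₂, invLog, id]
  field_simp
  ring

end Derivatives

/-! ### Radial profiles of Mindlin's tensor and their derivatives -/

/-- Radial profile of `mindlinG`: isotropic part of the horizontal block, in terms of the
reciprocal distances `A`, `B` to the source and its image and of `G = 1 / (R₂ + t + c)`. -/
def isoProfile (ν c t A B G : ℝ) : ℝ :=
  (3 - 4 * ν) * A + B + 2 * c * t * B ^ 3 + 4 * (1 - ν) * (1 - 2 * ν) * G

/-- `z_j` times this is the derivative of `isoProfile` in `z_j`. -/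
def isoProfileRad (ν c t A B G : ℝ) : ℝ :=
  -((3 - 4 * ν) * A ^ 3) - B ^ 3 - 6 * c * t * B ^ 5 - 4 * (1 - ν) * (1 - 2 * ν) * (B * G ^ 2)

/-- The derivative of `isoProfile` in the depth `t`. -/
def isoProfileDep (ν c t A B G : ℝ) : ℝ :=
  -((3 - 4 * ν) * (t - c) * A ^ 3) - (t + c) * B ^ 3 + 2 * c * B ^ 3 - 6 * c * t * (t + c) * B ^ 5
    - 4 * (1 - ν) * (1 - 2 * ν) * (B * G)

/-- Radial profile of `mindlinG`: deviatoric part of the horizontal block, in terms of the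
reciprocal distances `A`, `B` to the source and its image and of `G = 1 / (R₂ + t + c)`. -/
def devProfile (ν c t A B G : ℝ) : ℝ :=
  A ^ 3 + (3 - 4 * ν) * B ^ 3 - 6 * c * t * B ^ 5 - 4 * (1 - ν) * (1 - 2 * ν) * (B * G ^ 2)

/-- `z_j` times this is the derivative of `devProfile` in `z_j`. -/
def devProfileRad (ν c t A B G : ℝ) : ℝ :=
  -(3 * A ^ 5) - 3 * (3 - 4 * ν) * B ^ 5 + 30 * c * t * B ^ 7
    + 4 * (1 - ν) * (1 - 2 * ν) * (B ^ 3 * G ^ 2 + 2 * B ^ 2 * G ^ 3)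

/-- The derivative of `devProfile` in the depth `t`. -/
def devProfileDep (ν c t A B G : ℝ) : ℝ :=
  -(3 * (t - c) * A ^ 5) - 3 * (3 - 4 * ν) * (t + c) * B ^ 5 - 6 * c * B ^ 5
    + 30 * c * t * (t + c) * B ^ 7
    + 4 * (1 - ν) * (1 - 2 * ν) * ((t + c) * B ^ 3 * G ^ 2 + 2 * B ^ 2 * G ^ 2)

/-- Radial profile of `mindlinG`: vertical displacement due to a horizontal force, in terms of the
reciprocal distances `A`, `B` to the source and its image and of `G = 1 / (R₂ + t + c)`. -/
def hvProfile (ν c t A B G : ℝ) : ℝ :=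
  (t - c) * A ^ 3 + (3 - 4 * ν) * ((t - c) * B ^ 3) - 6 * c * t * (t + c) * B ^ 5
    + 4 * (1 - ν) * (1 - 2 * ν) * (B * G)

/-- `z_j` times this is the derivative of `hvProfile` in `z_j`. -/
def hvProfileRad (ν c t A B G : ℝ) : ℝ :=
  -(3 * (t - c) * A ^ 5) - 3 * (3 - 4 * ν) * (t - c) * B ^ 5 + 30 * c * t * (t + c) * B ^ 7
    - 4 * (1 - ν) * (1 - 2 * ν) * (B ^ 3 * G + B ^ 2 * G ^ 2)

/-- The derivative of `hvProfile` in the depth `t`. -/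
def hvProfileDep (ν c t A B G : ℝ) : ℝ :=
  A ^ 3 - 3 * (t - c) ^ 2 * A ^ 5 + (3 - 4 * ν) * (B ^ 3 - 3 * (t - c) * (t + c) * B ^ 5)
    - 6 * (c * (t + c) * B ^ 5 + c * t * B ^ 5 - 5 * c * t * (t + c) ^ 2 * B ^ 7)
    - 4 * (1 - ν) * (1 - 2 * ν) * ((t + c) * B ^ 3 * G + B ^ 2 * G)

/-- Radial profile of `mindlinG`: horizontal displacement due to a vertical force, in terms of the
reciprocal distances `A`, `B` to the source and its image and of `G = 1 / (R₂ + t + c)`. -/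
def vhProfile (ν c t A B G : ℝ) : ℝ :=
  (t - c) * A ^ 3 + (3 - 4 * ν) * ((t - c) * B ^ 3) + 6 * c * t * (t + c) * B ^ 5
    - 4 * (1 - ν) * (1 - 2 * ν) * (B * G)

/-- `z_j` times this is the derivative of `vhProfile` in `z_j`. -/
def vhProfileRad (ν c t A B G : ℝ) : ℝ :=
  -(3 * (t - c) * A ^ 5) - 3 * (3 - 4 * ν) * (t - c) * B ^ 5 - 30 * c * t * (t + c) * B ^ 7
    + 4 * (1 - ν) * (1 - 2 * ν) * (B ^ 3 * G + B ^ 2 * G ^ 2)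

/-- The derivative of `vhProfile` in the depth `t`. -/
def vhProfileDep (ν c t A B G : ℝ) : ℝ :=
  A ^ 3 - 3 * (t - c) ^ 2 * A ^ 5 + (3 - 4 * ν) * (B ^ 3 - 3 * (t - c) * (t + c) * B ^ 5)
    + 6 * (c * (t + c) * B ^ 5 + c * t * B ^ 5 - 5 * c * t * (t + c) ^ 2 * B ^ 7)
    + 4 * (1 - ν) * (1 - 2 * ν) * ((t + c) * B ^ 3 * G + B ^ 2 * G)

/-- Radial profile of `mindlinG`: vertical displacement due to a vertical force, in terms of the
reciprocal distances `A`, `B` to the source and its image and of `G = 1 / (R₂ + t + c)`. -/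
def vvProfile (ν c t A B _G : ℝ) : ℝ :=
  (3 - 4 * ν) * A + (8 * (1 - ν) ^ 2 - (3 - 4 * ν)) * B + (t - c) ^ 2 * A ^ 3
    + ((3 - 4 * ν) * (t + c) ^ 2 - 2 * c * t) * B ^ 3 + 6 * c * t * (t + c) ^ 2 * B ^ 5

/-- `z_j` times this is the derivative of `vvProfile` in `z_j`. -/
def vvProfileRad (ν c t A B _G : ℝ) : ℝ :=
  -((3 - 4 * ν) * A ^ 3) - (8 * (1 - ν) ^ 2 - (3 - 4 * ν)) * B ^ 3 - 3 * (t - c) ^ 2 * A ^ 5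
    - 3 * ((3 - 4 * ν) * (t + c) ^ 2 - 2 * c * t) * B ^ 5 - 30 * c * t * (t + c) ^ 2 * B ^ 7

/-- The derivative of `vvProfile` in the depth `t`. -/
def vvProfileDep (ν c t A B _G : ℝ) : ℝ :=
  -((3 - 4 * ν) * (t - c) * A ^ 3) - (8 * (1 - ν) ^ 2 - (3 - 4 * ν)) * (t + c) * B ^ 3
    + 2 * (t - c) * A ^ 3 - 3 * (t - c) ^ 3 * A ^ 5 + (2 * (3 - 4 * ν) * (t + c) - 2 * c) * B ^ 3
    - 3 * ((3 - 4 * ν) * (t + c) ^ 2 - 2 * c * t) * (t + c) * B ^ 5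
    + 6 * (c * (t + c) ^ 2 + 2 * c * t * (t + c)) * B ^ 5 - 30 * c * t * (t + c) ^ 3 * B ^ 7

/-- The derivatives along a horizontal direction of the three quantities on which the profiles
depend, `x` being the corresponding coordinate. -/
structure HasLineDerivs (x s : ℝ) (A B G : ℝ → ℝ) : Prop where
  source : HasDerivAt A (-(x * A s ^ 3)) s
  image : HasDerivAt B (-(x * B s ^ 3)) s
  log : HasDerivAt G (-(x * (B s * G s ^ 2))) s

/-- The derivatives in depth of the three quantities on which the profiles depend. -/
structure HasDepthDerivs (c t : ℝ) (A B G : ℝ → ℝ) : Prop where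
  source : HasDerivAt A (-((t - c) * A t ^ 3)) t
  image : HasDerivAt B (-((t + c) * B t ^ 3)) t
  log : HasDerivAt G (-(B t * G t)) t

section ProfileDerivatives

variable {ν c t x s : ℝ} {A B G : ℝ → ℝ}

theorem HasLineDerivs.isoProfile (h : HasLineDerivs x s A B G) :
    HasDerivAt (fun r => isoProfile ν c t (A r) (B r) (G r))
      (x * isoProfileRad ν c t (A s) (B s) (G s)) s := by
  obtain ⟨hA, hB, hG⟩ := h
  refine ((((hA.const_mul (3 - 4 * ν)).fun_add hB).fun_add ((hB.fun_pow 3).const_mul (2 * c * t))).fun_add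
    (hG.const_mul (4 * (1 - ν) * (1 - 2 * ν)))).congr_deriv ?_
  unfold isoProfileRad
  push_cast
  ring

theorem HasDepthDerivs.isoProfile (h : HasDepthDerivs c t A B G) :
    HasDerivAt (fun r => isoProfile ν c r (A r) (B r) (G r))
      (isoProfileDep ν c t (A t) (B t) (G t)) t := by
  obtain ⟨hA, hB, hG⟩ := h
  have hT := hasDerivAt_id' t
  refine ((((hA.const_mul (3 - 4 * ν)).fun_add hB).fun_add ((hT.const_mul (2 * c)).fun_mul (hB.fun_pow 3))).fun_add
    (hG.const_mul (4 * (1 - ν) * (1 - 2 * ν)))).congr_deriv ?_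
  unfold isoProfileDep
  push_cast
  ring

theorem HasLineDerivs.devProfile (h : HasLineDerivs x s A B G) :
    HasDerivAt (fun r => devProfile ν c t (A r) (B r) (G r))
      (x * devProfileRad ν c t (A s) (B s) (G s)) s := by
  obtain ⟨hA, hB, hG⟩ := h
  refine (((((hA.fun_pow 3).fun_add ((hB.fun_pow 3).const_mul (3 - 4 * ν))).fun_sub
    ((hB.fun_pow 5).const_mul (6 * c * t))).fun_sub
    ((hB.fun_mul (hG.fun_pow 2)).const_mul (4 * (1 - ν) * (1 - 2 * ν))))).congr_deriv ?_
  unfold devProfileRad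
  push_cast
  ring

theorem HasDepthDerivs.devProfile (h : HasDepthDerivs c t A B G) :
    HasDerivAt (fun r => devProfile ν c r (A r) (B r) (G r))
      (devProfileDep ν c t (A t) (B t) (G t)) t := by
  obtain ⟨hA, hB, hG⟩ := h
  have hT := hasDerivAt_id' t
  refine (((((hA.fun_pow 3).fun_add ((hB.fun_pow 3).const_mul (3 - 4 * ν))).fun_sub
    ((hT.const_mul (6 * c)).fun_mul (hB.fun_pow 5))).fun_sub
    ((hB.fun_mul (hG.fun_pow 2)).const_mul (4 * (1 - ν) * (1 - 2 * ν))))).congr_deriv ?_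
  unfold devProfileDep
  push_cast
  ring

theorem HasLineDerivs.hvProfile (h : HasLineDerivs x s A B G) :
    HasDerivAt (fun r => hvProfile ν c t (A r) (B r) (G r))
      (x * hvProfileRad ν c t (A s) (B s) (G s)) s := by
  obtain ⟨hA, hB, hG⟩ := h
  refine ((((((hA.fun_pow 3).const_mul (t - c))).fun_add
    (((hB.fun_pow 3).const_mul (t - c)).const_mul (3 - 4 * ν))).fun_sub
    ((hB.fun_pow 5).const_mul (6 * c * t * (t + c)))).fun_add
    ((hB.fun_mul hG).const_mul (4 * (1 - ν) * (1 - 2 * ν)))).congr_deriv ?_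
  unfold hvProfileRad
  push_cast
  ring

theorem HasDepthDerivs.hvProfile (h : HasDepthDerivs c t A B G) :
    HasDerivAt (fun r => hvProfile ν c r (A r) (B r) (G r))
      (hvProfileDep ν c t (A t) (B t) (G t)) t := by
  obtain ⟨hA, hB, hG⟩ := h
  have hT := hasDerivAt_id' t
  refine (((((hT.sub_const c).fun_mul (hA.fun_pow 3)).fun_add
    (((hT.sub_const c).fun_mul (hB.fun_pow 3)).const_mul (3 - 4 * ν))).fun_sub
    (((hT.const_mul (6 * c)).fun_mul (hT.add_const c)).fun_mul (hB.fun_pow 5))).fun_add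
    ((hB.fun_mul hG).const_mul (4 * (1 - ν) * (1 - 2 * ν)))).congr_deriv ?_
  unfold hvProfileDep
  push_cast
  ring

theorem HasLineDerivs.vhProfile (h : HasLineDerivs x s A B G) :
    HasDerivAt (fun r => vhProfile ν c t (A r) (B r) (G r))
      (x * vhProfileRad ν c t (A s) (B s) (G s)) s := by
  obtain ⟨hA, hB, hG⟩ := h
  refine ((((((hA.fun_pow 3).const_mul (t - c))).fun_add
    (((hB.fun_pow 3).const_mul (t - c)).const_mul (3 - 4 * ν))).fun_add
    ((hB.fun_pow 5).const_mul (6 * c * t * (t + c)))).fun_sub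
    ((hB.fun_mul hG).const_mul (4 * (1 - ν) * (1 - 2 * ν)))).congr_deriv ?_
  unfold vhProfileRad
  push_cast
  ring

theorem HasDepthDerivs.vhProfile (h : HasDepthDerivs c t A B G) :
    HasDerivAt (fun r => vhProfile ν c r (A r) (B r) (G r))
      (vhProfileDep ν c t (A t) (B t) (G t)) t := by
  obtain ⟨hA, hB, hG⟩ := h
  have hT := hasDerivAt_id' t
  refine (((((hT.sub_const c).fun_mul (hA.fun_pow 3)).fun_add
    (((hT.sub_const c).fun_mul (hB.fun_pow 3)).const_mul (3 - 4 * ν))).fun_add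
    (((hT.const_mul (6 * c)).fun_mul (hT.add_const c)).fun_mul (hB.fun_pow 5))).fun_sub
    ((hB.fun_mul hG).const_mul (4 * (1 - ν) * (1 - 2 * ν)))).congr_deriv ?_
  unfold vhProfileDep
  push_cast
  ring

theorem HasLineDerivs.vvProfile (h : HasLineDerivs x s A B G) :
    HasDerivAt (fun r => vvProfile ν c t (A r) (B r) (G r))
      (x * vvProfileRad ν c t (A s) (B s) (G s)) s := by
  obtain ⟨hA, hB, hG⟩ := h
  refine (((((hA.const_mul (3 - 4 * ν)).fun_add
    (hB.const_mul (8 * (1 - ν) ^ 2 - (3 - 4 * ν)))).fun_add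
    ((hA.fun_pow 3).const_mul ((t - c) ^ 2))).fun_add
    ((hB.fun_pow 3).const_mul ((3 - 4 * ν) * (t + c) ^ 2 - 2 * c * t))).fun_add
    ((hB.fun_pow 5).const_mul (6 * c * t * (t + c) ^ 2))).congr_deriv ?_
  unfold vvProfileRad
  push_cast
  ring

theorem HasDepthDerivs.vvProfile (h : HasDepthDerivs c t A B G) :
    HasDerivAt (fun r => vvProfile ν c r (A r) (B r) (G r))
      (vvProfileDep ν c t (A t) (B t) (G t)) t := by
  obtain ⟨hA, hB, hG⟩ := h
  have hT := hasDerivAt_id' t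
  refine (((((hA.const_mul (3 - 4 * ν)).fun_add
    (hB.const_mul (8 * (1 - ν) ^ 2 - (3 - 4 * ν)))).fun_add
    (((hT.sub_const c).fun_pow 2).fun_mul (hA.fun_pow 3))).fun_add
    (((((hT.add_const c).fun_pow 2).const_mul (3 - 4 * ν)).fun_sub (hT.const_mul (2 * c))).fun_mul
      (hB.fun_pow 3))).fun_add
    (((hT.const_mul (6 * c)).fun_mul ((hT.add_const c).fun_pow 2)).fun_mul (hB.fun_pow 5))).congr_deriv ?_
  unfold vvProfileDep
  push_cast
  ring

end ProfileDerivatives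

theorem hasLineDerivs {c t : ℝ} (hc : 0 ≤ c) (ht : t ∈ regularDepths c) (z : Plane) (j : Fin 2) :
    HasLineDerivs (z j) 0 (fun s : ℝ => invR₁ c (z + s • EuclideanSpace.single j 1) t)
      (fun s : ℝ => invR₂ c (z + s • EuclideanSpace.single j 1) t)
      (fun s : ℝ => invLog c (z + s • EuclideanSpace.single j 1) t) := by
  refine ⟨?_, ?_, ?_⟩ <;> simp only [zero_smul, add_zero]
  · exact hasDerivAt_invR₁_line ht z j
  · exact hasDerivAt_invR₂_line hc ht z j
  · exact hasDerivAt_invLog_line hc ht z j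

theorem hasDepthDerivs {c t : ℝ} (hc : 0 ≤ c) (ht : t ∈ regularDepths c) (z : Plane) :
    HasDepthDerivs c t (invR₁ c z) (invR₂ c z) (invLog c z) :=
  ⟨hasDerivAt_invR₁_depth ht z, hasDerivAt_invR₂_depth hc ht z, hasDerivAt_invLog_depth hc ht z⟩

/-- A profile evaluated at the distances of the point at horizontal offset `z` and depth `t` from a
source at depth `c`. -/
noncomputable def atPoint (φ : ℝ → ℝ → ℝ → ℝ → ℝ → ℝ) (c : ℝ) (z : Plane) (t : ℝ) : ℝ :=
  φ c t (invR₁ c z t) (invR₂ c z t) (invLog c z t)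

/-! ### Orders of the profiles as symbols -/

section ProfileSymbols

variable {c : ℝ}

theorem isSymbol_isoProfileRad (hc : 0 ≤ c) (ν : ℝ) :
    IsSymbol (regularDepths c) (fun t => t - c) (-3) (atPoint (isoProfileRad ν) c) := by
  have hD := sub_ne_zero_of_regular (c := c)
  have h0 := (isSymbol_source_monomial (c := c) 0 3 (-3) (by norm_num)).const_mul hD
    (-(3 - 4 * ν))
  have h1 := (isSymbol_image_monomial' hc 0 0 0 3 0 (-3) (by norm_num) (by norm_num)).const_mul hD
    (-1)
  have h2 := (isSymbol_image_monomial' hc 1 1 0 5 0 (-3) (by norm_num) (by norm_num)).const_mul hD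
    (-6)
  have h3 := (isSymbol_image_monomial' hc 0 0 0 1 2 (-3) (by norm_num) (by norm_num)).const_mul hD
    (-(4 * (1 - ν) * (1 - 2 * ν)))
  refine (((h0.add h1).add h2).add h3).congr rfl fun z t => ?_
  simp only [atPoint, isoProfileRad]
  ring

theorem isSymbol_isoProfileDep (hc : 0 ≤ c) (ν : ℝ) :
    IsSymbol (regularDepths c) (fun t => t - c) (-2) (atPoint (isoProfileDep ν) c) := by
  have hD := sub_ne_zero_of_regular (c := c)
  have h0 := (isSymbol_source_monomial (c := c) 1 3 (-2) (by norm_num)).const_mul hD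
    (-(3 - 4 * ν))
  have h1 := (isSymbol_image_monomial' hc 0 0 1 3 0 (-2) (by norm_num) (by norm_num)).const_mul hD
    (-1)
  have h2 := (isSymbol_image_monomial' hc 1 0 0 3 0 (-2) (by norm_num) (by norm_num)).const_mul hD
    (2)
  have h3 := (isSymbol_image_monomial' hc 1 1 1 5 0 (-2) (by norm_num) (by norm_num)).const_mul hD
    (-6)
  have h4 := (isSymbol_image_monomial' hc 0 0 0 1 1 (-2) (by norm_num) (by norm_num)).const_mul hD
    (-(4 * (1 - ν) * (1 - 2 * ν)))
  refine ((((h0.add h1).add h2).add h3).add h4).congr rfl fun z t => ?_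
  simp only [atPoint, isoProfileDep]
  ring

theorem isSymbol_devProfile (hc : 0 ≤ c) (ν : ℝ) :
    IsSymbol (regularDepths c) (fun t => t - c) (-3) (atPoint (devProfile ν) c) := by
  have hD := sub_ne_zero_of_regular (c := c)
  have h0 := (isSymbol_source_monomial (c := c) 0 3 (-3) (by norm_num)).const_mul hD
    (1)
  have h1 := (isSymbol_image_monomial' hc 0 0 0 3 0 (-3) (by norm_num) (by norm_num)).const_mul hD
    (3 - 4 * ν)
  have h2 := (isSymbol_image_monomial' hc 1 1 0 5 0 (-3) (by norm_num) (by norm_num)).const_mul hD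
    (-6)
  have h3 := (isSymbol_image_monomial' hc 0 0 0 1 2 (-3) (by norm_num) (by norm_num)).const_mul hD
    (-(4 * (1 - ν) * (1 - 2 * ν)))
  refine (((h0.add h1).add h2).add h3).congr rfl fun z t => ?_
  simp only [atPoint, devProfile]
  ring

theorem isSymbol_devProfileRad (hc : 0 ≤ c) (ν : ℝ) :
    IsSymbol (regularDepths c) (fun t => t - c) (-5) (atPoint (devProfileRad ν) c) := by
  have hD := sub_ne_zero_of_regular (c := c)
  have h0 := (isSymbol_source_monomial (c := c) 0 5 (-5) (by norm_num)).const_mul hD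
    (-3)
  have h1 := (isSymbol_image_monomial' hc 0 0 0 5 0 (-5) (by norm_num) (by norm_num)).const_mul hD
    (-3 * (3 - 4 * ν))
  have h2 := (isSymbol_image_monomial' hc 1 1 0 7 0 (-5) (by norm_num) (by norm_num)).const_mul hD
    (30)
  have h3 := (isSymbol_image_monomial' hc 0 0 0 3 2 (-5) (by norm_num) (by norm_num)).const_mul hD
    (4 * (1 - ν) * (1 - 2 * ν))
  have h4 := (isSymbol_image_monomial' hc 0 0 0 2 3 (-5) (by norm_num) (by norm_num)).const_mul hD
    (2 * (4 * (1 - ν) * (1 - 2 * ν)))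
  refine ((((h0.add h1).add h2).add h3).add h4).congr rfl fun z t => ?_
  simp only [atPoint, devProfileRad]
  ring

theorem isSymbol_devProfileDep (hc : 0 ≤ c) (ν : ℝ) :
    IsSymbol (regularDepths c) (fun t => t - c) (-4) (atPoint (devProfileDep ν) c) := by
  have hD := sub_ne_zero_of_regular (c := c)
  have h0 := (isSymbol_source_monomial (c := c) 1 5 (-4) (by norm_num)).const_mul hD
    (-3)
  have h1 := (isSymbol_image_monomial' hc 0 0 1 5 0 (-4) (by norm_num) (by norm_num)).const_mul hD
    (-3 * (3 - 4 * ν))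
  have h2 := (isSymbol_image_monomial' hc 1 0 0 5 0 (-4) (by norm_num) (by norm_num)).const_mul hD
    (-6)
  have h3 := (isSymbol_image_monomial' hc 1 1 1 7 0 (-4) (by norm_num) (by norm_num)).const_mul hD
    (30)
  have h4 := (isSymbol_image_monomial' hc 0 0 1 3 2 (-4) (by norm_num) (by norm_num)).const_mul hD
    (4 * (1 - ν) * (1 - 2 * ν))
  have h5 := (isSymbol_image_monomial' hc 0 0 0 2 2 (-4) (by norm_num) (by norm_num)).const_mul hD
    (2 * (4 * (1 - ν) * (1 - 2 * ν)))
  refine (((((h0.add h1).add h2).add h3).add h4).add h5).congr rfl fun z t => ?_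
  simp only [atPoint, devProfileDep]
  ring

theorem isSymbol_hvProfile (hc : 0 ≤ c) (ν : ℝ) :
    IsSymbol (regularDepths c) (fun t => t - c) (-2) (atPoint (hvProfile ν) c) := by
  have hD := sub_ne_zero_of_regular (c := c)
  have h0 := (isSymbol_source_monomial (c := c) 1 3 (-2) (by norm_num)).const_mul hD
    (1)
  have h1 := (isSymbol_image_monomial' hc 0 1 0 3 0 (-2) (by norm_num) (by norm_num)).const_mul hD
    (3 - 4 * ν)
  have h2 := (isSymbol_image_monomial' hc 1 0 0 3 0 (-2) (by norm_num) (by norm_num)).const_mul hD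
    (-(3 - 4 * ν))
  have h3 := (isSymbol_image_monomial' hc 1 1 1 5 0 (-2) (by norm_num) (by norm_num)).const_mul hD
    (-6)
  have h4 := (isSymbol_image_monomial' hc 0 0 0 1 1 (-2) (by norm_num) (by norm_num)).const_mul hD
    (4 * (1 - ν) * (1 - 2 * ν))
  refine ((((h0.add h1).add h2).add h3).add h4).congr rfl fun z t => ?_
  simp only [atPoint, hvProfile]
  ring

theorem isSymbol_hvProfileRad (hc : 0 ≤ c) (ν : ℝ) :
    IsSymbol (regularDepths c) (fun t => t - c) (-4) (atPoint (hvProfileRad ν) c) := by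
  have hD := sub_ne_zero_of_regular (c := c)
  have h0 := (isSymbol_source_monomial (c := c) 1 5 (-4) (by norm_num)).const_mul hD
    (-3)
  have h1 := (isSymbol_image_monomial' hc 0 1 0 5 0 (-4) (by norm_num) (by norm_num)).const_mul hD
    (-3 * (3 - 4 * ν))
  have h2 := (isSymbol_image_monomial' hc 1 0 0 5 0 (-4) (by norm_num) (by norm_num)).const_mul hD
    (3 * (3 - 4 * ν))
  have h3 := (isSymbol_image_monomial' hc 1 1 1 7 0 (-4) (by norm_num) (by norm_num)).const_mul hD
    (30)
  have h4 := (isSymbol_image_monomial' hc 0 0 0 3 1 (-4) (by norm_num) (by norm_num)).const_mul hD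
    (-(4 * (1 - ν) * (1 - 2 * ν)))
  have h5 := (isSymbol_image_monomial' hc 0 0 0 2 2 (-4) (by norm_num) (by norm_num)).const_mul hD
    (-(4 * (1 - ν) * (1 - 2 * ν)))
  refine (((((h0.add h1).add h2).add h3).add h4).add h5).congr rfl fun z t => ?_
  simp only [atPoint, hvProfileRad]
  ring

theorem isSymbol_hvProfileDep (hc : 0 ≤ c) (ν : ℝ) :
    IsSymbol (regularDepths c) (fun t => t - c) (-3) (atPoint (hvProfileDep ν) c) := by
  have hD := sub_ne_zero_of_regular (c := c)
  have h0 := (isSymbol_source_monomial (c := c) 0 3 (-3) (by norm_num)).const_mul hD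
    (1)
  have h1 := (isSymbol_source_monomial (c := c) 2 5 (-3) (by norm_num)).const_mul hD
    (-3)
  have h2 := (isSymbol_image_monomial' hc 0 0 0 3 0 (-3) (by norm_num) (by norm_num)).const_mul hD
    (3 - 4 * ν)
  have h3 := (isSymbol_image_monomial' hc 0 1 1 5 0 (-3) (by norm_num) (by norm_num)).const_mul hD
    (-3 * (3 - 4 * ν))
  have h4 := (isSymbol_image_monomial' hc 1 0 1 5 0 (-3) (by norm_num) (by norm_num)).const_mul hD
    (3 * (3 - 4 * ν))
  have h5 := (isSymbol_image_monomial' hc 1 0 1 5 0 (-3) (by norm_num) (by norm_num)).const_mul hD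
    (-6)
  have h6 := (isSymbol_image_monomial' hc 1 1 0 5 0 (-3) (by norm_num) (by norm_num)).const_mul hD
    (-6)
  have h7 := (isSymbol_image_monomial' hc 1 1 2 7 0 (-3) (by norm_num) (by norm_num)).const_mul hD
    (30)
  have h8 := (isSymbol_image_monomial' hc 0 0 1 3 1 (-3) (by norm_num) (by norm_num)).const_mul hD
    (-(4 * (1 - ν) * (1 - 2 * ν)))
  have h9 := (isSymbol_image_monomial' hc 0 0 0 2 1 (-3) (by norm_num) (by norm_num)).const_mul hD
    (-(4 * (1 - ν) * (1 - 2 * ν)))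
  refine (((((((((h0.add h1).add h2).add h3).add h4).add h5).add h6).add h7).add h8).add h9).congr rfl fun z t => ?_
  simp only [atPoint, hvProfileDep]
  ring

theorem isSymbol_vvProfileRad (hc : 0 ≤ c) (ν : ℝ) :
    IsSymbol (regularDepths c) (fun t => t - c) (-3) (atPoint (vvProfileRad ν) c) := by
  have hD := sub_ne_zero_of_regular (c := c)
  have h0 := (isSymbol_source_monomial (c := c) 0 3 (-3) (by norm_num)).const_mul hD
    (-(3 - 4 * ν))
  have h1 := (isSymbol_image_monomial' hc 0 0 0 3 0 (-3) (by norm_num) (by norm_num)).const_mul hD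
    (-(8 * (1 - ν) ^ 2 - (3 - 4 * ν)))
  have h2 := (isSymbol_source_monomial (c := c) 2 5 (-3) (by norm_num)).const_mul hD
    (-3)
  have h3 := (isSymbol_image_monomial' hc 0 0 2 5 0 (-3) (by norm_num) (by norm_num)).const_mul hD
    (-3 * (3 - 4 * ν))
  have h4 := (isSymbol_image_monomial' hc 1 1 0 5 0 (-3) (by norm_num) (by norm_num)).const_mul hD
    (6)
  have h5 := (isSymbol_image_monomial' hc 1 1 2 7 0 (-3) (by norm_num) (by norm_num)).const_mul hD
    (-30)
  refine (((((h0.add h1).add h2).add h3).add h4).add h5).congr rfl fun z t => ?_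
  simp only [atPoint, vvProfileRad]
  ring

theorem isSymbol_vvProfileDep (hc : 0 ≤ c) (ν : ℝ) :
    IsSymbol (regularDepths c) (fun t => t - c) (-2) (atPoint (vvProfileDep ν) c) := by
  have hD := sub_ne_zero_of_regular (c := c)
  have h0 := (isSymbol_source_monomial (c := c) 1 3 (-2) (by norm_num)).const_mul hD
    (2 - (3 - 4 * ν))
  have h1 := (isSymbol_source_monomial (c := c) 3 5 (-2) (by norm_num)).const_mul hD
    (-3)
  have h2 := (isSymbol_image_monomial' hc 0 0 1 3 0 (-2) (by norm_num) (by norm_num)).const_mul hD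
    (2 * (3 - 4 * ν) - (8 * (1 - ν) ^ 2 - (3 - 4 * ν)))
  have h3 := (isSymbol_image_monomial' hc 1 0 0 3 0 (-2) (by norm_num) (by norm_num)).const_mul hD
    (-2)
  have h4 := (isSymbol_image_monomial' hc 0 0 3 5 0 (-2) (by norm_num) (by norm_num)).const_mul hD
    (-3 * (3 - 4 * ν))
  have h5 := (isSymbol_image_monomial' hc 1 1 1 5 0 (-2) (by norm_num) (by norm_num)).const_mul hD
    (6)
  have h6 := (isSymbol_image_monomial' hc 1 0 2 5 0 (-2) (by norm_num) (by norm_num)).const_mul hD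
    (6)
  have h7 := (isSymbol_image_monomial' hc 1 1 1 5 0 (-2) (by norm_num) (by norm_num)).const_mul hD
    (12)
  have h8 := (isSymbol_image_monomial' hc 1 1 3 7 0 (-2) (by norm_num) (by norm_num)).const_mul hD
    (-30)
  refine ((((((((h0.add h1).add h2).add h3).add h4).add h5).add h6).add h7).add h8).congr rfl fun z t => ?_
  simp only [atPoint, vvProfileDep]
  ring

theorem isSymbol_vhProfile (hc : 0 ≤ c) (ν : ℝ) :
    IsSymbol (regularDepths c) (fun t => t - c) (-2) (atPoint (vhProfile ν) c) := by
  have hD := sub_ne_zero_of_regular (c := c)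
  have h0 := (isSymbol_source_monomial (c := c) 1 3 (-2) (by norm_num)).const_mul hD
    (1)
  have h1 := (isSymbol_image_monomial' hc 0 1 0 3 0 (-2) (by norm_num) (by norm_num)).const_mul hD
    (3 - 4 * ν)
  have h2 := (isSymbol_image_monomial' hc 1 0 0 3 0 (-2) (by norm_num) (by norm_num)).const_mul hD
    (-(3 - 4 * ν))
  have h3 := (isSymbol_image_monomial' hc 1 1 1 5 0 (-2) (by norm_num) (by norm_num)).const_mul hD
    (-(-6))
  have h4 := (isSymbol_image_monomial' hc 0 0 0 1 1 (-2) (by norm_num) (by norm_num)).const_mul hD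
    (-(4 * (1 - ν) * (1 - 2 * ν)))
  refine ((((h0.add h1).add h2).add h3).add h4).congr rfl fun z t => ?_
  simp only [atPoint, vhProfile]
  ring

theorem isSymbol_vhProfileRad (hc : 0 ≤ c) (ν : ℝ) :
    IsSymbol (regularDepths c) (fun t => t - c) (-4) (atPoint (vhProfileRad ν) c) := by
  have hD := sub_ne_zero_of_regular (c := c)
  have h0 := (isSymbol_source_monomial (c := c) 1 5 (-4) (by norm_num)).const_mul hD
    (-3)
  have h1 := (isSymbol_image_monomial' hc 0 1 0 5 0 (-4) (by norm_num) (by norm_num)).const_mul hD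
    (-3 * (3 - 4 * ν))
  have h2 := (isSymbol_image_monomial' hc 1 0 0 5 0 (-4) (by norm_num) (by norm_num)).const_mul hD
    (3 * (3 - 4 * ν))
  have h3 := (isSymbol_image_monomial' hc 1 1 1 7 0 (-4) (by norm_num) (by norm_num)).const_mul hD
    (-(30))
  have h4 := (isSymbol_image_monomial' hc 0 0 0 3 1 (-4) (by norm_num) (by norm_num)).const_mul hD
    (-(-(4 * (1 - ν) * (1 - 2 * ν))))
  have h5 := (isSymbol_image_monomial' hc 0 0 0 2 2 (-4) (by norm_num) (by norm_num)).const_mul hD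
    (-(-(4 * (1 - ν) * (1 - 2 * ν))))
  refine (((((h0.add h1).add h2).add h3).add h4).add h5).congr rfl fun z t => ?_
  simp only [atPoint, vhProfileRad]
  ring

theorem isSymbol_vhProfileDep (hc : 0 ≤ c) (ν : ℝ) :
    IsSymbol (regularDepths c) (fun t => t - c) (-3) (atPoint (vhProfileDep ν) c) := by
  have hD := sub_ne_zero_of_regular (c := c)
  have h0 := (isSymbol_source_monomial (c := c) 0 3 (-3) (by norm_num)).const_mul hD
    (1)
  have h1 := (isSymbol_source_monomial (c := c) 2 5 (-3) (by norm_num)).const_mul hD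
    (-3)
  have h2 := (isSymbol_image_monomial' hc 0 0 0 3 0 (-3) (by norm_num) (by norm_num)).const_mul hD
    (3 - 4 * ν)
  have h3 := (isSymbol_image_monomial' hc 0 1 1 5 0 (-3) (by norm_num) (by norm_num)).const_mul hD
    (-3 * (3 - 4 * ν))
  have h4 := (isSymbol_image_monomial' hc 1 0 1 5 0 (-3) (by norm_num) (by norm_num)).const_mul hD
    (3 * (3 - 4 * ν))
  have h5 := (isSymbol_image_monomial' hc 1 0 1 5 0 (-3) (by norm_num) (by norm_num)).const_mul hD
    (-(-6))
  have h6 := (isSymbol_image_monomial' hc 1 1 0 5 0 (-3) (by norm_num) (by norm_num)).const_mul hD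
    (-(-6))
  have h7 := (isSymbol_image_monomial' hc 1 1 2 7 0 (-3) (by norm_num) (by norm_num)).const_mul hD
    (-(30))
  have h8 := (isSymbol_image_monomial' hc 0 0 1 3 1 (-3) (by norm_num) (by norm_num)).const_mul hD
    (-(-(4 * (1 - ν) * (1 - 2 * ν))))
  have h9 := (isSymbol_image_monomial' hc 0 0 0 2 1 (-3) (by norm_num) (by norm_num)).const_mul hD
    (-(-(4 * (1 - ν) * (1 - 2 * ν))))
  refine (((((((((h0.add h1).add h2).add h3).add h4).add h5).add h6).add h7).add h8).add h9).congr rfl fun z t => ?_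
  simp only [atPoint, vhProfileDep]
  ring

end ProfileSymbols

/-! ### Explicit components of the gradient -/

/-- The common factor of the entries of `mindlinG`. -/
noncomputable def mindlinFactor (μ ν : ℝ) : ℝ := 1 / (16 * π * μ * (1 - ν))

section Entries

variable (μ ν : ℝ) (z : Plane) (c t : ℝ)

theorem mindlinG_castSucc_castSucc (k i : Fin 2) :
    mindlinG μ ν z c t k.castSucc i.castSucc = mindlinFactor μ ν *
      ((if k = i then atPoint (isoProfile ν) c z t else 0)
        + z k * z i * atPoint (devProfile ν) c z t) := by
  fin_cases k <;> fin_cases i <;>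
    simp [mindlinG, mindlinFactor, atPoint, isoProfile, devProfile, invR₁, invR₂, invLog, slant,
      div_eq_mul_inv, add_assoc, mul_inv, -mul_inv_rev]

theorem mindlinG_castSucc_two (k : Fin 2) :
    mindlinG μ ν z c t k.castSucc 2 = mindlinFactor μ ν *
      (z k * atPoint (hvProfile ν) c z t) := by
  fin_cases k <;>
    simp [mindlinG, mindlinFactor, atPoint, hvProfile, invR₁, invR₂, invLog, slant,
      div_eq_mul_inv, add_assoc, mul_assoc, mul_inv, -mul_inv_rev]

theorem mindlinG_two_castSucc (i : Fin 2) :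
    mindlinG μ ν z c t 2 i.castSucc = mindlinFactor μ ν *
      (z i * atPoint (vhProfile ν) c z t) := by
  fin_cases i <;>
    simp [mindlinG, mindlinFactor, atPoint, vhProfile, invR₁, invR₂, invLog, slant,
      div_eq_mul_inv, add_assoc, mul_assoc, mul_inv, -mul_inv_rev]

theorem mindlinG_two_two :
    mindlinG μ ν z c t 2 2 = mindlinFactor μ ν * atPoint (vvProfile ν) c z t := by
  simp [mindlinG, mindlinFactor, atPoint, vvProfile, invR₁, invR₂, slant, div_eq_mul_inv]

theorem mindlinGradG_castSucc (k i : Fin 3) (j : Fin 2) :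
    mindlinGradG μ ν z c t k i j.castSucc
      = deriv (fun s : ℝ => mindlinG μ ν (z + s • EuclideanSpace.single j 1) c t k i) 0 := by
  fin_cases j <;> simp [mindlinGradG]

theorem mindlinGradG_two (k i : Fin 3) :
    mindlinGradG μ ν z c t k i 2 = deriv (fun s : ℝ => mindlinG μ ν z c s k i) t := by
  simp [mindlinGradG]

theorem hasDerivAt_coord_line (j k : Fin 2) :
    HasDerivAt (fun s : ℝ => (z + s • EuclideanSpace.single j 1 : Plane) k)
      (if j = k then 1 else 0) 0 := by
  by_cases h : j = k
  · subst h
    simpa using (hasDerivAt_id' (0 : ℝ)).const_add (z j)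
  · have : (fun s : ℝ => (z + s • EuclideanSpace.single j 1 : Plane) k) = fun _ => z k := by
      ext s
      simp [Ne.symm h]
    rw [this, if_neg h]
    exact hasDerivAt_const _ _

end Entries

section Gradient

variable {μ ν : ℝ} {c t : ℝ}

theorem mindlinGradG_hhh (hc : 0 ≤ c) (ht : t ∈ regularDepths c) (z : Plane) (k i j : Fin 2) :
    mindlinGradG μ ν z c t k.castSucc i.castSucc j.castSucc = mindlinFactor μ ν *
      ((if k = i then z j * atPoint (isoProfileRad ν) c z t else 0)
        + ((if j = k then z i * atPoint (devProfile ν) c z t else 0)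
          + (if j = i then z k * atPoint (devProfile ν) c z t else 0)
          + z k * z i * (z j * atPoint (devProfileRad ν) c z t))) := by
  rw [mindlinGradG_castSucc]
  simp only [mindlinG_castSucc_castSucc]
  have hL := hasLineDerivs hc ht z j
  have h1 := hL.isoProfile (ν := ν) (c := c) (t := t)
  have h2 := hL.devProfile (ν := ν) (c := c) (t := t)
  have h3 := ((hasDerivAt_coord_line z j k).fun_mul (hasDerivAt_coord_line z j i)).fun_mul h2
  simp only [zero_smul, add_zero] at h1 h3
  refine HasDerivAt.deriv ?_
  refine HasDerivAt.const_mul _ ?_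
  -- For `k ≠ i` the isotropic part is absent, and its place in the sum is taken by the constant
  -- `0`.
  split_ifs at h3 ⊢ <;>
  first
  | exact (h1.fun_add h3).congr_deriv (by simp only [atPoint]; ring)
  | exact (h3.const_add 0).congr_deriv (by simp only [atPoint]; ring)

theorem mindlinGradG_hhv (hc : 0 ≤ c) (ht : t ∈ regularDepths c) (z : Plane) (k i : Fin 2) :
    mindlinGradG μ ν z c t k.castSucc i.castSucc 2 = mindlinFactor μ ν *
      ((if k = i then atPoint (isoProfileDep ν) c z t else 0)
        + z k * z i * atPoint (devProfileDep ν) c z t) := by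
  rw [mindlinGradG_two]
  simp only [mindlinG_castSucc_castSucc]
  have hL := hasDepthDerivs hc ht z
  have h1 := hL.isoProfile (ν := ν)
  have h2 := (hL.devProfile (ν := ν)).const_mul (z k * z i)
  refine HasDerivAt.deriv (HasDerivAt.const_mul _ ?_)
  split_ifs
  · exact h1.fun_add h2
  · exact (h2.const_add 0).congr_deriv (by simp only [atPoint]; ring)

theorem mindlinGradG_hvh (hc : 0 ≤ c) (ht : t ∈ regularDepths c) (z : Plane) (k j : Fin 2) :
    mindlinGradG μ ν z c t k.castSucc 2 j.castSucc = mindlinFactor μ ν *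
      ((if j = k then atPoint (hvProfile ν) c z t else 0)
        + z k * (z j * atPoint (hvProfileRad ν) c z t)) := by
  rw [mindlinGradG_castSucc]
  simp only [mindlinG_castSucc_two]
  have h2 := (hasLineDerivs hc ht z j).hvProfile (ν := ν) (c := c) (t := t)
  have h3 := (hasDerivAt_coord_line z j k).fun_mul h2
  simp only [zero_smul, add_zero] at h3
  refine HasDerivAt.deriv (HasDerivAt.const_mul _ (h3.congr_deriv ?_))
  split_ifs <;> (simp only [atPoint]; ring)

theorem mindlinGradG_hvv (hc : 0 ≤ c) (ht : t ∈ regularDepths c) (z : Plane) (k : Fin 2) :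
    mindlinGradG μ ν z c t k.castSucc 2 2 = mindlinFactor μ ν *
      (z k * atPoint (hvProfileDep ν) c z t) := by
  rw [mindlinGradG_two]
  simp only [mindlinG_castSucc_two]
  exact ((((hasDepthDerivs hc ht z).hvProfile (ν := ν)).const_mul (z k)).const_mul _).deriv

theorem mindlinGradG_vhh (hc : 0 ≤ c) (ht : t ∈ regularDepths c) (z : Plane) (i j : Fin 2) :
    mindlinGradG μ ν z c t 2 i.castSucc j.castSucc = mindlinFactor μ ν *
      ((if j = i then atPoint (vhProfile ν) c z t else 0)
        + z i * (z j * atPoint (vhProfileRad ν) c z t)) := by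
  rw [mindlinGradG_castSucc]
  simp only [mindlinG_two_castSucc]
  have h2 := (hasLineDerivs hc ht z j).vhProfile (ν := ν) (c := c) (t := t)
  have h3 := (hasDerivAt_coord_line z j i).fun_mul h2
  simp only [zero_smul, add_zero] at h3
  refine HasDerivAt.deriv (HasDerivAt.const_mul _ (h3.congr_deriv ?_))
  split_ifs <;> (simp only [atPoint]; ring)

theorem mindlinGradG_vhv (hc : 0 ≤ c) (ht : t ∈ regularDepths c) (z : Plane) (i : Fin 2) :
    mindlinGradG μ ν z c t 2 i.castSucc 2 = mindlinFactor μ ν *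
      (z i * atPoint (vhProfileDep ν) c z t) := by
  rw [mindlinGradG_two]
  simp only [mindlinG_two_castSucc]
  exact ((((hasDepthDerivs hc ht z).vhProfile (ν := ν)).const_mul (z i)).const_mul _).deriv

theorem mindlinGradG_vvh (hc : 0 ≤ c) (ht : t ∈ regularDepths c) (z : Plane) (j : Fin 2) :
    mindlinGradG μ ν z c t 2 2 j.castSucc = mindlinFactor μ ν *
      (z j * atPoint (vvProfileRad ν) c z t) := by
  rw [mindlinGradG_castSucc]
  simp only [mindlinG_two_two]
  have h2 := (hasLineDerivs hc ht z j).vvProfile (ν := ν) (c := c) (t := t)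
  simp only [zero_smul, add_zero] at h2
  exact (h2.const_mul _).deriv

theorem mindlinGradG_vvv (hc : 0 ≤ c) (ht : t ∈ regularDepths c) (z : Plane) :
    mindlinGradG μ ν z c t 2 2 2 = mindlinFactor μ ν * atPoint (vvProfileDep ν) c z t := by
  rw [mindlinGradG_two]
  simp only [mindlinG_two_two]
  exact (((hasDepthDerivs hc ht z).vvProfile (ν := ν)).const_mul _).deriv

end Gradient

/-! ### The components of the gradient are half-space kernels -/

section Kernels

variable {c : ℝ}

@[simp] theorem atPoint_rot (φ : ℝ → ℝ → ℝ → ℝ → ℝ → ℝ) (c : ℝ) (z : Plane) (t : ℝ) :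
    atPoint φ c (rot z) t = atPoint φ c z t := by
  simp [atPoint, invR₁, invR₂, invLog, slant]

theorem IsHalfSpaceKernel.const_mul {H : Plane → ℝ → ℝ} (hH : IsHalfSpaceKernel c H) (x : ℝ) :
    IsHalfSpaceKernel c (fun z t => x * H z t) := by
  refine ⟨hH.symbol.const_mul sub_ne_zero_of_regular x, (hH.rotSum.const_mul x).congr ?_⟩
  intro z t _
  simp only [_root_.rotSum]
  ring

theorem IsSymbol.zero {D : Set ℝ} {h : ℝ → ℝ} {p : ℤ} : IsSymbol D h p (fun _ _ => 0) :=
  ⟨measurable_const, 0, le_rfl, by simp⟩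

theorem IsSymbol.ite {D : Set ℝ} {h : ℝ → ℝ} {p : ℤ} {F : Plane → ℝ → ℝ} (P : Prop) [Decidable P]
    (hF : IsSymbol D h p F) : IsSymbol D h p (fun z t => if P then F z t else 0) := by
  split_ifs
  · exact hF
  · exact .zero

theorem IsSymbol.coord_mul {D : Set ℝ} {h : ℝ → ℝ} {p q : ℤ} {F : Plane → ℝ → ℝ} (i : Fin 2)
    (hD : ∀ t ∈ D, h t ≠ 0) (hF : IsSymbol D h p F) (hpq : 1 + p = q) :
    IsSymbol D h q (fun z t => z i * F z t) :=
  ((IsSymbol.coord i).mul hD hF).congr hpq fun _ _ => rfl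

/-- Each term is a rotation-invariant profile times an odd monomial in `z`. Two right-angle
rotations compose to `-1`, so the four rotated values cancel exactly. -/
theorem isHalfSpaceKernel_hhh (hc : 0 ≤ c) (ν : ℝ) (k i j : Fin 2) :
    IsHalfSpaceKernel c (fun z t =>
      (if k = i then z j * atPoint (isoProfileRad ν) c z t else 0)
        + ((if j = k then z i * atPoint (devProfile ν) c z t else 0)
          + (if j = i then z k * atPoint (devProfile ν) c z t else 0)
          + z k * z i * (z j * atPoint (devProfileRad ν) c z t))) := by
  have hD := sub_ne_zero_of_regular (c := c)
  constructor
  · have h1 := ((isSymbol_isoProfileRad hc ν).coord_mul j hD (q := -2) (by norm_num)).ite (k = i)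
    have h2 := ((isSymbol_devProfile hc ν).coord_mul i hD (q := -2) (by norm_num)).ite (j = k)
    have h3 := ((isSymbol_devProfile hc ν).coord_mul k hD (q := -2) (by norm_num)).ite (j = i)
    have h4 := (((isSymbol_devProfileRad hc ν).coord_mul j hD rfl).coord_mul i hD rfl).coord_mul k hD
      (q := -2) (by norm_num)
    exact (h1.add ((h2.add h3).add h4)).congr rfl (fun z t => by ring)
  · refine IsPoissonPair.zero.congr fun z t _ => ?_
    fin_cases k <;> fin_cases i <;> fin_cases j <;> simp [rotSum] <;> ring

/-- Over the four rotations `z k * z i` sums to `2‖z‖²` if `k = i` and to zero otherwise, so only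
the trace combination `2 iso + ‖z‖² dev` has to be bounded. -/
theorem isHalfSpaceKernel_hhv (hc : 0 ≤ c) (ν : ℝ) (k i : Fin 2) :
    IsHalfSpaceKernel c (fun z t => (if k = i then atPoint (isoProfileDep ν) c z t else 0)
        + z k * z i * atPoint (devProfileDep ν) c z t) := by
  have hD := sub_ne_zero_of_regular (c := c)
  constructor
  · have h1 := (isSymbol_isoProfileDep hc ν).ite (k = i)
    have h2 := ((isSymbol_devProfileDep hc ν).coord_mul i hD rfl).coord_mul k hD
      (q := -2) (by norm_num)
    exact (h1.add h2).congr rfl (fun z t => by ring)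
  · have key : IsPoissonPair c (fun z t => 2 * (2 * atPoint (isoProfileDep ν) c z t
        + ‖z‖ ^ 2 * atPoint (devProfileDep ν) c z t)) := by
      have s1 := (isPoissonPair_source (c := c) 0 3 (by norm_num)).const_mul
        (-2 * (3 - 4 * ν) - 3)
      have s2 := (isPoissonPair_source (c := c) 2 5 (by norm_num)).const_mul 3
      have a1 := (isPoissonPair_image_add hc 0 0 0 3 0 (by norm_num)).const_mul
        (-2 - 3 * (3 - 4 * ν) - 4 * (1 - ν) * (1 - 2 * ν))
      have a2 := (isPoissonPair_image_const hc 0 0 0 3 0 (by norm_num)).const_mul (-2)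
      have a3 := (isPoissonPair_image_const hc 0 1 1 5 0 (by norm_num)).const_mul 18
      have a4 := (isPoissonPair_image_add hc 0 0 2 5 0 (by norm_num)).const_mul (3 * (3 - 4 * ν))
      have a5 := (isPoissonPair_image_const hc 0 0 2 5 0 (by norm_num)).const_mul 6
      have a6 := (isPoissonPair_image_const hc 0 1 3 7 0 (by norm_num)).const_mul (-30)
      refine ((((((((s1.add s2).add a1).add a2).add a3).add a4).add a5).add a6).const_mul 2).congr ?_
      intro z t ht
      have r1 := normSq_mul_invR₁ z ht
      have r2 := normSq_mul_invR₂ hc z ht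
      have r3 := normSq_mul_invLog hc z ht
      have r4 := invLog_mul hc z ht
      simp only [atPoint, isoProfileDep, devProfileDep]
      generalize invR₁ c z t = A at *
      generalize invR₂ c z t = B at *
      generalize invLog c z t = G at *
      -- The relations eliminate `‖z‖²`. In the logarithmic part the terms `2 B G` without a depth
      -- factor cancel, and what remains, `-(t + c) B² G (1 + (t + c) B)`, equals `-(t + c) B³`.
      -- This is the last summand in the coefficient of `a1`.
      linear_combination (-6 * (t - c) * A ^ 3) * r1
        + 2 * ((-3 * (3 - 4 * ν) * (t + c) - 6 * c) * B ^ 3 + 30 * c * t * (t + c) * B ^ 5) * r2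
        + 2 * (4 * (1 - ν) * (1 - 2 * ν)) * (((t + c) * B ^ 2 * G + 2 * B * G) * r3
          - (t + c) * B ^ 2 * r4)
    refine (key.ite (k = i)).congr fun z t _ => ?_
    simp only [norm_sq_plane]
    fin_cases k <;> fin_cases i <;> simp [rotSum] <;> ring

theorem isHalfSpaceKernel_hvh (hc : 0 ≤ c) (ν : ℝ) (k j : Fin 2) :
    IsHalfSpaceKernel c (fun z t => (if j = k then atPoint (hvProfile ν) c z t else 0)
        + z k * (z j * atPoint (hvProfileRad ν) c z t)) := by
  have hD := sub_ne_zero_of_regular (c := c)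
  constructor
  · exact ((isSymbol_hvProfile hc ν).ite (j = k)).add
      (((isSymbol_hvProfileRad hc ν).coord_mul j hD rfl).coord_mul k hD (by norm_num))
  · have key : IsPoissonPair c (fun z t => 2 * (2 * atPoint (hvProfile ν) c z t
        + ‖z‖ ^ 2 * atPoint (hvProfileRad ν) c z t)) := by
      have s1 := (isPoissonPair_source (c := c) 0 3 (by norm_num)).const_mul (-1)
      have s2 := (isPoissonPair_source (c := c) 2 5 (by norm_num)).const_mul 3
      have a1 := (isPoissonPair_image_add hc 0 0 0 3 0 (by norm_num)).const_mul
        (-(3 - 4 * ν) + 4 * (1 - ν) * (1 - 2 * ν))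
      have a2 := (isPoissonPair_image_const hc 0 0 0 3 0 (by norm_num)).const_mul (2 * (3 - 4 * ν))
      have a3 := (isPoissonPair_image_const hc 0 1 1 5 0 (by norm_num)).const_mul 18
      have a4 := (isPoissonPair_image_add hc 0 0 2 5 0 (by norm_num)).const_mul (3 * (3 - 4 * ν))
      have a5 := (isPoissonPair_image_const hc 0 0 2 5 0 (by norm_num)).const_mul (-6 * (3 - 4 * ν))
      have a6 := (isPoissonPair_image_const hc 0 1 3 7 0 (by norm_num)).const_mul (-30)
      refine ((((((((s1.add s2).add a1).add a2).add a3).add a4).add a5).add a6).const_mul 2).congr ?_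
      intro z t ht
      have r1 := normSq_mul_invR₁ z ht
      have r2 := normSq_mul_invR₂ hc z ht
      have r3 := normSq_mul_invLog hc z ht
      have r4 := invLog_mul hc z ht
      simp only [atPoint, hvProfile, hvProfileRad]
      generalize invR₁ c z t = A at *
      generalize invR₂ c z t = B at *
      generalize invLog c z t = G at *
      -- The logarithmic part reduces to `B G (1 + (t + c) B) - B² + (t + c) B³`. The first two
      -- terms cancel by `r4`, leaving one with a depth factor.
      linear_combination (-6 * (t - c) * A ^ 3) * r1
        + 2 * (-3 * (3 - 4 * ν) * (t - c) * B ^ 3 + 30 * c * t * (t + c) * B ^ 5) * r2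
        + 2 * (4 * (1 - ν) * (1 - 2 * ν)) * (-(B ^ 2 + B * G) * r3 + B * r4)
    refine (key.ite (j = k)).congr fun z t _ => ?_
    simp only [norm_sq_plane]
    fin_cases k <;> fin_cases j <;> simp [rotSum] <;> ring

theorem isHalfSpaceKernel_vhh (hc : 0 ≤ c) (ν : ℝ) (i j : Fin 2) :
    IsHalfSpaceKernel c (fun z t => (if j = i then atPoint (vhProfile ν) c z t else 0)
        + z i * (z j * atPoint (vhProfileRad ν) c z t)) := by
  have hD := sub_ne_zero_of_regular (c := c)
  constructor
  · exact ((isSymbol_vhProfile hc ν).ite (j = i)).add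
      (((isSymbol_vhProfileRad hc ν).coord_mul j hD rfl).coord_mul i hD (by norm_num))
  · have key : IsPoissonPair c (fun z t => 2 * (2 * atPoint (vhProfile ν) c z t
        + ‖z‖ ^ 2 * atPoint (vhProfileRad ν) c z t)) := by
      have s1 := (isPoissonPair_source (c := c) 0 3 (by norm_num)).const_mul (-1)
      have s2 := (isPoissonPair_source (c := c) 2 5 (by norm_num)).const_mul 3
      have a1 := (isPoissonPair_image_add hc 0 0 0 3 0 (by norm_num)).const_mul
        (-(3 - 4 * ν) - 4 * (1 - ν) * (1 - 2 * ν))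
      have a2 := (isPoissonPair_image_const hc 0 0 0 3 0 (by norm_num)).const_mul (2 * (3 - 4 * ν))
      have a3 := (isPoissonPair_image_const hc 0 1 1 5 0 (by norm_num)).const_mul (-18)
      have a4 := (isPoissonPair_image_add hc 0 0 2 5 0 (by norm_num)).const_mul (3 * (3 - 4 * ν))
      have a5 := (isPoissonPair_image_const hc 0 0 2 5 0 (by norm_num)).const_mul (-6 * (3 - 4 * ν))
      have a6 := (isPoissonPair_image_const hc 0 1 3 7 0 (by norm_num)).const_mul 30
      refine ((((((((s1.add s2).add a1).add a2).add a3).add a4).add a5).add a6).const_mul 2).congr ?_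
      intro z t ht
      have r1 := normSq_mul_invR₁ z ht
      have r2 := normSq_mul_invR₂ hc z ht
      have r3 := normSq_mul_invLog hc z ht
      have r4 := invLog_mul hc z ht
      simp only [atPoint, vhProfile, vhProfileRad]
      generalize invR₁ c z t = A at *
      generalize invR₂ c z t = B at *
      generalize invLog c z t = G at *
      linear_combination (-6 * (t - c) * A ^ 3) * r1
        + 2 * (-3 * (3 - 4 * ν) * (t - c) * B ^ 3 - 30 * c * t * (t + c) * B ^ 5) * r2
        - 2 * (4 * (1 - ν) * (1 - 2 * ν)) * (-(B ^ 2 + B * G) * r3 + B * r4)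
    refine (key.ite (j = i)).congr fun z t _ => ?_
    simp only [norm_sq_plane]
    fin_cases i <;> fin_cases j <;> simp [rotSum] <;> ring

/-- A radial profile of order `-3` times a coordinate has vanishing rotational averages. -/
theorem isHalfSpaceKernel_coord_mul {φ : ℝ → ℝ → ℝ → ℝ → ℝ → ℝ}
    (hφ : IsSymbol (regularDepths c) (fun t => t - c) (-3) (atPoint φ c)) (i : Fin 2) :
    IsHalfSpaceKernel c (fun z t => z i * atPoint φ c z t) := by
  refine ⟨hφ.coord_mul i sub_ne_zero_of_regular (by norm_num), IsPoissonPair.zero.congr ?_⟩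
  intro z t _
  fin_cases i <;> simp [rotSum]

/-- This component is radial, so averaging gains nothing. However, every term of the depth
derivative already contains a factor `t - c`, `t + c` or `c`. -/
theorem isHalfSpaceKernel_vvv (hc : 0 ≤ c) (ν : ℝ) :
    IsHalfSpaceKernel c (fun z t => atPoint (vvProfileDep ν) c z t) := by
  refine ⟨isSymbol_vvProfileDep hc ν, ?_⟩
  have s1 := (isPoissonPair_source (c := c) 0 3 (by norm_num)).const_mul (2 - (3 - 4 * ν))
  have s2 := (isPoissonPair_source (c := c) 2 5 (by norm_num)).const_mul (-3)
  have a1 := (isPoissonPair_image_add hc 0 0 0 3 0 (by norm_num)).const_mul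
    (2 * (3 - 4 * ν) - (8 * (1 - ν) ^ 2 - (3 - 4 * ν)))
  have a2 := (isPoissonPair_image_const hc 0 0 0 3 0 (by norm_num)).const_mul (-2)
  have a3 := (isPoissonPair_image_const hc 0 1 1 5 0 (by norm_num)).const_mul 18
  have a4 := (isPoissonPair_image_add hc 0 0 2 5 0 (by norm_num)).const_mul (-3 * (3 - 4 * ν))
  have a5 := (isPoissonPair_image_const hc 0 0 2 5 0 (by norm_num)).const_mul 6
  have a6 := (isPoissonPair_image_const hc 0 1 3 7 0 (by norm_num)).const_mul (-30)
  refine ((((((((s1.add s2).add a1).add a2).add a3).add a4).add a5).add a6).const_mul 4).congr ?_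
  intro z t ht
  simp only [rotSum, atPoint_rot]
  simp only [atPoint, vvProfileDep]
  ring

/-- The explicit formulas are available only at regular depths, so a component of `∇G` is exchanged
there for a kernel defined by its formula, which is measurable everywhere. The exceptional depth is
a null set. -/
theorem IsHalfSpaceKernel.exists_of_eqOn {H : Plane → ℝ → ℝ} {G : Plane → ℝ → ℝ} {x : ℝ}
    (hH : IsHalfSpaceKernel c H) (h : ∀ t ∈ regularDepths c, ∀ z, G z t = x * H z t) :
    ∃ H', IsHalfSpaceKernel c H' ∧ ∀ t ∈ regularDepths c, ∀ z, G z t = H' z t :=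
  ⟨_, hH.const_mul x, h⟩

/-- Every component of the gradient of Mindlin's tensor is a half-space kernel. -/
theorem exists_isHalfSpaceKernel_mindlinGradG (μ ν : ℝ) (hc : 0 ≤ c) (k i j : Fin 3) :
    ∃ H, IsHalfSpaceKernel c H ∧
      ∀ t ∈ regularDepths c, ∀ z, mindlinGradG μ ν z c t k i j = H z t := by
  induction k using Fin.lastCases with
  | last =>
    induction i using Fin.lastCases with
    | last =>
      induction j using Fin.lastCases with
      | last =>
        exact (isHalfSpaceKernel_vvv hc ν).exists_of_eqOn fun t ht z => mindlinGradG_vvv hc ht z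
      | cast j =>
        exact (isHalfSpaceKernel_coord_mul (isSymbol_vvProfileRad hc ν) j).exists_of_eqOn
          fun t ht z => mindlinGradG_vvh hc ht z j
    | cast i =>
      induction j using Fin.lastCases with
      | last =>
        exact (isHalfSpaceKernel_coord_mul (isSymbol_vhProfileDep hc ν) i).exists_of_eqOn
          fun t ht z => mindlinGradG_vhv hc ht z i
      | cast j =>
        exact (isHalfSpaceKernel_vhh hc ν i j).exists_of_eqOn
          fun t ht z => mindlinGradG_vhh hc ht z i j
  | cast k =>
    induction i using Fin.lastCases with
    | last =>
      induction j using Fin.lastCases with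
      | last =>
        exact (isHalfSpaceKernel_coord_mul (isSymbol_hvProfileDep hc ν) k).exists_of_eqOn
          fun t ht z => mindlinGradG_hvv hc ht z k
      | cast j =>
        exact (isHalfSpaceKernel_hvh hc ν k j).exists_of_eqOn
          fun t ht z => mindlinGradG_hvh hc ht z k j
    | cast i =>
      induction j using Fin.lastCases with
      | last =>
        exact (isHalfSpaceKernel_hhv hc ν k i).exists_of_eqOn
          fun t ht z => mindlinGradG_hhv hc ht z k i
      | cast j =>
        exact (isHalfSpaceKernel_hhh hc ν k i j).exists_of_eqOn
          fun t ht z => mindlinGradG_hhh hc ht z k i j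

end Kernels

/-! ### The periodic cell, the torus and Fourier series -/

/-- The normalized area on the horizontal section of the periodic cell. -/
noncomputable def cellMeasure (L : Fin 2 → ℝ) : Measure Plane :=
  ENNReal.ofReal (1 / (L 0 * L 1)) • volume.restrict (cell L)

/-- The point of the unit torus represented by a point of the plane. -/
noncomputable def torusMk (L : Fin 2 → ℝ) (y : Plane) : UnitAddTorus (Fin 2) :=
  fun b => ((y b / L b : ℝ) : UnitAddCircle)

/-- Rescaling of the periodic cell to the unit square. -/
noncomputable def cellScale (L : Fin 2 → ℝ) (y : Plane) : Fin 2 → ℝ := fun b => y b / L b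

/-- Periodicity with respect to the horizontal lattice. -/
def LatticePeriodic {α : Type*} (L : Fin 2 → ℝ) (f : Plane → α) : Prop :=
  ∀ b, Function.Periodic f (EuclideanSpace.single b (L b))

section Torus

-- With Haar measure of total mass one on the circle, integrals over the torus correspond without
-- constants to averages over the cell.
noncomputable local instance : MeasureSpace UnitAddCircle := ⟨AddCircle.haarAddCircle⟩
local instance : Measure.IsAddHaarMeasure (volume : Measure UnitAddCircle) :=
  inferInstanceAs (Measure.IsAddHaarMeasure AddCircle.haarAddCircle)
local instance : IsProbabilityMeasure (volume : Measure UnitAddCircle) :=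
  inferInstanceAs (IsProbabilityMeasure AddCircle.haarAddCircle)

variable {L : Fin 2 → ℝ} {E : Type*} [NormedAddCommGroup E] [NormedSpace ℝ E]

/-- `cellScale` as a measurable equivalence. -/
noncomputable def cellScaleEquiv (hL : ∀ b, 0 < L b) : Plane ≃ᵐ (Fin 2 → ℝ) :=
  (MeasurableEquiv.toLp 2 (Fin 2 → ℝ)).symm.trans
    (MeasurableEquiv.piCongrRight fun b => (Homeomorph.mulRight₀ (L b)⁻¹
      (inv_ne_zero (hL b).ne')).toMeasurableEquiv)

theorem coe_cellScaleEquiv (hL : ∀ b, 0 < L b) : ⇑(cellScaleEquiv hL) = cellScale L := by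
  ext y b
  simp [cellScaleEquiv, cellScale, div_eq_mul_inv, MeasurableEquiv.piCongrRight]

theorem measurePreserving_cellScale (hL : ∀ b, 0 < L b) :
    MeasurePreserving (cellScale L) (ENNReal.ofReal (1 / (L 0 * L 1)) • volume) volume := by
  refine ⟨coe_cellScaleEquiv hL ▸ (cellScaleEquiv hL).measurable, ?_⟩
  have h0 := hL 0
  have h1 := hL 1
  rw [Measure.map_smul]
  have e : cellScale L = (Matrix.toLin' (Matrix.diagonal fun b => (L b)⁻¹)) ∘
      (MeasurableEquiv.toLp 2 (Fin 2 → ℝ)).symm := by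
    ext y b
    simp [cellScale, Matrix.mulVec_diagonal, div_eq_inv_mul]
  have h2 := Real.smul_map_diagonal_volume_pi (ι := Fin 2) (D := fun b => (L b)⁻¹) (by
    simp [Matrix.det_diagonal, h0.ne', h1.ne'])
  rw [e, ← Measure.map_map (by fun_prop) (by fun_prop),
    (EuclideanSpace.volume_preserving_symm_measurableEquiv_toLp (Fin 2)).map_eq]
  rw [Matrix.det_diagonal, Fin.prod_univ_two, abs_of_pos (by positivity)] at h2
  rw [one_div, mul_inv]
  exact h2

/-- Integration over the torus uses a half-open unit square while the cell is open; they differ by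
faces of measure zero. -/
theorem cellScale_preimage_ae (hL : ∀ b, 0 < L b) :
    (cellScale L ⁻¹' {x | ∀ i, x i ∈ Ioc (-(1 / 2) : ℝ) (-(1 / 2) + 1)} : Set Plane)
      =ᵐ[volume] cell L := by
  have h : cell L = cellScale L ⁻¹' (Set.pi univ fun _ => Ioo (-(1 / 2) : ℝ) (-(1 / 2) + 1)) := by
    ext y
    simp only [cell, cellScale, mem_ofPred_eq, mem_preimage, mem_univ_pi]
    refine forall_congr' fun b => ?_
    have := hL b
    simp only [mem_Ioo, lt_div_iff₀ this, div_lt_iff₀ this]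
    constructor <;> rintro ⟨h1, h2⟩ <;> constructor <;> linarith
  have h' : {x : Fin 2 → ℝ | ∀ i, x i ∈ Ioc (-(1 / 2) : ℝ) (-(1 / 2) + 1)}
      =ᵐ[volume] Set.pi univ fun _ => Ioo (-(1 / 2) : ℝ) (-(1 / 2) + 1) := by
    have e : {x : Fin 2 → ℝ | ∀ i, x i ∈ Ioc (-(1 / 2) : ℝ) (-(1 / 2) + 1)}
      = Set.pi univ fun _ => Ioc (-(1 / 2) : ℝ) (-(1 / 2) + 1) := by ext; simp
    rw [e]
    exact (Measure.univ_pi_Ioc_ae_eq_Icc (μ := fun _ : Fin 2 => (volume : Measure ℝ))).trans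
      (Measure.univ_pi_Ioo_ae_eq_Icc (μ := fun _ : Fin 2 => (volume : Measure ℝ))).symm
  have hq := (measurePreserving_cellScale hL).quasiMeasurePreserving.preimage_ae_eq h'
  rw [h]
  have h0 := hL 0
  have h1 := hL 1
  have hne : ENNReal.ofReal (1 / (L 0 * L 1)) ≠ 0 := by
    rw [ne_eq, ENNReal.ofReal_eq_zero, not_le]; positivity
  exact (Measure.absolutelyContinuous_smul hne).ae_le hq

theorem cellMeasure_eq_restrict (hL : ∀ b, 0 < L b) :
    cellMeasure L = (ENNReal.ofReal (1 / (L 0 * L 1)) • volume).restrict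
      (cellScale L ⁻¹' {x | ∀ i, x i ∈ Ioc (-(1 / 2) : ℝ) (-(1 / 2) + 1)}) := by
  rw [Measure.restrict_smul, Measure.restrict_congr_set (cellScale_preimage_ae hL), cellMeasure]

/-- Integration over the cell is integration over the torus. -/
theorem integral_torusMk (hL : ∀ b, 0 < L b) (f : UnitAddTorus (Fin 2) → E) :
    ∫ y, f (torusMk L y) ∂cellMeasure L = ∫ x, f x := by
  rw [UnitAddTorus.integral_preimage f (fun _ => -(1 / 2)), cellMeasure_eq_restrict hL]
  exact (measurePreserving_cellScale hL).setIntegral_preimage_emb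
    (coe_cellScaleEquiv hL ▸ (cellScaleEquiv hL).measurableEmbedding)
    (fun x : Fin 2 → ℝ => f (fun i => (x i : UnitAddCircle))) _

theorem lintegral_torusMk (hL : ∀ b, 0 < L b) (f : UnitAddTorus (Fin 2) → ENNReal) :
    ∫⁻ y, f (torusMk L y) ∂cellMeasure L = ∫⁻ x, f x := by
  rw [UnitAddTorus.lintegral_preimage f (fun _ => -(1 / 2)), cellMeasure_eq_restrict hL]
  exact (measurePreserving_cellScale hL).setLIntegral_comp_preimage_emb
    (coe_cellScaleEquiv hL ▸ (cellScaleEquiv hL).measurableEmbedding)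
    (fun x : Fin 2 → ℝ => f (fun i => (x i : UnitAddCircle))) _

theorem continuous_torusMk : Continuous (torusMk L) :=
  continuous_pi fun b => (AddCircle.continuous_mk' 1).comp (by fun_prop)

theorem measurePreserving_torusMk (hL : ∀ b, 0 < L b) :
    MeasurePreserving (torusMk L) (cellMeasure L) volume := by
  refine ⟨continuous_torusMk.measurable, ?_⟩
  ext s hs
  rw [Measure.map_apply continuous_torusMk.measurable hs]
  have := lintegral_torusMk hL (s.indicator 1)
  rw [lintegral_indicator_one hs] at this
  rw [← this, ← lintegral_indicator_one (continuous_torusMk.measurable hs)]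
  rfl

theorem isProbabilityMeasure_cellMeasure (hL : ∀ b, 0 < L b) :
    IsProbabilityMeasure (cellMeasure L) := by
  have h := measurePreserving_torusMk hL
  refine ⟨?_⟩
  rw [← preimage_univ (f := torusMk L), h.measure_preimage MeasurableSet.univ.nullMeasurableSet]
  exact measure_univ

theorem torusMk_add (x y : Plane) : torusMk L (x + y) = torusMk L x + torusMk L y := by
  ext b
  simp [torusMk, add_div]

theorem LatticePeriodic.eq_of_torusMk_eq {α : Type*} (hL : ∀ b, 0 < L b) {f : Plane → α}
    (hf : LatticePeriodic L f) {x y : Plane} (h : torusMk L x = torusMk L y) : f x = f y := by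
  have hn : ∀ b, ∃ n : ℤ, y b = x b + n * L b := by
    intro b
    have hb := congrFun h b
    simp only [torusMk] at hb
    obtain ⟨n, hn⟩ := (AddCircle.coe_eq_zero_iff (1 : ℝ)).1
      (show (((y b / L b - x b / L b : ℝ)) : UnitAddCircle) = 0 by
        rw [AddCircle.coe_sub, hb, sub_self])
    refine ⟨n, ?_⟩
    have := (hL b).ne'
    simp only [zsmul_eq_mul, mul_one] at hn
    rw [hn]
    field_simp
    ring
  choose n hn using hn
  have e : y = x + n 0 • EuclideanSpace.single 0 (L 0) + n 1 • EuclideanSpace.single 1 (L 1) := by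
    ext b
    fin_cases b <;> simp [hn]
  rw [e, (hf 1).zsmul (n 1) _, (hf 0).zsmul (n 0) _]

theorem surjective_torusMk (hL : ∀ b, 0 < L b) : Function.Surjective (torusMk L) := by
  intro x
  choose r hr using fun b => QuotientAddGroup.mk_surjective (x b)
  refine ⟨WithLp.toLp 2 fun b => r b * L b, ?_⟩
  ext b
  have := (hL b).ne'
  simp only [torusMk]
  rw [mul_div_assoc, div_self this, mul_one]
  exact hr b

theorem LatticePeriodic.exists_eq_comp {α : Type*} (hL : ∀ b, 0 < L b) {f : Plane → α}
    (hf : LatticePeriodic L f) : ∃ F : UnitAddTorus (Fin 2) → α, ∀ y, f y = F (torusMk L y) := by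
  choose r hr using surjective_torusMk hL
  exact ⟨fun x => f (r x), fun y => hf.eq_of_torusMk_eq hL (hr _).symm⟩

/-- A periodic function factors through the torus, where this is translation invariance of Haar
measure. No measurability of `f` enters. -/
theorem LatticePeriodic.integral_add (hL : ∀ b, 0 < L b) {f : Plane → E}
    (hf : LatticePeriodic L f) (a : Plane) :
    ∫ y, f (y + a) ∂cellMeasure L = ∫ y, f y ∂cellMeasure L := by
  obtain ⟨F, hF⟩ := hf.exists_eq_comp hL
  simp only [hF, torusMk_add]
  rw [integral_torusMk hL (fun x => F (x + torusMk L a)), integral_torusMk hL F]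
  exact integral_add_right_eq_self F _

/-- The cell is symmetric under `y ↦ -y`, which reduces the reflection to a translation. -/
theorem LatticePeriodic.integral_sub_left (hL : ∀ b, 0 < L b) {f : Plane → E}
    (hf : LatticePeriodic L f) (a : Plane) :
    ∫ y, f (a - y) ∂cellMeasure L = ∫ y, f y ∂cellMeasure L := by
  have h1 : LatticePeriodic L (fun y => f (a - y)) := fun b y => by
    have := hf b (a - (y + EuclideanSpace.single b (L b)))
    simp only [← this]
    congr 1
    abel
  have h2 := h1.integral_add hL a
  rw [← h2]
  have h3 := (Measure.measurePreserving_neg (volume : Measure Plane)).setIntegral_preimage_emb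
    (Homeomorph.neg Plane).measurableEmbedding f (cell L)
  have h4 : (Neg.neg ⁻¹' cell L : Set Plane) = cell L := by
    ext y
    simp only [cell, mem_preimage, mem_ofPred_eq, PiLp.neg_apply, mem_Ioo]
    exact forall_congr' fun b => ⟨fun h => ⟨by linarith, by linarith⟩,
      fun h => ⟨by linarith, by linarith⟩⟩
  simp only [sub_add_cancel_right, cellMeasure, integral_smul_measure]
  rw [← h3, h4]

theorem ae_norm_le_cellMeasure (L : Fin 2 → ℝ) : ∀ᵐ a ∂cellMeasure L, ‖a‖ ≤ L 0 + L 1 := by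
  refine Measure.ae_smul_measure ?_ _
  have hm : MeasurableSet (cell L) := by
    simp only [cell, Set.ofPred_forall]
    exact MeasurableSet.iInter fun b => measurableSet_Ioo.preimage (by fun_prop)
  filter_upwards [ae_restrict_mem hm] with a ha
  have h0 := ha 0
  have h1 := ha 1
  simp only [mem_Ioo] at h0 h1
  refine abs_le_of_sq_le_sq' ?_ (by linarith) |>.2
  rw [norm_sq_plane]
  nlinarith

theorem cellCoeff_eq (hL : ∀ b, 0 < L b) (f : Plane → ℂ) (k : Fin 2 → ℤ) :
    cellCoeff L f k = ∫ y, f y * cellExp L (-k) y ∂cellMeasure L := by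
  have h0 := hL 0
  have h1 := hL 1
  rw [cellCoeff, cellMeasure, integral_smul_measure, ENNReal.toReal_ofReal (by positivity),
    Complex.real_smul]
  push_cast
  rfl

theorem inner_kbar (k : Fin 2 → ℤ) (y : Plane) :
    inner ℝ (kbar L k) y = k 0 * (y 0 / L 0) + k 1 * (y 1 / L 1) := by
  simp [kbar, PiLp.inner_apply, Fin.sum_univ_two]
  ring

theorem cellExp_eq_mFourier (k : Fin 2 → ℤ) (y : Plane) :
    cellExp L k y = UnitAddTorus.mFourier k (torusMk L y) := by
  simp only [UnitAddTorus.mFourier, ContinuousMap.coe_mk, Fin.prod_univ_two, torusMk,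
    fourier_coe_apply]
  rw [cellExp, inner_kbar, ← Complex.exp_add]
  congr 1
  push_cast
  ring

theorem cellExp_add (k : Fin 2 → ℤ) (x y : Plane) :
    cellExp L k (x + y) = cellExp L k x * cellExp L k y := by
  simp only [cellExp]
  rw [← Complex.exp_add, inner_add_right]
  congr 1
  push_cast
  ring

theorem cellExp_neg (k : Fin 2 → ℤ) (x : Plane) : cellExp L k (-x) = cellExp L (-k) x := by
  simp only [cellExp]
  congr 3
  rw [inner_kbar, inner_kbar]
  simp
  ring

@[simp] theorem norm_cellExp (k : Fin 2 → ℤ) (x : Plane) : ‖cellExp L k x‖ = 1 := by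
  rw [cellExp, show (2 * π * Complex.I * (inner ℝ (kbar L k) x : ℝ) : ℂ)
    = ((2 * π * inner ℝ (kbar L k) x : ℝ) : ℂ) * Complex.I by push_cast; ring]
  exact Complex.norm_exp_ofReal_mul_I _

theorem continuous_cellExp (L : Fin 2 → ℝ) (k : Fin 2 → ℤ) : Continuous (cellExp L k) := by
  unfold cellExp
  fun_prop

theorem cellExp_zero (x : Plane) : cellExp L 0 x = 1 := by
  simp [cellExp, inner_kbar]

theorem cellExp_mul_neg (k : Fin 2 → ℤ) (x : Plane) : cellExp L k x * cellExp L (-k) x = 1 := by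
  rw [← cellExp_neg, ← cellExp_add]
  simp [cellExp]

theorem latticePeriodic_torusMk (hL : ∀ b, 0 < L b) : LatticePeriodic L (torusMk L) := by
  intro b y
  rw [torusMk_add]
  have : torusMk L (EuclideanSpace.single b (L b)) = 0 := by
    ext d
    have := (hL b).ne'
    by_cases h : d = b
    · subst h
      simp [torusMk, this]
    · simp [torusMk, h]
  rw [this, add_zero]

theorem latticePeriodic_cellExp (hL : ∀ b, 0 < L b) (k : Fin 2 → ℤ) :
    LatticePeriodic L (cellExp L k) := by
  intro b y
  rw [cellExp_eq_mFourier, cellExp_eq_mFourier, latticePeriodic_torusMk hL b]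

theorem integral_cellExp (hL : ∀ b, 0 < L b) (k : Fin 2 → ℤ) :
    ∫ y, cellExp L k y ∂cellMeasure L = if k = 0 then 1 else 0 := by
  have := isProbabilityMeasure_cellMeasure hL
  split_ifs with h
  · subst h
    simp [cellExp_zero]
  · obtain ⟨b, hb⟩ := Function.ne_iff.1 h
    simp only [Pi.zero_apply, ne_eq] at hb
    -- A shift by half a wavelength in a direction with `k b ≠ 0` changes the sign of the character,
    -- while its mean is invariant under shifts. Hence the mean vanishes.
    set a : Plane := EuclideanSpace.single b (L b / (2 * k b)) with ha
    have hk : (k b : ℝ) ≠ 0 := by exact_mod_cast hb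
    have hLb := (hL b).ne'
    have e : cellExp L k a = -1 := by
      have : inner ℝ (kbar L k) a = 1 / 2 := by
        have h : ∀ (b : Fin 2) (r : ℝ),
            inner ℝ (kbar L k) (EuclideanSpace.single b r) = k b * (r / L b) := by
          intro b r
          rw [inner_kbar]
          fin_cases b <;> simp
        rw [ha, h]
        field_simp
      rw [cellExp, this, ← Complex.exp_pi_mul_I]
      congr 1
      push_cast
      ring
    have h2 := (latticePeriodic_cellExp hL k).integral_add hL a
    simp only [cellExp_add, e, mul_neg, mul_one, integral_neg] at h2
    exact self_eq_neg.1 h2.symm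

/-- Needed for continuity on the plane to descend to the torus. -/
theorem isOpenQuotientMap_torusMk (hL : ∀ b, 0 < L b) : IsOpenQuotientMap (torusMk L) := by
  refine ⟨surjective_torusMk hL, continuous_torusMk, ?_⟩
  have h1 : IsOpenMap (fun (x : Fin 2 → ℝ) b => (x b : UnitAddCircle)) :=
    IsOpenMap.piMap (fun _ => QuotientAddGroup.isOpenMap_coe) (by simp)
  have h2 : IsOpenMap (cellScale L) := by
    have e : cellScale L = (Homeomorph.piCongrRight fun b => (Homeomorph.mulRight₀ (L b)⁻¹
        (inv_ne_zero (hL b).ne'))) ∘ (EuclideanSpace.equiv (Fin 2) ℝ) := by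
      ext y b
      simp [cellScale, div_eq_mul_inv]
    rw [e]
    exact (Homeomorph.isOpenMap _).comp (ContinuousLinearEquiv.isOpenMap _)
  exact h1.comp h2

/-- The continuous function on the torus defined by a continuous periodic function. -/
theorem LatticePeriodic.exists_continuousMap (hL : ∀ b, 0 < L b) {f : Plane → ℂ}
    (hf : LatticePeriodic L f) (hc : Continuous f) :
    ∃ F : C(UnitAddTorus (Fin 2), ℂ), ∀ y, f y = F (torusMk L y) := by
  obtain ⟨F, hF⟩ := hf.exists_eq_comp hL
  refine ⟨⟨F, (isOpenQuotientMap_torusMk hL).isQuotientMap.continuous_iff.2 ?_⟩, hF⟩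
  convert hc using 1
  ext y
  simp [hF]

theorem mFourierCoeff_eq_cellCoeff (hL : ∀ b, 0 < L b) {f : Plane → ℂ}
    {F : UnitAddTorus (Fin 2) → ℂ} (hF : ∀ y, f y = F (torusMk L y)) (k : Fin 2 → ℤ) :
    UnitAddTorus.mFourierCoeff F k = cellCoeff L f k := by
  rw [cellCoeff_eq hL, UnitAddTorus.mFourierCoeff, ← integral_torusMk hL]
  simp only [cellExp_eq_mFourier, hF, smul_eq_mul, mul_comm]

/-- The Fourier series of a continuous periodic function converges pointwise when its coefficients
are absolutely summable. -/
theorem LatticePeriodic.hasSum_cellCoeff (hL : ∀ b, 0 < L b) {f : Plane → ℂ}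
    (hf : LatticePeriodic L f) (hc : Continuous f) (hs : Summable (cellCoeff L f)) (x : Plane) :
    HasSum (fun k => cellCoeff L f k * cellExp L k x) (f x) := by
  obtain ⟨F, hF⟩ := hf.exists_continuousMap hL hc
  have e : UnitAddTorus.mFourierCoeff F = cellCoeff L f :=
    funext (mFourierCoeff_eq_cellCoeff hL hF)
  have h := UnitAddTorus.hasSum_mFourier_series_apply_of_summable (e ▸ hs) (torusMk L x)
  simpa only [e, smul_eq_mul, ← cellExp_eq_mFourier, ← hF] using h

/-- The Fourier series of a continuous periodic function converges in `L²` of the cell. -/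
theorem LatticePeriodic.tendsto_eLpNorm_cellCoeff (hL : ∀ b, 0 < L b) {f : Plane → ℂ}
    (hf : LatticePeriodic L f) (hc : Continuous f) :
    Tendsto (fun s : Finset (Fin 2 → ℤ) => eLpNorm (fun x =>
        f x - ∑ k ∈ s, cellCoeff L f k * cellExp L k x) 2 (volume.restrict (cell L)))
      atTop (𝓝 0) := by
  obtain ⟨F, hF⟩ := hf.exists_continuousMap hL hc
  have e : UnitAddTorus.mFourierCoeff F = cellCoeff L f :=
    funext (mFourierCoeff_eq_cellCoeff hL hF)
  have h := UnitAddTorus.hasSum_mFourier_series_L2 (ContinuousMap.toLp 2 volume ℂ F)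
  simp only [UnitAddTorus.mFourierCoeff_toLp, e] at h
  have h1 := tendsto_iff_edist_tendsto_0.1 h
  rw [SummationFilter.unconditional_filter] at h1
  have h2 : ∀ s : Finset (Fin 2 → ℤ),
      edist (∑ k ∈ s, cellCoeff L f k • UnitAddTorus.mFourierLp (d := Fin 2) 2 k)
        (ContinuousMap.toLp 2 volume ℂ F) = eLpNorm (fun x =>
          f x - ∑ k ∈ s, cellCoeff L f k * cellExp L k x) 2 (cellMeasure L) := by
    intro s
    have e1 : ∑ k ∈ s, cellCoeff L f k • UnitAddTorus.mFourierLp (d := Fin 2) 2 k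
        = ContinuousMap.toLp (E := ℂ) 2 volume ℂ
          (∑ k ∈ s, cellCoeff L f k • UnitAddTorus.mFourier k) := by
      simp [map_sum]
    set G : C(UnitAddTorus (Fin 2), ℂ) := ∑ k ∈ s, cellCoeff L f k • UnitAddTorus.mFourier k
    rw [e1, edist_comm, Lp.edist_def]
    have e2 : (fun x => f x - ∑ k ∈ s, cellCoeff L f k * cellExp L k x)
        = (fun x => F x - G x) ∘ torusMk L := by
      ext x
      simp [hF, G, cellExp_eq_mFourier]
    rw [e2, eLpNorm_comp_measurePreserving (by fun_prop) (measurePreserving_torusMk hL)]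
    refine eLpNorm_congr_ae ?_
    filter_upwards [ContinuousMap.coeFn_toLp (p := 2) (𝕜 := ℂ) volume F,
      ContinuousMap.coeFn_toLp (p := 2) (𝕜 := ℂ) volume G] with x hx hx'
    rw [Pi.sub_apply, hx, hx']
  simp only [h2] at h1
  -- The `L²` seminorms for normalised and for Lebesgue measure on the cell differ by the finite
  -- nonzero factor `a`, which can be divided out.
  have h0 := hL 0
  have h0' := hL 1
  have hne : ENNReal.ofReal (1 / (L 0 * L 1)) ≠ 0 := by
    rw [ne_eq, ENNReal.ofReal_eq_zero, not_le]; positivity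
  simp only [cellMeasure, eLpNorm_smul_measure_of_ne_zero hne] at h1
  set a : ENNReal := ENNReal.ofReal (1 / (L 0 * L 1)) ^ (1 / (2 : ENNReal)).toReal with ha
  have ha0 : a ≠ 0 := by
    rw [ha]
    exact (ENNReal.rpow_pos (pos_iff_ne_zero.2 hne) ENNReal.ofReal_ne_top).ne'
  have ha1 : a ≠ ⊤ := ENNReal.rpow_ne_top_of_nonneg (by simp) ENNReal.ofReal_ne_top
  have h3 := ENNReal.Tendsto.const_mul (a := a⁻¹) h1 (Or.inr (ENNReal.inv_ne_top.2 ha0))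
  simpa only [smul_eq_mul, ← mul_assoc, ENNReal.inv_mul_cancel ha0 ha1, one_mul, mul_zero] using h3

end Torus

/-! ### The plane integral of the Poisson-type kernel -/

section PoissonIntegral

theorem integrable_inv_slant_one : Integrable (fun z : Plane => 1 / slant 1 z ^ 3) := by
  have h := (integrable_one_add_norm (E := Plane) (μ := volume) (r := 3) (by simp; norm_num)).const_mul 8
  refine h.mono' ?_ (Eventually.of_forall fun z => ?_)
  · have : Measurable (fun z : Plane => slant 1 z) := by unfold slant; fun_prop
    exact (measurable_const.div (this.pow_const 3)).aestronglyMeasurable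
  · have h1 := slant_pos one_ne_zero z
    have h2 := sq_slant 1 z
    -- From `(1 + ‖z‖)² ≤ 2 (1 + ‖z‖²)`; cubing the factor `2` gives the constant `8` above.
    have h3 : (1 + ‖z‖) / 2 ≤ slant 1 z := by
      have := norm_nonneg z
      nlinarith [sq_nonneg (‖z‖ - 1)]
    have h4 : 0 < 1 + ‖z‖ := by positivity
    rw [Real.norm_of_nonneg (by positivity), Real.rpow_neg (by positivity)]
    norm_cast
    calc 1 / slant 1 z ^ 3 ≤ 1 / ((1 + ‖z‖) / 2) ^ 3 := by gcongr
      _ = 8 * ((1 + ‖z‖) ^ 3)⁻¹ := by field_simp; norm_num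

/-- The Poisson-type kernel, obtained by scaling from the one at unit height difference. -/
theorem poisson_scaling {h : ℝ} (hh : h ≠ 0) (z : Plane) :
    |h| / slant h z ^ 3 = (h ^ 2)⁻¹ * (1 / slant 1 ((|h|)⁻¹ • z) ^ 3) := by
  have hp : 0 < |h| := abs_pos.2 hh
  have e : slant 1 ((|h|)⁻¹ • z) = (|h|)⁻¹ * slant h z := by
    unfold slant
    rw [norm_smul, Real.norm_of_nonneg (by positivity), ← Real.sqrt_sq (inv_nonneg.2 hp.le),
      ← Real.sqrt_mul (by positivity), Real.sqrt_sq (inv_nonneg.2 hp.le)]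
    congr 1
    rw [mul_pow, mul_add, inv_pow, sq_abs]
    field_simp
  have := slant_pos hh z
  rw [e, ← sq_abs h]
  field_simp

theorem integrable_poisson {h : ℝ} (hh : h ≠ 0) :
    Integrable (fun z : Plane => |h| / slant h z ^ 3) := by
  simp only [poisson_scaling hh]
  exact (integrable_inv_slant_one.comp_smul (inv_ne_zero (abs_pos.2 hh).ne')).const_mul _

/-- In dimension two the Jacobian `h ^ 2` of the dilation cancels the prefactor exactly. This
independence of `h` keeps disc integrals bounded as the depth approaches that of the source. -/
theorem integral_poisson {h : ℝ} (hh : h ≠ 0) :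
    ∫ z : Plane, |h| / slant h z ^ 3 = ∫ z : Plane, 1 / slant 1 z ^ 3 := by
  simp only [poisson_scaling hh]
  rw [integral_const_mul, Measure.integral_comp_inv_smul (μ := (volume : Measure Plane))
    (fun z => 1 / slant 1 z ^ 3)]
  simp only [finrank_euclideanSpace, Fintype.card_fin, smul_eq_mul, abs_pow, sq_abs]
  field_simp

end PoissonIntegral

/-! ### Size bounds and disc integrals of half-space kernels -/

namespace IsHalfSpaceKernel

variable {c : ℝ} {H : Plane → ℝ → ℝ}

theorem exists_bound (hH : IsHalfSpaceKernel c H) : ∃ C, 0 ≤ C ∧ ∀ t ∈ regularDepths c,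
    (∀ z, |H z t| ≤ C / slant (t - c) z ^ 2) ∧
    ∀ z a, 2 * ‖a‖ ≤ ‖z‖ → |H (z + a) t - H z t| ≤ C * ‖a‖ / slant (t - c) z ^ 3 := by
  obtain ⟨C, hC, h⟩ := hH.symbol.exists_bound
  refine ⟨C, hC, fun t ht => ⟨fun z => ((h t ht).1 z).trans (le_of_eq ?_),
    fun z a ha => ((h t ht).2 z a ha).trans (le_of_eq ?_)⟩⟩
  · rw [zpow_neg, div_eq_mul_inv]; norm_cast
  · rw [show (-2 - 1 : ℤ) = -3 by norm_num, zpow_neg, div_eq_mul_inv]; norm_cast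

theorem measurable (hH : IsHalfSpaceKernel c H) : Measurable (fun q : Plane × ℝ => H q.1 q.2) :=
  hH.symbol.measurable

theorem measurable_slice (hH : IsHalfSpaceKernel c H) (t : ℝ) : Measurable (fun z => H z t) :=
  hH.measurable.comp (measurable_id.prodMk measurable_const)

theorem exists_slice_bound (hH : IsHalfSpaceKernel c H) {t : ℝ} (ht : t ∈ regularDepths c) :
    ∃ M, 0 ≤ M ∧ ∀ z, |H z t| ≤ M := by
  obtain ⟨C, hC, h⟩ := hH.exists_bound
  have hh := sub_ne_zero_of_regular t ht
  refine ⟨C / |t - c| ^ 2, by positivity, fun z => ((h t ht).1 z).trans ?_⟩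
  have := abs_pos.2 hh
  gcongr
  exact abs_le_slant _ _

theorem integrable_slice (hH : IsHalfSpaceKernel c H) {t : ℝ} (ht : t ∈ regularDepths c)
    (μ : Measure Plane) [IsFiniteMeasure μ] : Integrable (fun z => H z t) μ := by
  obtain ⟨M, -, hM⟩ := hH.exists_slice_bound ht
  exact Integrable.of_bound (hH.measurable_slice t).aestronglyMeasurable M
    (Eventually.of_forall hM)

theorem integrableOn_ball (hH : IsHalfSpaceKernel c H) {t : ℝ} (ht : t ∈ regularDepths c) (R : ℝ) :
    IntegrableOn (fun z => H z t) (Metric.ball 0 R) :=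
  have : IsFiniteMeasure (volume.restrict (Metric.ball (0 : Plane) R)) :=
    ⟨by rw [Measure.restrict_apply_univ]; exact measure_ball_lt_top⟩
  hH.integrable_slice ht _

theorem exists_rotSum_bound (hH : IsHalfSpaceKernel c H) : ∃ C, 0 ≤ C ∧ ∀ t ∈ regularDepths c,
    ∀ z, |_root_.rotSum H z t|
      ≤ C * (|t - c| / slant (t - c) z ^ 3 + |t + c| / slant (t + c) z ^ 3) := by
  obtain ⟨F₁, F₂, ⟨C₁, hC₁, h₁⟩, ⟨C₂, hC₂, h₂⟩, h⟩ := hH.rotSum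
  refine ⟨max C₁ C₂, le_max_of_le_left hC₁, fun t ht z => ?_⟩
  rw [h z t ht, mul_add]
  have p1 : 0 ≤ |t - c| / slant (t - c) z ^ 3 := by
    have : 0 ≤ slant (t - c) z := Real.sqrt_nonneg _
    positivity
  have p2 : 0 ≤ |t + c| / slant (t + c) z ^ 3 := by
    have : 0 ≤ slant (t + c) z := Real.sqrt_nonneg _
    positivity
  exact (abs_add_le _ _).trans (add_le_add
    ((h₁ t ht z).trans (mul_le_mul_of_nonneg_right (le_max_left _ _) p1))
    ((h₂ t ht z).trans (mul_le_mul_of_nonneg_right (le_max_right _ _) p2)))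

end IsHalfSpaceKernel

/-- Rotation by a right angle as a linear isometry equivalence. -/
noncomputable def rotEquiv : Plane ≃ₗᵢ[ℝ] Plane where
  toFun := rot
  invFun z := !₂[z 1, -z 0]
  map_add' x y := by ext i; fin_cases i <;> simp [rot]; ring
  map_smul' a x := by ext i; fin_cases i <;> simp [rot]
  left_inv x := by ext i; fin_cases i <;> simp [rot]
  right_inv x := by ext i; fin_cases i <;> simp [rot]
  norm_map' x := norm_rot x

theorem setIntegral_ball_comp_rot (f : Plane → ℝ) (R : ℝ) :
    ∫ z in Metric.ball 0 R, f (rot z) = ∫ z in Metric.ball 0 R, f z := by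
  have h := rotEquiv.measurePreserving.setIntegral_preimage_emb
    rotEquiv.toHomeomorph.measurableEmbedding f (Metric.ball 0 R)
  rw [rotEquiv.preimage_ball, map_zero] at h
  exact h

theorem integrableOn_ball_comp_rot {f : Plane → ℝ} {R : ℝ}
    (hf : IntegrableOn f (Metric.ball 0 R)) :
    IntegrableOn (fun z => f (rot z)) (Metric.ball 0 R) := by
  have h := (rotEquiv.measurePreserving.integrableOn_comp_preimage
    rotEquiv.toHomeomorph.measurableEmbedding (f := f) (s := Metric.ball 0 R)).2 hf
  rw [rotEquiv.preimage_ball, map_zero] at h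
  exact h

/-- The improper integral of a half-space kernel over a horizontal plane. -/
noncomputable def kernelMean (H : Plane → ℝ → ℝ) (t : ℝ) : ℝ := (1 / 4) * ∫ z, rotSum H z t

namespace IsHalfSpaceKernel

variable {c : ℝ} {H : Plane → ℝ → ℝ}

/-- Discs are invariant under rotation, so over them a kernel may be replaced by its rotational
average. The latter is absolutely integrable over the plane although the kernel need not be. -/
theorem setIntegral_ball (hH : IsHalfSpaceKernel c H) {t : ℝ} (ht : t ∈ regularDepths c) (R : ℝ) :
    ∫ z in Metric.ball 0 R, H z t = (1 / 4) * ∫ z in Metric.ball 0 R, _root_.rotSum H z t := by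
  have h0 := hH.integrableOn_ball ht R
  have h1 := integrableOn_ball_comp_rot h0
  have h2 := integrableOn_ball_comp_rot h1
  have h3 := integrableOn_ball_comp_rot h2
  have e1 := setIntegral_ball_comp_rot (fun z => H z t) R
  have e2 := setIntegral_ball_comp_rot (fun z => H (rot z) t) R
  have e3 := setIntegral_ball_comp_rot (fun z => H (rot (rot z)) t) R
  have h01 : IntegrableOn (fun z => H z t + H (rot z) t) (Metric.ball 0 R) := h0.add h1
  have h012 : IntegrableOn (fun z => H z t + H (rot z) t + H (rot (rot z)) t)
    (Metric.ball 0 R) := h01.add h2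
  simp only [_root_.rotSum]
  rw [integral_add h012 h3, integral_add h01 h2, integral_add h0 h1]
  linarith

theorem exists_integral_rotSum_bound (hH : IsHalfSpaceKernel c H) (hc : 0 ≤ c) :
    ∃ C, 0 ≤ C ∧ ∀ t ∈ regularDepths c,
      Integrable (fun z => _root_.rotSum H z t) ∧ ∫ z, |_root_.rotSum H z t| ≤ C := by
  obtain ⟨C, hC, h⟩ := hH.exists_rotSum_bound
  have p : 0 ≤ ∫ z : Plane, 1 / slant 1 z ^ 3 := integral_nonneg fun z => by
    have := slant_pos one_ne_zero z
    positivity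
  refine ⟨C * (2 * ∫ z : Plane, 1 / slant 1 z ^ 3), by positivity, fun t ht => ?_⟩
  have hm : Measurable (fun z => _root_.rotSum H z t) := by
    have h0 := hH.measurable_slice t
    have hr : Measurable rot := rotEquiv.continuous.measurable
    exact ((h0.add (h0.comp hr)).add (h0.comp (hr.comp hr))).add (h0.comp (hr.comp (hr.comp hr)))
  have hi1 := integrable_poisson (sub_ne_zero_of_regular t ht)
  have hi2 := integrable_poisson (add_ne_zero_of_regular hc t ht)
  have hi := (hi1.add hi2).const_mul C
  have hint : Integrable (fun z => _root_.rotSum H z t) :=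
    hi.mono' hm.aestronglyMeasurable (Eventually.of_forall (h t ht))
  refine ⟨hint, (integral_mono hint.abs hi (h t ht)).trans (le_of_eq ?_)⟩
  simp only [Pi.add_apply]
  rw [integral_const_mul, integral_add hi1 hi2, integral_poisson (sub_ne_zero_of_regular t ht),
    integral_poisson (add_ne_zero_of_regular hc t ht)]
  ring

theorem exists_setIntegral_bound (hH : IsHalfSpaceKernel c H) (hc : 0 ≤ c) :
    ∃ C, 0 ≤ C ∧ ∀ t ∈ regularDepths c,
      (∀ R, |∫ z in Metric.ball 0 R, H z t| ≤ C) ∧ |kernelMean H t| ≤ C := by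
  obtain ⟨C, hC, h⟩ := hH.exists_integral_rotSum_bound hc
  refine ⟨C, hC, fun t ht => ⟨fun R => ?_, ?_⟩⟩
  · rw [hH.setIntegral_ball ht, abs_mul, abs_of_pos (by norm_num : (0 : ℝ) < 1 / 4)]
    have h1 : |∫ z in Metric.ball 0 R, _root_.rotSum H z t|
        ≤ ∫ z in Metric.ball 0 R, |_root_.rotSum H z t| := abs_integral_le_integral_abs
    have h2 := setIntegral_le_integral (s := Metric.ball 0 R) (h t ht).1.abs
      (Eventually.of_forall fun z => abs_nonneg _)
    have := (h t ht).2
    linarith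
  · rw [kernelMean, abs_mul, abs_of_pos (by norm_num : (0 : ℝ) < 1 / 4)]
    have h1 : |∫ z, _root_.rotSum H z t| ≤ ∫ z, |_root_.rotSum H z t| :=
      abs_integral_le_integral_abs
    have := (h t ht).2
    linarith

theorem tendsto_setIntegral_ball (hH : IsHalfSpaceKernel c H) (hc : 0 ≤ c) {t : ℝ}
    (ht : t ∈ regularDepths c) :
    Tendsto (fun R => ∫ z in Metric.ball 0 R, H z t) atTop (𝓝 (kernelMean H t)) := by
  obtain ⟨C, -, h⟩ := hH.exists_integral_rotSum_bound hc
  simp only [hH.setIntegral_ball ht]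
  exact ((aecover_ball (x := (0 : Plane)) tendsto_id).integral_tendsto_of_countably_generated
    (h t ht).1).const_mul _

end IsHalfSpaceKernel

/-! ### Separating depth from the horizontal singularity -/

/-- The weight in depth that controls the plane integrals of a half-space kernel. -/
noncomputable def depthWeight (c t : ℝ) : ℝ := 1 + |t - c| ^ (-(1 / 2) : ℝ)

theorem one_le_depthWeight (c t : ℝ) : 1 ≤ depthWeight c t := by
  have : 0 ≤ |t - c| ^ (-(1 / 2) : ℝ) := Real.rpow_nonneg (abs_nonneg _) _
  unfold depthWeight
  linarith

theorem measurable_depthWeight (c : ℝ) : Measurable (depthWeight c) := by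
  unfold depthWeight
  fun_prop

theorem integrableOn_norm_rpow_ball (R : ℝ) :
    IntegrableOn (fun z : Plane => ‖z‖ ^ (-(3 / 2) : ℝ)) (Metric.ball 0 R) :=
  integrableOn_ball_of_norm_le_rpow (C := 1) (α := 3 / 2) (by simp) (by simp; norm_num)
    (Eventually.of_forall fun z => by
      rw [one_mul, Real.norm_of_nonneg (Real.rpow_nonneg (norm_nonneg _) _)])
    (measurable_norm.pow_const _).aestronglyMeasurable

/-- The exponent `2` is split as `1/2 + 3/2` so that both factors are locally integrable: `1/2 < 1`
on the line and `3/2 < 2` in the plane. -/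
theorem inv_sq_slant_le {h : ℝ} (hh : h ≠ 0) {z : Plane} (hz : z ≠ 0) :
    1 / slant h z ^ 2 ≤ |h| ^ (-(1 / 2) : ℝ) * ‖z‖ ^ (-(3 / 2) : ℝ) := by
  have hp := slant_pos hh z
  have hz' : 0 < ‖z‖ := norm_pos_iff.2 hz
  have hh' : 0 < |h| := abs_pos.2 hh
  have e : slant h z ^ 2 = slant h z ^ (1 / 2 : ℝ) * slant h z ^ (3 / 2 : ℝ) := by
    rw [← Real.rpow_add hp]; norm_num
  rw [e, Real.rpow_neg hh'.le, Real.rpow_neg hz'.le, ← mul_inv, one_div]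
  gcongr
  · exact abs_le_slant h z
  · exact norm_le_slant h z

namespace IsHalfSpaceKernel

variable {c : ℝ} {H : Plane → ℝ → ℝ}

theorem exists_weight_bound (hH : IsHalfSpaceKernel c H) : ∃ C, 0 ≤ C ∧
    ∀ t ∈ regularDepths c, ∀ z, z ≠ 0 → |H z t| ≤ C * depthWeight c t * ‖z‖ ^ (-(3 / 2) : ℝ) := by
  obtain ⟨C, hC, h⟩ := hH.exists_bound
  refine ⟨C, hC, fun t ht z hz => ((h t ht).1 z).trans ?_⟩
  have h1 := inv_sq_slant_le (sub_ne_zero_of_regular t ht) hz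
  have h2 : 0 ≤ ‖z‖ ^ (-(3 / 2) : ℝ) := Real.rpow_nonneg (norm_nonneg _) _
  rw [div_eq_mul_one_div, mul_assoc]
  refine mul_le_mul_of_nonneg_left (h1.trans (mul_le_mul_of_nonneg_right ?_ h2)) hC
  unfold depthWeight
  linarith

end IsHalfSpaceKernel

/-! ### Oscillation of a kernel over the cell -/

/-- The kernel minus its average over the periodic cell. -/
noncomputable def kernelOsc (L : Fin 2 → ℝ) (H : Plane → ℝ → ℝ) (z : Plane) (t : ℝ) : ℝ :=
  H z t - ∫ a, H (z + a) t ∂cellMeasure L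

namespace IsHalfSpaceKernel

variable {c : ℝ} {H : Plane → ℝ → ℝ} {L : Fin 2 → ℝ}

theorem measurable_kernelOsc (hH : IsHalfSpaceKernel c H) (hL : ∀ b, 0 < L b) :
    Measurable (fun q : Plane × ℝ => kernelOsc L H q.1 q.2) := by
  have := isProbabilityMeasure_cellMeasure hL
  refine hH.measurable.sub (StronglyMeasurable.integral_prod_right'
    (f := fun q : (Plane × ℝ) × Plane => H (q.1.1 + q.2) q.1.2)
    (Measurable.stronglyMeasurable ?_)).measurable
  exact hH.measurable.comp ((measurable_fst.fst.add measurable_snd).prodMk measurable_fst.snd)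

theorem integrable_translate (hH : IsHalfSpaceKernel c H) (hL : ∀ b, 0 < L b) {t : ℝ}
    (ht : t ∈ regularDepths c) (z : Plane) :
    Integrable (fun a => H (z + a) t) (cellMeasure L) := by
  have := isProbabilityMeasure_cellMeasure hL
  obtain ⟨M, -, hM⟩ := hH.exists_slice_bound ht
  exact Integrable.of_bound ((hH.measurable_slice t).comp
    (measurable_const_add z)).aestronglyMeasurable M (Eventually.of_forall fun a => hM _)

/-- Averaging smooths the point singularity. As cell points have norm at most `L 0 + L 1`, each
average is at most `1 / (L 0 * L 1)` times the integral over one fixed larger disc, uniformly in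
`z`. -/
theorem exists_integral_translate_rpow_bound (hL : ∀ b, 0 < L b) (r : ℝ) : ∃ K, 0 ≤ K ∧
    ∀ z : Plane, ‖z‖ < r → Integrable (fun a => ‖z + a‖ ^ (-(3 / 2) : ℝ)) (cellMeasure L) ∧
      ∫ a, ‖z + a‖ ^ (-(3 / 2) : ℝ) ∂cellMeasure L ≤ K := by
  have h0 := hL 0
  have h1 := hL 1
  set ψ : Plane → ℝ := fun z => ‖z‖ ^ (-(3 / 2) : ℝ) with hψ
  have hψ0 : ∀ z, 0 ≤ ψ z := fun z => Real.rpow_nonneg (norm_nonneg _) _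
  set r' := r + (L 0 + L 1) with hr'
  have hi : Integrable ((Metric.ball (0 : Plane) r').indicator ψ) :=
    (integrable_indicator_iff Metric.isOpen_ball.measurableSet).2 (integrableOn_norm_rpow_ball r')
  have hn : ∀ z, 0 ≤ (Metric.ball (0 : Plane) r').indicator ψ z := fun z =>
    indicator_nonneg (fun z _ => hψ0 z) z
  have hae : ∀ z : Plane, ‖z‖ < r → ∀ᵐ a ∂cellMeasure L,
      (Metric.ball (0 : Plane) r').indicator ψ (z + a) = ψ (z + a) := by
    intro z hz
    filter_upwards [ae_norm_le_cellMeasure L] with a ha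
    rw [indicator_of_mem]
    rw [mem_ball_zero_iff]
    exact (norm_add_le _ _).trans_lt (by linarith)
  refine ⟨1 / (L 0 * L 1) * ∫ z, (Metric.ball (0 : Plane) r').indicator ψ z,
    mul_nonneg (by positivity) (integral_nonneg hn), fun z hz => ?_⟩
  have hi' : Integrable (fun a => (Metric.ball (0 : Plane) r').indicator ψ (z + a)) :=
    hi.comp_add_left z
  constructor
  · refine Integrable.congr ?_ (hae z hz)
    exact (hi'.restrict (s := cell L)).smul_measure ENNReal.ofReal_ne_top
  · rw [← integral_congr_ae (hae z hz), cellMeasure, integral_smul_measure,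
      ENNReal.toReal_ofReal (by positivity), smul_eq_mul]
    refine mul_le_mul_of_nonneg_left ?_ (by positivity)
    refine (setIntegral_le_integral hi' (Eventually.of_forall fun a => hn _)).trans (le_of_eq ?_)
    exact integral_add_left_eq_self _ z

theorem ae_cellMeasure_add_ne_zero (L : Fin 2 → ℝ) (z : Plane) :
    ∀ᵐ a ∂cellMeasure L, z + a ≠ 0 := by
  refine Measure.ae_smul_measure (ae_restrict_of_ae ?_) _
  have : ∀ᵐ a : Plane, a ≠ -z := by simp [ae_iff]
  filter_upwards [this] with a ha hza
  exact ha (by rw [eq_neg_iff_add_eq_zero, add_comm]; exact hza)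

/-- The oscillation of a half-space kernel decays like the third power of the distance. -/
theorem exists_kernelOsc_far_bound (hH : IsHalfSpaceKernel c H) (hL : ∀ b, 0 < L b) :
    ∃ C, 0 ≤ C ∧ ∀ t ∈ regularDepths c, ∀ z, 2 * (L 0 + L 1) ≤ ‖z‖ →
      |kernelOsc L H z t| ≤ C * (1 + ‖z‖) ^ (-3 : ℝ) := by
  have := isProbabilityMeasure_cellMeasure hL
  have h0 := hL 0
  have h1 := hL 1
  set d := L 0 + L 1 with hd
  have hd0 : 0 < d := by positivity
  obtain ⟨C, hC, hCb⟩ := hH.exists_bound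
  -- Shifts within the cell have norm at most `d`, which gives `C d / ‖z‖³`. The cubed factor
  -- converts `‖z‖⁻¹` into `(1 + ‖z‖)⁻¹`, as `‖z‖ ≥ 2d`.
  refine ⟨C * d * (1 + 1 / (2 * d)) ^ 3, by positivity, fun t ht z hzd => ?_⟩
  have hz0 : 0 < ‖z‖ := by linarith
  -- The cell measure has mass one, so the oscillation is an average of differences, to which the
  -- symbol estimate applies.
  have e : kernelOsc L H z t = ∫ a, (H z t - H (z + a) t) ∂cellMeasure L := by
    rw [integral_sub (integrable_const _) (hH.integrable_translate hL ht z)]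
    simp [kernelOsc]
  have h2 : ‖∫ a, (H z t - H (z + a) t) ∂cellMeasure L‖ ≤ C * d / ‖z‖ ^ 3 := by
    have := norm_integral_le_of_norm_le_const (μ := cellMeasure L)
      (f := fun a => H z t - H (z + a) t) (C := C * d / ‖z‖ ^ 3) (by
        filter_upwards [ae_norm_le_cellMeasure L] with a ha
        rw [← hd] at ha
        rw [norm_sub_rev]
        refine ((hCb t ht).2 z a (by linarith)).trans ?_
        gcongr
        exact norm_le_slant _ _)
    simpa using this
  rw [e]
  refine h2.trans ?_
  rw [Real.rpow_neg (by positivity), mul_assoc, div_eq_mul_inv]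
  norm_cast
  rw [← div_eq_mul_inv ((1 + 1 / (2 * d)) ^ 3), ← div_pow, ← inv_pow]
  have : (‖z‖)⁻¹ ≤ (1 + 1 / (2 * d)) / (1 + ‖z‖) := by
    rw [le_div_iff₀ (by positivity), mul_add, inv_mul_cancel₀ hz0.ne', mul_one, one_div]
    have : (‖z‖)⁻¹ ≤ (2 * d)⁻¹ := by gcongr
    linarith
  gcongr

/-- The oscillation of a half-space kernel is dominated by an integrable function of the horizontal
offset times the depth weight. -/
theorem exists_kernelOsc_bound (hH : IsHalfSpaceKernel c H) (hL : ∀ b, 0 < L b) :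
    ∃ Ψ : Plane → ℝ, Integrable Ψ ∧ (∀ z, 0 ≤ Ψ z) ∧ ∀ t ∈ regularDepths c, ∀ z, z ≠ 0 →
      |kernelOsc L H z t| ≤ depthWeight c t * Ψ z := by
  have := isProbabilityMeasure_cellMeasure hL
  have h0 := hL 0
  have h1 := hL 1
  set d := L 0 + L 1 with hd
  have hd0 : 0 < d := by positivity
  obtain ⟨C, hC, hfar⟩ := hH.exists_kernelOsc_far_bound hL
  obtain ⟨C', hC', hCb'⟩ := hH.exists_weight_bound
  obtain ⟨K, hK, hKb⟩ := exists_integral_translate_rpow_bound hL (2 * d)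
  have hball : IntegrableOn (fun _ : Plane => C' * K) (Metric.ball 0 (2 * d)) :=
    integrableOn_const measure_ball_lt_top.ne
  have hA := ((integrableOn_norm_rpow_ball (2 * d)).const_mul C').add hball
  have hA' := (integrable_indicator_iff Metric.isOpen_ball.measurableSet).2 hA
  have hB := (integrable_one_add_norm (E := Plane) (μ := volume) (r := 3)
    (by simp; norm_num)).const_mul C
  -- The majorant has, on the disc of radius `2d`, the singularity of the kernel plus a constant for
  -- its cell average, and everywhere the cubic tail.
  refine ⟨_, hA'.add hB, fun z => ?_, fun t ht z hz => ?_⟩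
  · have : 0 ≤ ‖z‖ ^ (-(3 / 2) : ℝ) := Real.rpow_nonneg (norm_nonneg _) _
    refine add_nonneg (indicator_nonneg (fun z _ => ?_) z) (by positivity)
    have : 0 ≤ ‖z‖ ^ (-(3 / 2) : ℝ) := Real.rpow_nonneg (norm_nonneg _) _
    simp only [Pi.add_apply]
    positivity
  · have hw := one_le_depthWeight c t
    have pB : 0 ≤ C * (1 + ‖z‖) ^ (-3 : ℝ) := by positivity
    rw [Pi.add_apply]
    by_cases hzd : ‖z‖ < 2 * d
    · rw [indicator_of_mem (by simpa using hzd)]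
      simp only [Pi.add_apply]
      have h2 := hCb' t ht z hz
      have h3 : |∫ a, H (z + a) t ∂cellMeasure L| ≤ C' * depthWeight c t * K := by
        have hne := ae_cellMeasure_add_ne_zero L z
        obtain ⟨hi, hle⟩ := hKb z hzd
        have h4 : |∫ a, H (z + a) t ∂cellMeasure L|
            ≤ ∫ a, C' * depthWeight c t * ‖z + a‖ ^ (-(3 / 2) : ℝ) ∂cellMeasure L := by
          rw [← Real.norm_eq_abs]
          refine norm_integral_le_of_norm_le (hi.const_mul _) ?_
          filter_upwards [hne] with a ha using hCb' t ht _ ha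
        rw [integral_const_mul] at h4
        exact h4.trans (mul_le_mul_of_nonneg_left hle (by positivity))
      have h5 := abs_sub (H z t) (∫ a, H (z + a) t ∂cellMeasure L)
      have pB' := mul_nonneg (zero_le_one.trans hw) pB
      rw [kernelOsc]
      nlinarith
    · rw [indicator_of_notMem (by simpa using hzd), zero_add]
      push Not at hzd
      exact (hfar t ht z hzd).trans (le_mul_of_one_le_left (by positivity) hw)

end IsHalfSpaceKernel

/-! ### Integration against bounded densities -/

section BoundedDensity

variable {X E : Type*} [MeasurableSpace X] [NormedAddCommGroup E] [NormedSpace ℝ E]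

theorem integrable_smul_of_ae_bound {μ : Measure X} {f : X → ℝ} {g : X → E} {B : ℝ}
    (hf : Integrable f μ) (hg : AEStronglyMeasurable g μ) (hB : ∀ᵐ x ∂μ, ‖g x‖ ≤ B) :
    Integrable (fun x => f x • g x) μ := by
  refine (hf.norm.mul_const B).mono' (hf.aestronglyMeasurable.smul hg) ?_
  filter_upwards [hB] with x hx
  rw [norm_smul]
  gcongr

theorem norm_integral_smul_le {μ : Measure X} {f : X → ℝ} {g : X → E} {B : ℝ}
    (hf : Integrable f μ) (hB : ∀ᵐ x ∂μ, ‖g x‖ ≤ B) :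
    ‖∫ x, f x • g x ∂μ‖ ≤ (∫ x, |f x| ∂μ) * B := by
  rw [← integral_mul_const]
  refine norm_integral_le_of_norm_le (hf.abs.mul_const B) ?_
  filter_upwards [hB] with x hx
  rw [norm_smul, Real.norm_eq_abs]
  gcongr

end BoundedDensity

section Translation

variable {E : Type*} [NormedAddCommGroup E] {g : Plane → E} {B : ℝ}

theorem aestronglyMeasurable_add_right (hg : AEStronglyMeasurable g volume) (x : Plane) :
    AEStronglyMeasurable (fun z => g (z + x)) volume :=
  hg.comp_measurePreserving (measurePreserving_add_right volume x)

theorem ae_add_right {p : Plane → Prop} (h : ∀ᵐ y, p y) (x : Plane) : ∀ᵐ z, p (z + x) :=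
  (measurePreserving_add_right volume x).quasiMeasurePreserving.ae h

theorem volume_real_annulus_le {r s : ℝ} (hr : 0 ≤ r) (hrs : r ≤ s) :
    volume.real (Metric.ball (0 : Plane) s \ Metric.ball 0 r) = π * (s ^ 2 - r ^ 2) := by
  rw [measureReal_sdiff (Metric.ball_subset_ball hrs) Metric.isOpen_ball.measurableSet]
  simp only [measureReal_def, EuclideanSpace.volume_ball_fin_two]
  simp only [ENNReal.toReal_mul, ENNReal.toReal_pow, ENNReal.toReal_ofReal hr,
    ENNReal.toReal_ofReal (hr.trans hrs), ENNReal.toReal_ofReal Real.pi_pos.le]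
  ring

end Translation

section Shift

variable {E : Type*} [NormedAddCommGroup E] [NormedSpace ℝ E] {g : Plane → E} {B C N R : ℝ}

/-- After the substitution `y = z + v` the integrals differ only by their domains, the discs of
radius `R` about `-v` and `0`. The symmetric difference lies in the annulus between `R - N` and `R +
N`, of area `4πRN`, where `|f| ≤ C / (R - N)²`. Since `R - N ≥ R / 2`, the constant is `16π`. -/
theorem norm_setIntegral_ball_shift_sub_le {f : Plane → ℝ} (hf : ∀ R, IntegrableOn f (Metric.ball 0 R))
    (hC : 0 ≤ C) (hfC : ∀ z, z ≠ 0 → |f z| ≤ C / ‖z‖ ^ 2)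
    (hg : AEStronglyMeasurable g volume) (hB : ∀ᵐ y, ‖g y‖ ≤ B) (hB0 : 0 ≤ B)
    {v : Plane} (hv : ‖v‖ ≤ N) (hR : 2 * N + 1 ≤ R) :
    ‖(∫ y in Metric.ball 0 R, f (y - v) • g y) - ∫ z in Metric.ball 0 R, f z • g (z + v)‖
      ≤ B * C * (16 * π * N) / R := by
  have hN : 0 ≤ N := (norm_nonneg v).trans hv
  have hm : MeasurableSet (Metric.ball (0 : Plane) R) := Metric.isOpen_ball.measurableSet
  have hgv := aestronglyMeasurable_add_right hg v
  have hBv := ae_add_right hB v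
  have e1 : ∫ y in Metric.ball 0 R, f (y - v) • g y
      = ∫ z, (Metric.ball (0 : Plane) R).indicator (fun y => f (y - v) • g y) (z + v) := by
    rw [integral_add_right_eq_self
      (fun z => (Metric.ball (0 : Plane) R).indicator (fun y => f (y - v) • g y) z),
      integral_indicator hm]
  have e2 : ∀ z : Plane, (Metric.ball (0 : Plane) R).indicator (fun y => f (y - v) • g y) (z + v)
      = (Metric.ball (-v) R).indicator (fun z => f z • g (z + v)) z := by
    intro z
    simp only [indicator, Metric.mem_ball, dist_eq_norm, sub_zero, sub_neg_eq_add,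
      add_sub_cancel_right]
  have hsub : Metric.ball (-v) R ⊆ Metric.ball 0 (R + N) := by
    refine Metric.ball_subset_ball' ?_
    rw [dist_zero_right, norm_neg]
    linarith
  have hint : ∀ s ⊆ Metric.ball (0 : Plane) (R + N),
      IntegrableOn (fun z => f z • g (z + v)) s := fun s hs =>
    integrable_smul_of_ae_bound ((hf _).mono_set hs) hgv.restrict (ae_restrict_of_ae hBv)
  have hi1 := hint _ hsub
  have hi2 := hint (Metric.ball 0 R) (Metric.ball_subset_ball (by linarith))
  rw [e1]
  simp only [e2]
  rw [← integral_indicator hm, ← integral_sub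
    ((integrable_indicator_iff Metric.isOpen_ball.measurableSet).2 hi1)
    ((integrable_indicator_iff hm).2 hi2)]
  set A : Set Plane := Metric.ball 0 (R + N) \ Metric.ball 0 (R - N) with hA
  have hAm : MeasurableSet A :=
    Metric.isOpen_ball.measurableSet.diff Metric.isOpen_ball.measurableSet
  have hAfin : volume A ≠ ⊤ := ((measure_mono sdiff_subset).trans_lt measure_ball_lt_top).ne
  have hRN : 0 < R - N := by linarith
  have hRpos : 0 < R := by linarith
  have hbound : ∀ᵐ z : Plane, ‖(Metric.ball (-v) R).indicator (fun z => f z • g (z + v)) z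
      - (Metric.ball 0 R).indicator (fun z => f z • g (z + v)) z‖
      ≤ A.indicator (fun _ => C / (R - N) ^ 2 * B) z := by
    filter_upwards [hBv] with z hz
    by_cases hzA : z ∈ A
    · rw [indicator_of_mem hzA]
      have hz1 : R - N ≤ ‖z‖ := by simpa using hzA.2
      have hz0 : z ≠ 0 := norm_pos_iff.1 (hRN.trans_le hz1)
      have h1 : ‖f z • g (z + v)‖ ≤ C / (R - N) ^ 2 * B := by
        rw [norm_smul, Real.norm_eq_abs]
        have h2 : |f z| ≤ C / (R - N) ^ 2 := (hfC z hz0).trans (by gcongr)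
        gcongr
      have h0 : 0 ≤ C / (R - N) ^ 2 * B := by positivity
      by_cases h2 : z ∈ Metric.ball (-v) R <;> by_cases h3 : z ∈ Metric.ball (0 : Plane) R <;>
        simp only [indicator_of_mem, indicator_of_notMem, h2, h3, not_false_eq_true, sub_self,
          norm_zero, sub_zero, zero_sub, norm_neg, h0, h1]
    · rw [indicator_of_notMem hzA]
      have h4 : ‖z‖ < R - N ∨ R + N ≤ ‖z‖ := by
        by_contra! h
        exact hzA ⟨by simpa using h.2, by simpa using h.1⟩
      have h5 : z ∈ Metric.ball (-v) R ↔ z ∈ Metric.ball (0 : Plane) R := by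
        simp only [Metric.mem_ball, dist_eq_norm, sub_neg_eq_add, sub_zero]
        have := norm_add_le z v
        have : ‖z‖ ≤ ‖z + v‖ + ‖v‖ := by simpa using norm_sub_le (z + v) v
        constructor <;> intro <;> rcases h4 with h4 | h4 <;> linarith
      by_cases h3 : z ∈ Metric.ball (0 : Plane) R
      · rw [indicator_of_mem h3, indicator_of_mem (h5.2 h3), sub_self, norm_zero]
      · rw [indicator_of_notMem h3, indicator_of_notMem (mt h5.1 h3), sub_self, norm_zero]
  refine (norm_integral_le_of_norm_le ((integrable_indicator_iff hAm).2
    (integrableOn_const hAfin)) hbound).trans ?_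
  rw [integral_indicator hAm, setIntegral_const, smul_eq_mul,
    volume_real_annulus_le hRN.le (by linarith)]
  have h6 : R / 2 ≤ R - N := by linarith
  have h7 : π * ((R + N) ^ 2 - (R - N) ^ 2) * (C / (R - N) ^ 2 * B)
      = B * C * (4 * π * N) * R / (R - N) ^ 2 := by ring
  rw [h7, div_le_div_iff₀ (by positivity) hRpos]
  have h8 : R * R ≤ 4 * (R - N) ^ 2 := by nlinarith
  calc B * C * (4 * π * N) * R * R = B * C * (4 * π * N) * (R * R) := by ring
    _ ≤ B * C * (4 * π * N) * (4 * (R - N) ^ 2) := by gcongr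
    _ = _ := by ring

end Shift

/-! ### Pairing a kernel with a periodic density at fixed depth -/

/-- The pairing of a half-space kernel, at depth `t`, with the translate by `x` of a periodic
density: the regularized value of `∫ H(y - x, t) g(y) dy`. -/
noncomputable def kernelPairing {E : Type*} [NormedAddCommGroup E] [NormedSpace ℝ E]
    (L : Fin 2 → ℝ) (H : Plane → ℝ → ℝ) (t : ℝ) (g : Plane → E) (x : Plane) : E :=
  (∫ z, kernelOsc L H z t • g (z + x)) + kernelMean H t • ∫ a, g a ∂cellMeasure L

namespace IsHalfSpaceKernel

variable {c : ℝ} {H : Plane → ℝ → ℝ} {L : Fin 2 → ℝ} {E : Type*} [NormedAddCommGroup E]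
  [NormedSpace ℝ E] {g : Plane → E} {B : ℝ} {t : ℝ}

theorem measurable_kernelOsc_slice (hH : IsHalfSpaceKernel c H) (hL : ∀ b, 0 < L b) (t : ℝ) :
    Measurable (fun z => kernelOsc L H z t) :=
  (hH.measurable_kernelOsc hL).comp (measurable_id.prodMk measurable_const)

theorem exists_integral_kernelOsc_bound (hH : IsHalfSpaceKernel c H) (hL : ∀ b, 0 < L b) :
    ∃ C, 0 ≤ C ∧ ∀ t ∈ regularDepths c, Integrable (fun z => kernelOsc L H z t) ∧
      ∫ z, |kernelOsc L H z t| ≤ C * depthWeight c t := by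
  obtain ⟨Ψ, hΨ, hΨ0, h⟩ := hH.exists_kernelOsc_bound hL
  refine ⟨∫ z, Ψ z, integral_nonneg hΨ0, fun t ht => ?_⟩
  have hne : ∀ᵐ z : Plane, z ≠ 0 := by simp [ae_iff]
  have hi := hΨ.const_mul (depthWeight c t)
  have h1 : Integrable (fun z => kernelOsc L H z t) := by
    refine hi.mono' (hH.measurable_kernelOsc_slice hL t).aestronglyMeasurable ?_
    filter_upwards [hne] with z hz using h t ht z hz
  refine ⟨h1, ?_⟩
  rw [mul_comm, ← integral_const_mul]
  refine integral_mono_ae h1.abs hi ?_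
  filter_upwards [hne] with z hz using h t ht z hz

theorem integrableOn_ball_smul (hH : IsHalfSpaceKernel c H) (ht : t ∈ regularDepths c)
    (hg : AEStronglyMeasurable g volume) (hB : ∀ᵐ y, ‖g y‖ ≤ B) (x : Plane) (R : ℝ) :
    IntegrableOn (fun y => H (y - x) t • g y) (Metric.ball 0 R) := by
  have : IsFiniteMeasure (volume.restrict (Metric.ball (0 : Plane) R)) :=
    ⟨by rw [Measure.restrict_apply_univ]; exact measure_ball_lt_top⟩
  obtain ⟨M, -, hM⟩ := hH.exists_slice_bound ht
  refine integrable_smul_of_ae_bound (f := fun y => H (y - x) t) ?_ hg.restrict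
    (ae_restrict_of_ae hB)
  exact Integrable.of_bound ((hH.measurable_slice t).comp
    (measurable_sub_const x)).aestronglyMeasurable M (Eventually.of_forall fun a => hM _)

/-- Over a disc, pairing with a periodic density amounts to pairing with the oscillation of the
kernel and replacing the density by its mean, up to a boundary term. -/
theorem exists_norm_setIntegral_ball_sub_le [CompleteSpace E]
    (hH : IsHalfSpaceKernel c H) (hL : ∀ b, 0 < L b) :
    ∃ C, 0 ≤ C ∧ ∀ t ∈ regularDepths c, ∀ (g : Plane → E) (B : ℝ), LatticePeriodic L g →
      AEStronglyMeasurable g volume → (∀ᵐ y, ‖g y‖ ≤ B) → 0 ≤ B → ∀ (x : Plane) (R : ℝ),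
      2 * (‖x‖ + (L 0 + L 1)) + 1 ≤ R →
      ‖(∫ y in Metric.ball 0 R, H (y - x) t • g y)
        - (∫ y in Metric.ball 0 R, kernelOsc L H (y - x) t • g y)
        - (∫ z in Metric.ball 0 R, H z t) • ∫ a, g a ∂cellMeasure L‖
        ≤ B * C * (‖x‖ + (L 0 + L 1)) / R := by
  have hP := isProbabilityMeasure_cellMeasure hL
  obtain ⟨C, hC, hCb⟩ := hH.exists_bound
  refine ⟨16 * π * C, by positivity, fun t ht g B hper hg hB hB0 x R hR => ?_⟩
  have hfin : IsFiniteMeasure (volume.restrict (Metric.ball (0 : Plane) R)) :=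
    ⟨by rw [Measure.restrict_apply_univ]; exact measure_ball_lt_top⟩
  obtain ⟨M, hM0, hM⟩ := hH.exists_slice_bound ht
  have hHm := hH.measurable_slice t
  have hgR : AEStronglyMeasurable g (volume.restrict (Metric.ball 0 R)) := hg.restrict
  have hBR : ∀ᵐ y ∂volume.restrict (Metric.ball (0 : Plane) R), ‖g y‖ ≤ B := ae_restrict_of_ae hB
  have hS1 : Integrable (fun q : Plane × Plane => H (q.1 - x + q.2) t • g q.1)
      ((volume.restrict (Metric.ball 0 R)).prod (cellMeasure L)) := by
    refine integrable_smul_of_ae_bound (f := fun q : Plane × Plane => H (q.1 - x + q.2) t) (B := B)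
      (Integrable.of_bound (hHm.comp (by fun_prop)).aestronglyMeasurable M
        (Eventually.of_forall fun a => hM _)) hgR.comp_fst ?_
    exact Measure.quasiMeasurePreserving_fst.ae hBR
  -- The density is measurable and bounded only almost everywhere. Pulling null sets back through
  -- this map makes the composition on the product space legitimate.
  have hq : Measure.QuasiMeasurePreserving (fun q : Plane × Plane => q.2 + (x - q.1))
      ((cellMeasure L).prod volume) volume :=
    QuasiMeasurePreserving.prod_of_right (by fun_prop) (Eventually.of_forall fun a =>
      (measurePreserving_add_right volume (x - a)).quasiMeasurePreserving)
  have hac : (cellMeasure L).prod (volume.restrict (Metric.ball (0 : Plane) R))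
      ≪ (cellMeasure L).prod volume :=
    Measure.AbsolutelyContinuous.rfl.prod Measure.absolutelyContinuous_restrict
  have hS2 : Integrable (fun q : Plane × Plane => H q.2 t • g (q.2 + (x - q.1)))
      ((cellMeasure L).prod (volume.restrict (Metric.ball 0 R))) := by
    refine integrable_smul_of_ae_bound (f := fun q : Plane × Plane => H q.2 t) (B := B)
      (Integrable.of_bound (hHm.comp (by fun_prop)).aestronglyMeasurable M
        (Eventually.of_forall fun a => hM _)) ?_ (hac.ae_le (hq.ae hB))
    exact (hg.comp_quasiMeasurePreserving hq).mono_ac hac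
  -- Kernel minus oscillation is the cell average of the translated kernel; Fubini takes the average
  -- outside.
  have e1 : (∫ y in Metric.ball 0 R, H (y - x) t • g y)
      - (∫ y in Metric.ball 0 R, kernelOsc L H (y - x) t • g y)
      = ∫ a, (∫ y in Metric.ball 0 R, H (y - x + a) t • g y) ∂cellMeasure L := by
    rw [← integral_integral_swap hS1, ← integral_sub (hH.integrableOn_ball_smul ht hg hB x R)]
    · refine integral_congr_ae (Eventually.of_forall fun y => ?_)
      simp only
      rw [integral_smul_const, ← sub_smul, kernelOsc, sub_sub_cancel]
    · have h1 := (hH.integrableOn_ball_smul ht hg hB x R).sub hS1.integral_prod_left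
      refine h1.congr (Eventually.of_forall fun y => ?_)
      simp only [Pi.sub_apply]
      rw [integral_smul_const, ← sub_smul, kernelOsc]
  -- By periodicity the mean of `g` is the average over `a` of `g (z + (x - a))`, for every `z`.
  have e2 : (∫ z in Metric.ball 0 R, H z t) • ∫ a, g a ∂cellMeasure L
      = ∫ a, (∫ z in Metric.ball 0 R, H z t • g (z + (x - a))) ∂cellMeasure L := by
    rw [integral_integral_swap hS2, ← integral_smul_const]
    refine integral_congr_ae (Eventually.of_forall fun z => ?_)
    simp only
    rw [integral_smul, ← hper.integral_sub_left hL (z + x)]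
    simp only [add_sub_assoc]
  -- For each `a` the two integrands are the unshifted and shifted integrals for the vector `v = x -
  -- a`, whose norm is at most `‖x‖ + (L 0 + L 1)`.
  rw [e1, e2, ← integral_sub hS1.integral_prod_right hS2.integral_prod_left]
  have key := norm_integral_le_of_norm_le_const (μ := cellMeasure L)
    (f := fun a => (∫ y in Metric.ball 0 R, H (y - x + a) t • g y)
      - ∫ z in Metric.ball 0 R, H z t • g (z + (x - a)))
    (C := B * (16 * π * C) * (‖x‖ + (L 0 + L 1)) / R) (by
      filter_upwards [ae_norm_le_cellMeasure L] with a ha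
      have h1 := norm_setIntegral_ball_shift_sub_le (f := fun z => H z t) (C := C)
        (hH.integrableOn_ball ht) hC (fun z hz => ((hCb t ht).1 z).trans (by
          have := norm_pos_iff.2 hz
          gcongr
          exact norm_le_slant _ _)) hg hB hB0 (v := x - a) (N := ‖x‖ + (L 0 + L 1))
        ((norm_sub_le _ _).trans (by linarith)) hR
      simp only [sub_sub_eq_add_sub] at h1
      simp only [sub_add_eq_add_sub] at h1 ⊢
      refine (le_of_eq ?_).trans (h1.trans (le_of_eq (by ring)))
      simp only [← add_sub_assoc, add_comm])
  simpa using key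

theorem integrable_kernelOsc_smul (hH : IsHalfSpaceKernel c H) (hL : ∀ b, 0 < L b)
    (ht : t ∈ regularDepths c) (hg : AEStronglyMeasurable g volume) (hB : ∀ᵐ y, ‖g y‖ ≤ B)
    (x : Plane) : Integrable (fun y => kernelOsc L H (y - x) t • g y) := by
  obtain ⟨C, -, h⟩ := hH.exists_integral_kernelOsc_bound hL
  exact integrable_smul_of_ae_bound (f := fun y => kernelOsc L H (y - x) t)
    ((h t ht).1.comp_sub_right x) hg hB

theorem kernelPairing_eq (L : Fin 2 → ℝ) (H : Plane → ℝ → ℝ) (t : ℝ) (g : Plane → E) (x : Plane) :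
    kernelPairing L H t g x
      = (∫ y, kernelOsc L H (y - x) t • g y) + kernelMean H t • ∫ a, g a ∂cellMeasure L := by
  rw [kernelPairing, ← integral_add_right_eq_self (fun y => kernelOsc L H (y - x) t • g y) x]
  simp only [add_sub_cancel_right]

/-- Integrals of a half-space kernel against a bounded periodic density over growing discs
converge. -/
theorem tendsto_setIntegral_ball_smul [CompleteSpace E] (hH : IsHalfSpaceKernel c H) (hc : 0 ≤ c)
    (hL : ∀ b, 0 < L b) (ht : t ∈ regularDepths c) (hper : LatticePeriodic L g)
    (hg : AEStronglyMeasurable g volume) (hB : ∀ᵐ y, ‖g y‖ ≤ B) (x : Plane) :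
    Tendsto (fun R => ∫ y in Metric.ball 0 R, H (y - x) t • g y) atTop
      (𝓝 (kernelPairing L H t g x)) := by
  obtain ⟨C, hC, h⟩ := hH.exists_norm_setIntegral_ball_sub_le (E := E) hL
  have hB' : ∀ᵐ y, ‖g y‖ ≤ |B| := hB.mono fun y hy => hy.trans (le_abs_self B)
  have h1 := (aecover_ball (x := (0 : Plane)) tendsto_id).integral_tendsto_of_countably_generated
    (hH.integrable_kernelOsc_smul hL ht hg hB x)
  have h2 := (hH.tendsto_setIntegral_ball hc ht).smul_const (∫ a, g a ∂cellMeasure L)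
  have h3 : Tendsto (fun R => (∫ y in Metric.ball 0 R, H (y - x) t • g y)
        - (∫ y in Metric.ball 0 R, kernelOsc L H (y - x) t • g y)
        - (∫ z in Metric.ball 0 R, H z t) • ∫ a, g a ∂cellMeasure L) atTop (𝓝 0) := by
    refine squeeze_zero_norm' (a := fun R => |B| * C * (‖x‖ + (L 0 + L 1)) / R) ?_
      (tendsto_const_nhds.div_atTop tendsto_id)
    filter_upwards [eventually_ge_atTop (2 * (‖x‖ + (L 0 + L 1)) + 1)] with R hR
    exact h t ht g _ hper hg hB' (abs_nonneg _) x R hR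
  rw [kernelPairing_eq]
  refine ((h3.add h1).add h2).congr' (Eventually.of_forall fun R => ?_) |>.trans (by rw [zero_add])
  simp only [id]
  abel

/-- Integrals of a half-space kernel over large discs are controlled by the depth weight. -/
theorem exists_norm_setIntegral_ball_le [CompleteSpace E] (hH : IsHalfSpaceKernel c H) (hc : 0 ≤ c)
    (hL : ∀ b, 0 < L b) (x : Plane) :
    ∃ C R₀, 0 ≤ C ∧ ∀ t ∈ regularDepths c, ∀ (g : Plane → E) (B : ℝ), LatticePeriodic L g →
      AEStronglyMeasurable g volume → (∀ᵐ y, ‖g y‖ ≤ B) → 0 ≤ B → ∀ R, R₀ ≤ R →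
      ‖∫ y in Metric.ball 0 R, H (y - x) t • g y‖ ≤ C * depthWeight c t * B := by
  have hP := isProbabilityMeasure_cellMeasure hL
  obtain ⟨C₁, hC₁, h₁⟩ := hH.exists_norm_setIntegral_ball_sub_le (E := E) hL
  obtain ⟨C₂, hC₂, h₂⟩ := hH.exists_integral_kernelOsc_bound hL
  obtain ⟨C₃, hC₃, h₃⟩ := hH.exists_setIntegral_bound hc
  have h0 := hL 0
  have h0' := hL 1
  set N := ‖x‖ + (L 0 + L 1) with hN
  have hN0 : 0 ≤ N := by positivity
  refine ⟨C₁ * N + C₂ + C₃, 2 * N + 1, by positivity, fun t ht g B hper hg hB hB0 R hR => ?_⟩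
  have a1 := h₁ t ht g B hper hg hB hB0 x R hR
  have a2 : ‖∫ y in Metric.ball 0 R, kernelOsc L H (y - x) t • g y‖
      ≤ C₂ * depthWeight c t * B := by
    have hi : Integrable (fun y => kernelOsc L H (y - x) t) := (h₂ t ht).1.comp_sub_right x
    refine (norm_integral_smul_le (hi.restrict (s := Metric.ball 0 R))
      (ae_restrict_of_ae hB)).trans ?_
    refine mul_le_mul_of_nonneg_right (le_trans ?_ (h₂ t ht).2) hB0
    refine (setIntegral_le_integral hi.abs (Eventually.of_forall fun _ => abs_nonneg _)).trans
      (le_of_eq ?_)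
    exact integral_sub_right_eq_self (fun y => |kernelOsc L H y t|) x
  have a3 : ‖(∫ z in Metric.ball 0 R, H z t) • ∫ a, g a ∂cellMeasure L‖ ≤ C₃ * B := by
    rw [norm_smul]
    refine mul_le_mul ((h₃ t ht).1 R) ?_ (norm_nonneg _) hC₃
    have hBc : ∀ᵐ a ∂cellMeasure L, ‖g a‖ ≤ B :=
      Measure.ae_smul_measure (ae_restrict_of_ae hB) _
    simpa using norm_integral_le_of_norm_le_const hBc
  -- The threshold `R ≥ 2N + 1` gives `R ≥ 1`, so the boundary error is bounded independently of
  -- `R`.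
  have a4 : B * C₁ * N / R ≤ C₁ * N * B := by
    rw [div_le_iff₀ (by linarith)]
    have : 0 ≤ C₁ * N * B := by positivity
    nlinarith
  have hw := one_le_depthWeight c t
  set P := ∫ y in Metric.ball 0 R, H (y - x) t • g y
  set Q := ∫ y in Metric.ball 0 R, kernelOsc L H (y - x) t • g y
  set S := (∫ z in Metric.ball 0 R, H z t) • ∫ a, g a ∂cellMeasure L
  have a5 : ‖P‖ ≤ ‖P - Q - S‖ + ‖Q‖ + ‖S‖ := by
    calc ‖P‖ = ‖(P - Q - S) + Q + S‖ := by congr 1; abel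
      _ ≤ _ := norm_add₃_le
  have a6 : (C₁ * N * B) * 1 ≤ (C₁ * N * B) * depthWeight c t := by gcongr
  have a7 : (C₃ * B) * 1 ≤ (C₃ * B) * depthWeight c t := by gcongr
  calc ‖P‖ ≤ C₁ * N * B + C₂ * depthWeight c t * B + C₃ * B := by linarith
    _ ≤ _ := by linarith

end IsHalfSpaceKernel

/-! ### Densities with a majorant in depth -/

section Depth

/-- Majorants in depth of the densities: nonnegative, bounded and integrable. -/
structure IsDepthMajorant (m : ℝ → ℝ) : Prop where
  nonneg : ∀ t, 0 ≤ m t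
  bounded : ∃ M, ∀ t, m t ≤ M
  integrable : IntegrableOn m (Ioi 0)

theorem ae_regularDepths (c : ℝ) : ∀ᵐ t ∂volume.restrict (Ioi (0 : ℝ)), t ∈ regularDepths c := by
  have h : ∀ᵐ t : ℝ, t ≠ c := by simp [ae_iff]
  filter_upwards [ae_restrict_mem measurableSet_Ioi, ae_restrict_of_ae h] with t h1 h2
  exact ⟨h1, h2⟩

theorem integrableOn_abs_sub_rpow (c : ℝ) :
    IntegrableOn (fun t : ℝ => |t - c| ^ (-(1 / 2) : ℝ)) (Metric.ball c 1) := by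
  have h : IntegrableOn (fun t : ℝ => ‖t‖ ^ (-(1 / 2) : ℝ)) (Metric.ball 0 1) :=
    integrableOn_ball_of_norm_le_rpow (C := 1) (α := 1 / 2) (by simp) (by simp; norm_num)
      (Eventually.of_forall fun z => by
        rw [one_mul, Real.norm_of_nonneg (Real.rpow_nonneg (norm_nonneg _) _)])
      (measurable_norm.pow_const _).aestronglyMeasurable
  rw [← integrable_indicator_iff Metric.isOpen_ball.measurableSet] at h ⊢
  refine (h.comp_sub_right c).congr (Eventually.of_forall fun t => ?_)
  simp only [indicator, Metric.mem_ball, dist_eq_norm, sub_zero, Real.norm_eq_abs]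

/-- Within distance one of `c`, the bound on `m` leaves the integrable singularity `|t - c|^{-1/2}`.
Further away the weight is at most `2` and integrability of `m` suffices. Both assumptions on the
majorant are used here. -/
theorem IsDepthMajorant.integrable_weight {m : ℝ → ℝ} (hm : IsDepthMajorant m) (c : ℝ) :
    Integrable (fun t => depthWeight c t * m t) (volume.restrict (Ioi 0)) := by
  obtain ⟨M, hM⟩ := hm.bounded
  have h1 := (integrable_indicator_iff Metric.isOpen_ball.measurableSet).2
    ((integrableOn_abs_sub_rpow c).const_mul M)
  refine ((h1.restrict (s := Ioi 0)).add (hm.integrable.const_mul 2)).mono'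
    ((measurable_depthWeight c).aestronglyMeasurable.mul hm.integrable.aestronglyMeasurable)
    (Eventually.of_forall fun t => ?_)
  have p := hm.nonneg t
  have q : 0 ≤ |t - c| ^ (-(1 / 2) : ℝ) := Real.rpow_nonneg (abs_nonneg _) _
  rw [Real.norm_of_nonneg (mul_nonneg (zero_le_one.trans (one_le_depthWeight c t)) p), Pi.add_apply,
    depthWeight]
  by_cases ht : t ∈ Metric.ball c 1
  · rw [indicator_of_mem ht]
    have := hM t
    nlinarith
  · rw [indicator_of_notMem ht]
    have h2 : 1 ≤ |t - c| := by simpa [Real.dist_eq] using ht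
    have h3 : |t - c| ^ (-(1 / 2) : ℝ) ≤ 1 := Real.rpow_le_one_of_one_le_of_nonpos h2 (by norm_num)
    nlinarith

end Depth

/-- The measure on the open half-space. -/
noncomputable abbrev halfSpaceMeasure : Measure (Plane × ℝ) :=
  (volume : Measure Plane).prod (volume.restrict (Ioi (0 : ℝ)))

theorem volume_restrict_halfSpace :
    (volume.restrict {p : Plane × ℝ | 0 < p.2} : Measure (Plane × ℝ)) = halfSpaceMeasure := by
  have : {p : Plane × ℝ | 0 < p.2} = univ ×ˢ Ioi (0 : ℝ) := by ext; simp
  rw [this, Measure.volume_eq_prod, ← Measure.prod_restrict, Measure.restrict_univ]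

/-- Horizontally periodic densities with a majorant in depth. -/
structure IsPeriodicDensity (L : Fin 2 → ℝ) (m : ℝ → ℝ) (g : Plane → ℝ → ℝ) : Prop where
  periodic : ∀ t, 0 < t → LatticePeriodic L (fun y => g y t)
  aestronglyMeasurable : AEStronglyMeasurable (fun p : Plane × ℝ => g p.1 p.2) halfSpaceMeasure
  bound : ∀ᵐ p ∂halfSpaceMeasure, |g p.1 p.2| ≤ m p.2

theorem ae_ae_of_ae_halfSpace {p : Plane × ℝ → Prop} (h : ∀ᵐ q ∂halfSpaceMeasure, p q) :
    ∀ᵐ t ∂volume.restrict (Ioi (0 : ℝ)), ∀ᵐ y : Plane, p (y, t) := by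
  have h1 : ∀ᵐ q ∂(volume.restrict (Ioi (0 : ℝ))).prod (volume : Measure Plane), p q.swap :=
    Measure.measurePreserving_swap.quasiMeasurePreserving.ae h
  exact Measure.ae_ae_of_ae_prod h1

namespace IsPeriodicDensity

variable {L : Fin 2 → ℝ} {m : ℝ → ℝ} {g : Plane → ℝ → ℝ}

theorem ae_slice (hg : IsPeriodicDensity L m g) : ∀ᵐ t ∂volume.restrict (Ioi (0 : ℝ)),
    AEStronglyMeasurable (fun y => g y t) volume ∧ (∀ᵐ y, ‖g y t‖ ≤ m t) ∧
      LatticePeriodic L (fun y => g y t) := by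
  have h1 : AEStronglyMeasurable (fun q : ℝ × Plane => g q.2 q.1)
      ((volume.restrict (Ioi (0 : ℝ))).prod volume) := hg.aestronglyMeasurable.prod_swap
  filter_upwards [h1.prodMk_left, ae_ae_of_ae_halfSpace hg.bound,
    ae_restrict_mem measurableSet_Ioi] with t h2 h3 h4
  exact ⟨h2, h3, hg.periodic t h4⟩

end IsPeriodicDensity

/-! ### The volume integral: convergence and continuity -/

/-- The volume integral of a half-space kernel against a periodic density. -/
noncomputable def volumePotential (L : Fin 2 → ℝ) (H : Plane → ℝ → ℝ) (g : Plane → ℝ → ℝ)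
    (x : Plane) : ℝ :=
  ∫ t in Ioi (0 : ℝ), kernelPairing L H t (fun y => g y t) x

namespace IsHalfSpaceKernel

variable {c : ℝ} {H : Plane → ℝ → ℝ} {L : Fin 2 → ℝ} {m : ℝ → ℝ} {g : Plane → ℝ → ℝ}

theorem measurable_translate (hH : IsHalfSpaceKernel c H) (x : Plane) :
    Measurable (fun p : Plane × ℝ => H (p.1 - x) p.2) :=
  hH.measurable.comp ((measurable_fst.sub_const x).prodMk measurable_snd)

/-- The volume integral of a half-space kernel over a vertical cylinder converges absolutely. -/
theorem integrable_truncated (hH : IsHalfSpaceKernel c H) (hm : IsDepthMajorant m)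
    (hg : IsPeriodicDensity L m g) (x : Plane) (R : ℝ) :
    Integrable (fun p : Plane × ℝ => (Metric.ball (0 : Plane) R).indicator
      (fun y => H (y - x) p.2 * g y p.2) p.1) halfSpaceMeasure := by
  obtain ⟨C, hC, hb⟩ := hH.exists_weight_bound
  set ψ : Plane → ℝ := fun z => ‖z‖ ^ (-(3 / 2) : ℝ) with hψ
  have hψ0 : ∀ z, 0 ≤ ψ z := fun z => Real.rpow_nonneg (norm_nonneg _) _
  have h1 : Integrable ((Metric.ball (0 : Plane) R).indicator fun y => ψ (y - x)) := by
    rw [integrable_indicator_iff Metric.isOpen_ball.measurableSet]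
    have h2 := (integrable_indicator_iff Metric.isOpen_ball.measurableSet).2
      (integrableOn_norm_rpow_ball (R + ‖x‖))
    refine (h2.comp_sub_right x).integrableOn.congr_fun ?_ Metric.isOpen_ball.measurableSet
    intro y hy
    have hy' : ‖y‖ < R := by simpa using hy
    have : y - x ∈ Metric.ball (0 : Plane) (R + ‖x‖) := by
      rw [mem_ball_zero_iff]
      exact (norm_sub_le _ _).trans_lt (by linarith)
    simp only [indicator_of_mem this, hψ]
  have h3 := h1.mul_prod ((hm.integrable_weight c).const_mul C)
  have hms : MeasurableSet (Prod.fst ⁻¹' Metric.ball (0 : Plane) R : Set (Plane × ℝ)) :=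
    measurable_fst Metric.isOpen_ball.measurableSet
  refine h3.mono' ?_ ?_
  · exact AEStronglyMeasurable.indicator
      ((hH.measurable_translate x).aestronglyMeasurable.mul hg.aestronglyMeasurable) hms
  · have hne : ∀ᵐ y : Plane, y ≠ x := by simp [ae_iff]
    have a1 : ∀ᵐ p : Plane × ℝ ∂halfSpaceMeasure, p.1 ≠ x :=
      Measure.quasiMeasurePreserving_fst.ae hne
    have a2 : ∀ᵐ p : Plane × ℝ ∂halfSpaceMeasure, p.2 ∈ regularDepths c :=
      Measure.quasiMeasurePreserving_snd.ae (ae_regularDepths c)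
    filter_upwards [a1, a2, hg.bound] with p p1 p2 p3
    by_cases hp : p.1 ∈ Metric.ball (0 : Plane) R
    · rw [indicator_of_mem hp, indicator_of_mem hp, norm_mul]
      have h4 := hb p.2 p2 (p.1 - x) (sub_ne_zero.2 p1)
      have := one_le_depthWeight c p.2
      have := hψ0 (p.1 - x)
      calc ‖H (p.1 - x) p.2‖ * ‖g p.1 p.2‖
          ≤ (C * depthWeight c p.2 * ψ (p.1 - x)) * m p.2 :=
            mul_le_mul h4 p3 (norm_nonneg _) (by positivity)
        _ = _ := by ring
    · rw [indicator_of_notMem hp, indicator_of_notMem hp]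
      simp

theorem integral_indicator_slice (H : Plane → ℝ → ℝ) (g : Plane → ℝ → ℝ) (x : Plane) (R t : ℝ) :
    ∫ y, (Metric.ball (0 : Plane) R).indicator (fun y => H (y - x) t * g y t) y
      = ∫ y in Metric.ball 0 R, H (y - x) t • g y t := by
  rw [integral_indicator Metric.isOpen_ball.measurableSet]
  rfl

theorem aestronglyMeasurable_slice_integral (hH : IsHalfSpaceKernel c H) (hm : IsDepthMajorant m)
    (hg : IsPeriodicDensity L m g) (x : Plane) (R : ℝ) :
    AEStronglyMeasurable (fun t => ∫ y in Metric.ball 0 R, H (y - x) t • g y t)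
      (volume.restrict (Ioi (0 : ℝ))) := by
  have h := (hH.integrable_truncated hm hg x R).integral_prod_right
  simp only [integral_indicator_slice] at h
  exact h.aestronglyMeasurable

theorem ae_tendsto_slice_integral (hH : IsHalfSpaceKernel c H) (hc : 0 ≤ c) (hL : ∀ b, 0 < L b)
    (hg : IsPeriodicDensity L m g) (x : Plane) :
    ∀ᵐ t ∂volume.restrict (Ioi (0 : ℝ)), Tendsto
      (fun R => ∫ y in Metric.ball 0 R, H (y - x) t • g y t) atTop
      (𝓝 (kernelPairing L H t (fun y => g y t) x)) := by
  filter_upwards [ae_regularDepths c, hg.ae_slice] with t ht h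
  exact hH.tendsto_setIntegral_ball_smul hc hL ht h.2.2 h.1 h.2.1 x

/-- Measurability in depth is inherited from the disc integrals, of which the pairing is the limit
at almost every depth. -/
theorem aestronglyMeasurable_kernelPairing (hH : IsHalfSpaceKernel c H) (hc : 0 ≤ c)
    (hL : ∀ b, 0 < L b) (hm : IsDepthMajorant m) (hg : IsPeriodicDensity L m g) (x : Plane) :
    AEStronglyMeasurable (fun t => kernelPairing L H t (fun y => g y t) x)
      (volume.restrict (Ioi (0 : ℝ))) :=
  aestronglyMeasurable_of_tendsto_ae atTop (fun R => hH.aestronglyMeasurable_slice_integral hm hg x R)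
    (hH.ae_tendsto_slice_integral hc hL hg x)

/-- The volume integrals over growing cylinders converge. -/
theorem tendsto_volumePotential (hH : IsHalfSpaceKernel c H) (hc : 0 ≤ c)
    (hL : ∀ b, 0 < L b) (hm : IsDepthMajorant m) (hg : IsPeriodicDensity L m g) (x : Plane) :
    Tendsto (fun R => ∫ t in Ioi (0 : ℝ), ∫ y in Metric.ball 0 R, H (y - x) t • g y t) atTop
      (𝓝 (volumePotential L H g x)) := by
  obtain ⟨C, R₀, hC, h⟩ := hH.exists_norm_setIntegral_ball_le (E := ℝ) hc hL x
  refine tendsto_integral_filter_of_dominated_convergence (fun t => C * (depthWeight c t * m t))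
    (Eventually.of_forall fun R => hH.aestronglyMeasurable_slice_integral hm hg x R) ?_
    ((hm.integrable_weight c).const_mul C) (hH.ae_tendsto_slice_integral hc hL hg x)
  filter_upwards [eventually_ge_atTop R₀] with R hR
  filter_upwards [ae_regularDepths c, hg.ae_slice] with t ht h'
  rw [← mul_assoc]
  exact h t ht _ _ h'.2.2 h'.1 h'.2.1 (hm.nonneg t) R hR

theorem latticePeriodic_volumePotential (hg : IsPeriodicDensity L m g) (H : Plane → ℝ → ℝ) :
    LatticePeriodic L (volumePotential L H g) := by
  intro b x
  refine setIntegral_congr_fun measurableSet_Ioi fun t ht => ?_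
  simp only [kernelPairing]
  congr 2
  ext z
  have := hg.periodic t ht b (z + x)
  simp only [add_assoc] at this
  rw [this]

theorem norm_kernelPairing_le {E : Type*} [NormedAddCommGroup E] [NormedSpace ℝ E]
    (hH : IsHalfSpaceKernel c H) (hc : 0 ≤ c)
    (hL : ∀ b, 0 < L b) : ∃ C, 0 ≤ C ∧ ∀ t ∈ regularDepths c, ∀ (g : Plane → E) (B : ℝ),
      (∀ᵐ y, ‖g y‖ ≤ B) → 0 ≤ B → ∀ x, ‖kernelPairing L H t g x‖ ≤ C * depthWeight c t * B := by
  have hP := isProbabilityMeasure_cellMeasure hL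
  obtain ⟨C₂, hC₂, h₂⟩ := hH.exists_integral_kernelOsc_bound hL
  obtain ⟨C₃, hC₃, h₃⟩ := hH.exists_setIntegral_bound hc
  refine ⟨C₂ + C₃, by positivity, fun t ht g B hB hB0 x => ?_⟩
  have a2 : ‖∫ z, kernelOsc L H z t • g (z + x)‖ ≤ C₂ * depthWeight c t * B :=
    (norm_integral_smul_le (h₂ t ht).1 (ae_add_right hB x)).trans
      (mul_le_mul_of_nonneg_right (h₂ t ht).2 hB0)
  have a3 : ‖kernelMean H t • ∫ a, g a ∂cellMeasure L‖ ≤ C₃ * B := by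
    rw [norm_smul]
    refine mul_le_mul (h₃ t ht).2 ?_ (norm_nonneg _) hC₃
    have hBc : ∀ᵐ a ∂cellMeasure L, ‖g a‖ ≤ B :=
      Measure.ae_smul_measure (ae_restrict_of_ae hB) _
    simpa using norm_integral_le_of_norm_le_const hBc
  have a7 : (C₃ * B) * 1 ≤ (C₃ * B) * depthWeight c t := by
    gcongr
    exact one_le_depthWeight c t
  rw [kernelPairing]
  refine (norm_add_le _ _).trans ?_
  linarith

/-- The difference estimate for symbols is a local Lipschitz bound. It admits only shifts up to `‖z‖
/ 2`, hence the exclusion of the origin. -/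
theorem continuousAt_slice (hH : IsHalfSpaceKernel c H) {t : ℝ} (ht : t ∈ regularDepths c)
    {z : Plane} (hz : z ≠ 0) : ContinuousAt (fun z => H z t) z := by
  obtain ⟨C, hC, h⟩ := hH.exists_bound
  have hz' : 0 < ‖z‖ := norm_pos_iff.2 hz
  have hcont : Tendsto (fun w : Plane => C * ‖w - z‖ / slant (t - c) z ^ 3) (𝓝 z) (𝓝 0) := by
    have : Continuous (fun w : Plane => C * ‖w - z‖ / slant (t - c) z ^ 3) := by fun_prop
    simpa using this.tendsto z
  rw [ContinuousAt, tendsto_iff_norm_sub_tendsto_zero]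
  refine squeeze_zero' (Eventually.of_forall fun w => norm_nonneg _) ?_ hcont
  filter_upwards [Metric.ball_mem_nhds z (half_pos hz')] with w hw
  have hw' : ‖w - z‖ < ‖z‖ / 2 := by simpa [dist_eq_norm] using hw
  have := (h t ht).2 z (w - z) (by linarith)
  rwa [add_sub_cancel] at this

theorem continuousAt_kernelOsc (hH : IsHalfSpaceKernel c H) (hL : ∀ b, 0 < L b) {t : ℝ}
    (ht : t ∈ regularDepths c) {z : Plane} (hz : z ≠ 0) :
    ContinuousAt (fun z => kernelOsc L H z t) z := by
  have hP := isProbabilityMeasure_cellMeasure hL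
  obtain ⟨M, -, hM⟩ := hH.exists_slice_bound ht
  refine (hH.continuousAt_slice ht hz).sub ?_
  refine continuousAt_of_dominated (bound := fun _ => M)
    (Eventually.of_forall fun w => (hH.integrable_translate hL ht w).aestronglyMeasurable)
    (Eventually.of_forall fun w => Eventually.of_forall fun a => hM _) (integrable_const _) ?_
  filter_upwards [ae_cellMeasure_add_ne_zero L z] with a ha
  exact ContinuousAt.comp (f := fun w => w + a) (hH.continuousAt_slice ht ha) (by fun_prop)

/-- At a fixed regular depth the kernel is bounded, so the cubic decay holds down to the origin,
with a constant depending on `t`. This serves as the majorant for continuity in `x`. -/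
theorem exists_kernelOsc_slice_bound (hH : IsHalfSpaceKernel c H) (hL : ∀ b, 0 < L b) {t : ℝ}
    (ht : t ∈ regularDepths c) :
    ∃ K, 0 ≤ K ∧ ∀ z, |kernelOsc L H z t| ≤ K * (1 + ‖z‖) ^ (-3 : ℝ) := by
  have hP := isProbabilityMeasure_cellMeasure hL
  obtain ⟨M, hM0, hM⟩ := hH.exists_slice_bound ht
  obtain ⟨C, hC, h⟩ := hH.exists_kernelOsc_far_bound hL
  have h0 := hL 0
  have h1 := hL 1
  refine ⟨C + 2 * M * (1 + 2 * (L 0 + L 1)) ^ (3 : ℝ), by positivity, fun z => ?_⟩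
  have p : 0 ≤ (1 + ‖z‖) ^ (-3 : ℝ) := by positivity
  rw [add_mul]
  by_cases hz : 2 * (L 0 + L 1) ≤ ‖z‖
  · have := h t ht z hz
    have : 0 ≤ 2 * M * (1 + 2 * (L 0 + L 1)) ^ (3 : ℝ) * (1 + ‖z‖) ^ (-3 : ℝ) := by positivity
    linarith
  · push Not at hz
    have h2 : |∫ a, H (z + a) t ∂cellMeasure L| ≤ M := by
      have := norm_integral_le_of_norm_le_const (μ := cellMeasure L) (f := fun a => H (z + a) t)
        (C := M) (Eventually.of_forall fun a => hM _)
      simpa using this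
    have h3 := abs_sub (H z t) (∫ a, H (z + a) t ∂cellMeasure L)
    have h4 := hM z
    have h5 : 1 ≤ (1 + 2 * (L 0 + L 1)) ^ (3 : ℝ) * (1 + ‖z‖) ^ (-3 : ℝ) := by
      rw [Real.rpow_neg (by positivity), ← div_eq_mul_inv, one_le_div (by positivity)]
      gcongr
    have h6 : 0 ≤ C * (1 + ‖z‖) ^ (-3 : ℝ) := by positivity
    rw [kernelOsc]
    nlinarith

theorem continuous_kernelPairing {E : Type*} [NormedAddCommGroup E] [NormedSpace ℝ E]
    (hH : IsHalfSpaceKernel c H) (hL : ∀ b, 0 < L b) {t : ℝ}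
    (ht : t ∈ regularDepths c) {g : Plane → E} {B : ℝ} (hg : AEStronglyMeasurable g volume)
    (hB : ∀ᵐ y, ‖g y‖ ≤ B) : Continuous (kernelPairing L H t g) := by
  obtain ⟨K, hK, h⟩ := hH.exists_kernelOsc_slice_bound hL ht
  -- The density is merely measurable, so the dependence on `x` is moved to the kernel.
  have e : kernelPairing L H t g = fun x => (∫ y, kernelOsc L H (y - x) t • g y)
      + kernelMean H t • ∫ a, g a ∂cellMeasure L := funext (kernelPairing_eq L H t g)
  rw [e]
  refine Continuous.add ?_ continuous_const
  rw [continuous_iff_continuousAt]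
  intro x₀
  -- For `‖x - x₀‖ < 1`, `1 + ‖y - x‖` is at least half of `1 + ‖y - x₀‖`, and cubing gives the
  -- factor `8`.
  have hi := (((integrable_one_add_norm (E := Plane) (μ := volume) (r := 3)
    (by simp; norm_num)).comp_sub_right x₀).const_mul (K * 8)).mul_const |B|
  refine continuousAt_of_dominated (Eventually.of_forall fun x =>
    (hH.integrable_kernelOsc_smul hL ht hg hB x).aestronglyMeasurable) ?_ hi ?_
  · filter_upwards [Metric.ball_mem_nhds x₀ one_pos] with x hx
    filter_upwards [hB] with y hy
    rw [norm_smul]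
    refine mul_le_mul ((h _).trans ?_) (hy.trans (le_abs_self B)) (norm_nonneg _) (by positivity)
    rw [mul_assoc]
    refine mul_le_mul_of_nonneg_left ?_ hK
    have hx' : ‖x - x₀‖ < 1 := by simpa [dist_eq_norm] using hx
    have h1 : ‖y - x₀‖ ≤ ‖y - x‖ + ‖x - x₀‖ := by simpa using norm_add_le (y - x) (x - x₀)
    have h2 : (1 + ‖y - x₀‖) / 2 ≤ 1 + ‖y - x‖ := by
      have := norm_nonneg (y - x)
      linarith
    rw [Real.rpow_neg (by positivity), Real.rpow_neg (by positivity)]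
    norm_cast
    calc ((1 + ‖y - x‖) ^ 3)⁻¹ ≤ (((1 + ‖y - x₀‖) / 2) ^ 3)⁻¹ := by gcongr
      _ = 8 * ((1 + ‖y - x₀‖) ^ 3)⁻¹ := by field_simp; norm_num
  · have hne : ∀ᵐ y : Plane, y ≠ x₀ := by simp [ae_iff]
    filter_upwards [hne] with y hy
    exact (ContinuousAt.comp (f := fun x => y - x)
      (hH.continuousAt_kernelOsc hL ht (sub_ne_zero.2 hy)) (by fun_prop)).smul continuousAt_const

/-- The volume integral depends continuously on the horizontal position. -/
theorem continuous_volumePotential (hH : IsHalfSpaceKernel c H) (hc : 0 ≤ c)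
    (hL : ∀ b, 0 < L b) (hm : IsDepthMajorant m) (hg : IsPeriodicDensity L m g) :
    Continuous (volumePotential L H g) := by
  obtain ⟨C, hC, h⟩ := norm_kernelPairing_le (E := ℝ) hH hc hL
  refine continuous_of_dominated (fun x => hH.aestronglyMeasurable_kernelPairing hc hL hm hg x)
    (bound := fun t => C * (depthWeight c t * m t)) (fun x => ?_)
    ((hm.integrable_weight c).const_mul C) ?_
  · filter_upwards [ae_regularDepths c, hg.ae_slice] with t ht h'
    rw [← mul_assoc]
    exact h t ht _ _ h'.2.1 (hm.nonneg t) x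
  · filter_upwards [ae_regularDepths c, hg.ae_slice] with t ht h'
    exact hH.continuous_kernelPairing hL ht h'.1 h'.2.1

end IsHalfSpaceKernel

/-! ### Fourier coefficients of the volume integral -/

theorem kernelPairing_ofReal (L : Fin 2 → ℝ) (H : Plane → ℝ → ℝ) (t : ℝ) (g : Plane → ℝ)
    (x : Plane) :
    ((kernelPairing L H t g x : ℝ) : ℂ) = kernelPairing L H t (fun y => (g y : ℂ)) x := by
  simp only [kernelPairing, smul_eq_mul, Complex.real_smul]
  push_cast
  rw [← integral_complex_ofReal, ← integral_complex_ofReal]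
  push_cast
  rfl

theorem LatticePeriodic.mul {L : Fin 2 → ℝ} {f g : Plane → ℂ} (hf : LatticePeriodic L f)
    (hg : LatticePeriodic L g) : LatticePeriodic L (fun y => f y * g y) := fun b y => by
  simp only [hf b y, hg b y]

theorem cellExp_neg_apply_eq (L : Fin 2 → ℝ) (k : Fin 2 → ℤ) (x z : Plane) :
    cellExp L (-k) x = cellExp L (-k) (z + x) * cellExp L k z := by
  rw [cellExp_add, mul_right_comm, mul_comm (cellExp L (-k) z), cellExp_mul_neg, one_mul]

namespace IsHalfSpaceKernel

variable {c : ℝ} {H : Plane → ℝ → ℝ} {L : Fin 2 → ℝ} {m : ℝ → ℝ}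

/-- At fixed depth, the pairing acts diagonally on Fourier coefficients. -/
theorem integral_kernelPairing_mul_cellExp (hH : IsHalfSpaceKernel c H) (hL : ∀ b, 0 < L b) {t : ℝ}
    (ht : t ∈ regularDepths c) {g : Plane → ℂ} {B : ℝ} (hg : AEStronglyMeasurable g volume)
    (hB : ∀ᵐ y, ‖g y‖ ≤ B) (hper : LatticePeriodic L g) (k : Fin 2 → ℤ) :
    ∫ x, kernelPairing L H t g x * cellExp L (-k) x ∂cellMeasure L
      = kernelPairing L H t (cellExp L k) 0 * ∫ y, g y * cellExp L (-k) y ∂cellMeasure L := by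
  have hP := isProbabilityMeasure_cellMeasure hL
  obtain ⟨C, -, hJ⟩ := hH.exists_integral_kernelOsc_bound hL
  obtain ⟨hJi, -⟩ := hJ t ht
  have hq : Measure.QuasiMeasurePreserving (fun q : Plane × Plane => q.2 + q.1)
      ((cellMeasure L).prod volume) volume :=
    QuasiMeasurePreserving.prod_of_right (by fun_prop) (Eventually.of_forall fun a =>
      (measurePreserving_add_right volume a).quasiMeasurePreserving)
  have hE : Continuous fun q : Plane × Plane => cellExp L (-k) q.1 :=
    (continuous_cellExp L (-k)).comp continuous_fst
  have hT : Integrable (fun q : Plane × Plane =>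
      kernelOsc L H q.2 t • (g (q.2 + q.1) * cellExp L (-k) q.1))
      ((cellMeasure L).prod volume) := by
    refine integrable_smul_of_ae_bound (f := fun q : Plane × Plane => kernelOsc L H q.2 t) (B := B)
      (hJi.comp_snd (cellMeasure L))
      ((hg.comp_quasiMeasurePreserving hq).mul hE.aestronglyMeasurable) ?_
    filter_upwards [hq.ae hB] with q hq
    simpa using hq
  have e1 : ∀ x, kernelPairing L H t g x * cellExp L (-k) x
      = (∫ z, kernelOsc L H z t • (g (z + x) * cellExp L (-k) x))
        + (kernelMean H t * ∫ a, g a ∂cellMeasure L) * cellExp L (-k) x := by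
    intro x
    rw [kernelPairing, add_mul, ← integral_mul_const]
    simp only [Complex.real_smul, mul_assoc]
  simp only [e1]
  have hEi : Integrable (cellExp L (-k)) (cellMeasure L) :=
    Integrable.of_bound (continuous_cellExp L (-k)).aestronglyMeasurable 1
      (Eventually.of_forall fun x => (norm_cellExp _ _).le)
  rw [integral_add hT.integral_prod_left (hEi.const_mul _), integral_integral_swap hT,
    integral_const_mul, integral_cellExp hL]
  -- Shifting the density by `z` multiplies its `k`-th coefficient by `cellExp L k z`.
  have e2 : ∀ z, ∫ x, kernelOsc L H z t • (g (z + x) * cellExp L (-k) x) ∂cellMeasure L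
      = kernelOsc L H z t • cellExp L k z * ∫ y, g y * cellExp L (-k) y ∂cellMeasure L := by
    intro z
    rw [integral_smul, smul_mul_assoc]
    congr 1
    have h1 := (hper.mul (latticePeriodic_cellExp hL (-k))).integral_add hL z
    rw [← h1, ← integral_const_mul]
    refine integral_congr_ae (Eventually.of_forall fun x => ?_)
    simp only
    rw [cellExp_neg_apply_eq L k x z, add_comm x z]
    ring
  simp only [e2]
  rw [integral_mul_const, kernelPairing, integral_cellExp hL, add_mul]
  -- The term with `kernelMean` occurs on both sides only for `k = 0`, where the coefficient is the
  -- mean itself.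
  simp only [add_zero, neg_eq_zero, Complex.real_smul]
  congr 1
  split_ifs with h
  · subst h
    simp [cellExp_zero]
  · simp

theorem measurable_kernelMean (hH : IsHalfSpaceKernel c H) : Measurable (kernelMean H) := by
  have hr : Measurable rot := rotEquiv.continuous.measurable
  have h1 : ∀ {f : ℝ × Plane → Plane}, Measurable f →
      Measurable (fun q : ℝ × Plane => H (f q) q.1) := fun hf =>
    hH.measurable.comp (hf.prodMk measurable_fst)
  have h2 : Measurable (fun q : ℝ × Plane => _root_.rotSum H q.2 q.1) :=
    (((h1 measurable_snd).add (h1 (hr.comp measurable_snd))).add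
      (h1 (hr.comp (hr.comp measurable_snd)))).add
      (h1 (hr.comp (hr.comp (hr.comp measurable_snd))))
  exact (h2.stronglyMeasurable.integral_prod_right').measurable.const_mul _

/-- The pairing is jointly integrable in depth and horizontal position. -/
theorem integrable_kernelPairing (hH : IsHalfSpaceKernel c H) (hc : 0 ≤ c) (hL : ∀ b, 0 < L b)
    (hm : IsDepthMajorant m) {g : Plane → ℝ → ℝ} (hg : IsPeriodicDensity L m g) :
    Integrable (fun q : Plane × ℝ => kernelPairing L H q.2 (fun y => g y q.2) q.1)
      ((cellMeasure L).prod (volume.restrict (Ioi 0))) := by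
  have hP := isProbabilityMeasure_cellMeasure hL
  obtain ⟨Ψ, hΨ, hΨ0, hJ⟩ := hH.exists_kernelOsc_bound hL
  obtain ⟨C, hC, hb⟩ := norm_kernelPairing_le (E := ℝ) hH hc hL
  set ν : Measure ℝ := volume.restrict (Ioi 0) with hν
  have hae : ∀ᵐ q ∂(cellMeasure L).prod ν, q.2 ∈ regularDepths c ∧
      (∀ᵐ y, ‖g y q.2‖ ≤ m q.2) :=
    Measure.quasiMeasurePreserving_snd.ae ((ae_regularDepths c).and
      (hg.ae_slice.mono fun t h => h.2.1))
  refine (((hm.integrable_weight c).const_mul C).comp_snd (cellMeasure L)).mono' ?_ ?_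
  -- The skew translation `((x, t), z) ↦ (t, z + x)` preserves measure up to the normalised
  -- `x`-factor, so composition with the almost everywhere defined density stays measurable.
  · have hτ : MeasurePreserving (fun q : (Plane × ℝ) × Plane => (q.1.2, q.2 + q.1.1))
        (((cellMeasure L).prod ν).prod volume) (ν.prod volume) :=
      MeasurePreserving.skew_product (g := fun (p : Plane × ℝ) (z : Plane) => z + p.1)
        measurePreserving_snd (by fun_prop) (Eventually.of_forall fun p =>
          (measurePreserving_add_right volume p.1).map_eq)
    have hτ' := Measure.measurePreserving_swap.comp hτ
    have hgτ : AEStronglyMeasurable (fun q : (Plane × ℝ) × Plane => g (q.2 + q.1.1) q.1.2)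
        (((cellMeasure L).prod ν).prod volume) :=
      hg.aestronglyMeasurable.comp_measurePreserving hτ'
    have hJm : Measurable (fun q : (Plane × ℝ) × Plane => kernelOsc L H q.2 q.1.2) :=
      (hH.measurable_kernelOsc hL).comp (measurable_snd.prodMk measurable_fst.snd)
    have h1 : AEStronglyMeasurable (fun q : Plane × ℝ =>
        ∫ z, kernelOsc L H z q.2 • g (z + q.1) q.2) ((cellMeasure L).prod ν) :=
      (hJm.aestronglyMeasurable.smul hgτ).integral_prod_right'
    have hac : (cellMeasure L).prod ν ≪ halfSpaceMeasure :=
      ((Measure.absolutelyContinuous_restrict).smul_left _).prod Measure.AbsolutelyContinuous.rfl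
    have h2 : AEStronglyMeasurable (fun t : ℝ => ∫ a, g a t ∂cellMeasure L) ν :=
      (hg.aestronglyMeasurable.mono_ac hac).prod_swap.integral_prod_right'
    exact h1.add (hH.measurable_kernelMean.aestronglyMeasurable.smul h2).comp_snd
  · filter_upwards [hae] with q hq
    rw [← mul_assoc]
    exact hb q.2 hq.1 _ _ hq.2 (hm.nonneg _) q.1

/-- The Fourier coefficients of the volume integral. -/
theorem cellCoeff_volumePotential (hH : IsHalfSpaceKernel c H) (hc : 0 ≤ c) (hL : ∀ b, 0 < L b)
    (hm : IsDepthMajorant m) {g : Plane → ℝ → ℝ} (hg : IsPeriodicDensity L m g) (k : Fin 2 → ℤ) :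
    IntegrableOn (fun t => kernelPairing L H t (cellExp L k) 0
        * cellCoeff L (fun y => (g y t : ℂ)) k) (Ioi 0) ∧
      cellCoeff L (fun x => (volumePotential L H g x : ℂ)) k
        = ∫ t in Ioi (0 : ℝ), kernelPairing L H t (cellExp L k) 0
          * cellCoeff L (fun y => (g y t : ℂ)) k := by
  have hP := isProbabilityMeasure_cellMeasure hL
  have hF := hH.integrable_kernelPairing hc hL hm hg
  have hE : Continuous fun q : Plane × ℝ => cellExp L (-k) q.1 :=
    (continuous_cellExp L (-k)).comp continuous_fst
  have hF' : Integrable (fun q : Plane × ℝ =>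
      ((kernelPairing L H q.2 (fun y => g y q.2) q.1 : ℝ) : ℂ) * cellExp L (-k) q.1)
      ((cellMeasure L).prod (volume.restrict (Ioi 0))) :=
    hF.ofReal.mul_bdd (c := 1) hE.aestronglyMeasurable
      (Eventually.of_forall fun q => (norm_cellExp _ _).le)
  -- At almost every depth the pairing acts diagonally; what remains is the exchange of the depth
  -- and cell integrals.
  have hae : (fun t => ∫ x, ((kernelPairing L H t (fun y => g y t) x : ℝ) : ℂ) * cellExp L (-k) x
        ∂cellMeasure L) =ᵐ[volume.restrict (Ioi 0)]
      fun t => kernelPairing L H t (cellExp L k) 0 * cellCoeff L (fun y => (g y t : ℂ)) k := by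
    filter_upwards [ae_regularDepths c, hg.ae_slice] with t ht h
    simp only [kernelPairing_ofReal, cellCoeff_eq hL]
    exact hH.integral_kernelPairing_mul_cellExp hL ht (B := m t)
      (Complex.continuous_ofReal.comp_aestronglyMeasurable h.1)
      (h.2.1.mono fun y hy => by simpa using hy) (fun b y => congrArg _ (h.2.2 b y)) k
  refine ⟨hF'.integral_prod_right.congr hae, ?_⟩
  rw [cellCoeff_eq hL, ← integral_congr_ae hae, ← integral_integral_swap hF']
  refine integral_congr_ae (Eventually.of_forall fun x => ?_)
  simp only [volumePotential]
  rw [← integral_complex_ofReal, ← integral_mul_const]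

end IsHalfSpaceKernel

/-! ### The improper Fourier transform of a kernel -/

section PlaneFourier

variable {c : ℝ} {H : Plane → ℝ → ℝ} {L : Fin 2 → ℝ}

theorem exp_eq_cellExp (L : Fin 2 → ℝ) (k : Fin 2 → ℤ) (z : Plane) :
    Complex.exp (-(Complex.I * (inner ℝ (-(2 * π) • kbar L k) z : ℝ))) = cellExp L k z := by
  rw [cellExp, inner_smul_left]
  congr 1
  simp only [map_neg, conj_trivial]
  push_cast
  ring

/-- The improper Fourier integrals of a half-space kernel at the lattice frequencies. -/
theorem IsHalfSpaceKernel.hasPlaneFourier_kbar (hH : IsHalfSpaceKernel c H) (hc : 0 ≤ c)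
    (hL : ∀ b, 0 < L b) {t : ℝ} (ht : t ∈ regularDepths c) (k : Fin 2 → ℤ) :
    HasPlaneFourier (fun z => H z t) (-(2 * π) • kbar L k)
      (kernelPairing L H t (cellExp L k) 0) := by
  refine ⟨hH.integrableOn_ball ht, ?_⟩
  -- The character is itself a bounded periodic density, so the Fourier integral is an instance of
  -- the pairing at the origin.
  have h := hH.tendsto_setIntegral_ball_smul hc hL ht (latticePeriodic_cellExp hL k)
    (continuous_cellExp L k).aestronglyMeasurable (B := 1)
    (Eventually.of_forall fun x => (norm_cellExp _ _).le) 0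
  refine h.congr fun R => ?_
  simp only [discFourier, exp_eq_cellExp, sub_zero, Complex.real_smul]

/-- Every frequency is a lattice frequency for suitable periods. -/
theorem exists_eq_smul_kbar (q : Plane) : ∃ (L : Fin 2 → ℝ) (k : Fin 2 → ℤ), (∀ b, 0 < L b) ∧
    q = -(2 * π) • kbar L k := by
  have h : ∀ b, ∃ (l : ℝ) (n : ℤ), 0 < l ∧ q b = -(2 * π) * (n / l) := by
    intro b
    -- A nonzero component of `q` takes the period `2π / |q b|` and the integer `±1`; a zero
    -- component takes the integer `0` and an arbitrary period.
    rcases lt_trichotomy (q b) 0 with hb | hb | hb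
    · refine ⟨2 * π / -q b, 1, div_pos (by positivity) (by linarith), ?_⟩
      have := hb.ne
      have := Real.pi_pos.ne'
      push_cast
      field_simp
    · exact ⟨1, 0, one_pos, by simp [hb]⟩
    · refine ⟨2 * π / q b, -1, by positivity, ?_⟩
      have := hb.ne'
      have := Real.pi_pos.ne'
      push_cast
      field_simp
  choose l n hl hq using h
  refine ⟨l, n, hl, ?_⟩
  ext b
  fin_cases b <;> simp [kbar, hq]

theorem IsHalfSpaceKernel.exists_hasPlaneFourier (hH : IsHalfSpaceKernel c H) (hc : 0 ≤ c)
    {t : ℝ} (ht : t ∈ regularDepths c) (q : Plane) :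
    ∃ a, HasPlaneFourier (fun z => H z t) q a := by
  obtain ⟨L, k, hL, rfl⟩ := exists_eq_smul_kbar q
  exact ⟨_, hH.hasPlaneFourier_kbar hc hL ht k⟩

end PlaneFourier

/-! ### Assembling the components -/

theorem LatticePeriodic.integrable_cellMeasure {L : Fin 2 → ℝ} (hL : ∀ b, 0 < L b) {f : Plane → ℂ}
    (hf : LatticePeriodic L f) (hc : Continuous f) : Integrable f (cellMeasure L) := by
  have hP := isProbabilityMeasure_cellMeasure hL
  obtain ⟨F, hF⟩ := hf.exists_continuousMap hL hc
  exact Integrable.of_bound hc.aestronglyMeasurable ‖F‖ (Eventually.of_forall fun y => by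
    rw [hF]; exact F.norm_coe_le_norm _)

theorem cellCoeff_finset_sum {L : Fin 2 → ℝ} (hL : ∀ b, 0 < L b) {ι : Type*} (s : Finset ι)
    {f : ι → Plane → ℂ} (hf : ∀ i ∈ s, Integrable (f i) (cellMeasure L)) (k : Fin 2 → ℤ) :
    cellCoeff L (fun x => ∑ i ∈ s, f i x) k = ∑ i ∈ s, cellCoeff L (f i) k := by
  simp only [cellCoeff_eq hL, Finset.sum_mul]
  refine integral_finsetSum s fun i hi => ?_
  exact (hf i hi).mul_bdd (c := 1) (continuous_cellExp L (-k)).aestronglyMeasurable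
    (Eventually.of_forall fun q => (norm_cellExp _ _).le)

theorem HasPlaneFourier.mindlinGradGHat_eq {μ ν x₃ t : ℝ} {q : Plane} {k i j : Fin 3} {a : ℂ}
    (h : HasPlaneFourier (fun z => mindlinGradG μ ν z x₃ t k i j) q a) :
    mindlinGradGHat μ ν q x₃ t k i j = a :=
  h.tendsto.limUnder_eq

theorem volumeIntegrand_truncateTo {μ ν : ℝ} {w : Plane → ℝ → Matrix (Fin 3) (Fin 3) ℝ} {x : Plane}
    {x₃ t : ℝ} {k : Fin 3} {H : Fin 3 → Fin 3 → Plane → ℝ → ℝ}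
    (hH : ∀ i j z, mindlinGradG μ ν z x₃ t k i j = H i j z t) (R : ℝ) (y : Plane) :
    volumeIntegrand μ ν (truncateTo R w) x x₃ k y t
      = ∑ q : Fin 3 × Fin 3, (Metric.ball (0 : Plane) R).indicator
        (fun y => H q.1 q.2 (y - x) t * w y t q.1 q.2) y := by
  rw [Fintype.sum_prod_type, volumeIntegrand]
  refine Finset.sum_congr rfl fun i _ => Finset.sum_congr rfl fun j _ => ?_
  rw [hH, truncateTo]
  by_cases hy : y ∈ Metric.ball (0 : Plane) R
  · rw [indicator_of_mem hy, indicator_of_mem hy]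
  · rw [indicator_of_notMem hy, indicator_of_notMem hy, Matrix.zero_apply, mul_zero]

theorem theorem1 (μ ν : ℝ) (hμ : 0 < μ) (hν : -1 < ν) (hν' : ν < 1 / 2)
    (L : Fin 2 → ℝ) (hL : ∀ b, 0 < L b)
    (w : Plane → ℝ → Matrix (Fin 3) (Fin 3) ℝ)
    (hper : CellPeriodic L w)
    (hmeas : ∀ i j, AEMeasurable (fun p : Plane × ℝ => w p.1 p.2 i j)
      (volume.restrict {p | 0 < p.2}))
    (m : ℝ → ℝ) (M : ℝ) (hmM : ∀ t, m t ≤ M) (hm : IntegrableOn m (Ioi 0))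
    (hwm : ∀ i j, ∀ᵐ p : Plane × ℝ ∂(volume.restrict {p | 0 < p.2}), |w p.1 p.2 i j| ≤ m p.2) :
    (∀ (q : Plane) (x₃ t : ℝ), 0 ≤ x₃ → 0 < t → t ≠ x₃ → ∀ p i j,
      HasPlaneFourier (fun z => mindlinGradG μ ν z x₃ t p i j) q
        (mindlinGradGHat μ ν q x₃ t p i j)) ∧
    ∃ u : Plane → ℝ → Fin 3 → ℝ,
      IsMindlinVolume μ ν w u ∧
      CellPeriodic L u ∧
      ∀ x₃, 0 ≤ x₃ → ∀ p : Fin 3,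
        Continuous (fun x => u x x₃ p) ∧
        (∀ k : Fin 2 → ℤ,
          IntegrableOn (modeIntegrand μ ν L w k x₃ p) (Ioi 0) ∧
          cellCoeff L (fun x => (u x x₃ p : ℂ)) k = modeCoeff μ ν L w k x₃ p) ∧
        Tendsto
          (fun s : Finset (Fin 2 → ℤ) =>
            eLpNorm (fun x : Plane =>
              (u x x₃ p : ℂ) - ∑ k ∈ s, modeCoeff μ ν L w k x₃ p * cellExp L k x)
              2 (volume.restrict (cell L)))
          atTop (𝓝 0) ∧
        (Summable (fun k : Fin 2 → ℤ => modeCoeff μ ν L w k x₃ p) →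
          ∀ x : Plane, HasSum (fun k : Fin 2 → ℤ => modeCoeff μ ν L w k x₃ p * cellExp L k x)
            (u x x₃ p : ℂ)) := by
  have hex : ∀ c : ℝ, 0 ≤ c → ∀ k i j : Fin 3, ∃ H : Plane → ℝ → ℝ, IsHalfSpaceKernel c H ∧
      ∀ t ∈ regularDepths c, ∀ z, mindlinGradG μ ν z c t k i j = H z t :=
    fun c hc k i j => exists_isHalfSpaceKernel_mindlinGradG μ ν hc k i j
  choose! H hH hHeq using hex
  have hHeq' : ∀ c : ℝ, 0 ≤ c → ∀ t ∈ regularDepths c, ∀ k i j : Fin 3,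
      (fun z => mindlinGradG μ ν z c t k i j) = fun z => H c k i j z t :=
    fun c hc t ht k i j => funext (hHeq c hc k i j t ht)
  -- The given majorant is not assumed nonnegative at every depth; its positive part is.
  have hm' : IsDepthMajorant (fun t => max (m t) 0) :=
    ⟨fun t => le_max_right _ _, ⟨max M 0, fun t => max_le_max (hmM t) le_rfl⟩, hm.pos_part⟩
  have hw : ∀ i j, IsPeriodicDensity L (fun t => max (m t) 0) (fun y t => w y t i j) := by
    intro i j
    refine ⟨fun t ht b y => ?_, ?_, ?_⟩
    · simp only [hper y t ht.le b]
    · rw [← volume_restrict_halfSpace]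
      exact (hmeas i j).aestronglyMeasurable
    · rw [← volume_restrict_halfSpace]
      exact (hwm i j).mono fun p hp => hp.trans (le_max_left _ _)
  refine ⟨fun q x₃ t hx₃ ht htx p i j => ?_, fun x c p => ∑ q : Fin 3 × Fin 3,
    volumePotential L (H c p q.1 q.2) (fun y t => w y t q.1 q.2) x, ⟨?_, ?_⟩, ?_, ?_⟩
  · obtain ⟨a, ha⟩ := (hH x₃ hx₃ p i j).exists_hasPlaneFourier hx₃ ⟨ht, htx⟩ q
    rw [← hHeq' x₃ hx₃ t ⟨ht, htx⟩ p i j] at ha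
    -- `mindlinGradGHat` is an arbitrary value unless the limit exists; existence having been shown,
    -- it is the limit.
    rwa [ha.mindlinGradGHat_eq]
  · intro R x c hc k
    rw [IntegrableOn, volume_restrict_halfSpace]
    refine (integrable_finsetSum Finset.univ fun (q : Fin 3 × Fin 3) _ =>
      (hH c hc k q.1 q.2).integrable_truncated hm' (hw q.1 q.2) x R).congr ?_
    have hae : ∀ᵐ p : Plane × ℝ ∂halfSpaceMeasure, p.2 ∈ regularDepths c :=
      Measure.quasiMeasurePreserving_snd.ae (ae_regularDepths c)
    filter_upwards [hae] with p hp
    exact (volumeIntegrand_truncateTo (fun i j z => hHeq c hc k i j p.2 hp z) R p.1).symm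
  · intro x c hc k
    have h1 := tendsto_finsetSum Finset.univ fun (q : Fin 3 × Fin 3) _ =>
      (hH c hc k q.1 q.2).tendsto_volumePotential hc hL hm' (hw q.1 q.2) x
    refine h1.congr fun R => ?_
    have hint : ∀ q : Fin 3 × Fin 3, Integrable (fun t => ∫ y in Metric.ball 0 R,
        H c k q.1 q.2 (y - x) t • w y t q.1 q.2) (volume.restrict (Ioi 0)) := fun q => by
      have := ((hH c hc k q.1 q.2).integrable_truncated hm' (hw q.1 q.2) x R).integral_prod_right
      exact this.congr (Eventually.of_forall fun t =>
        IsHalfSpaceKernel.integral_indicator_slice _ (fun y t => w y t q.1 q.2) x R t)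
    rw [mindlinIntegral, ← integral_finsetSum _ fun q _ => hint q]
    refine integral_congr_ae ?_
    have hslice : ∀ᵐ t ∂volume.restrict (Ioi (0 : ℝ)), ∀ q : Fin 3 × Fin 3,
        AEStronglyMeasurable (fun y => w y t q.1 q.2) volume ∧
          ∀ᵐ y, ‖w y t q.1 q.2‖ ≤ max (m t) 0 :=
      ae_all_iff.2 fun q => (hw q.1 q.2).ae_slice.mono fun t h => ⟨h.1, h.2.1⟩
    filter_upwards [ae_regularDepths c, hslice] with t ht hs
    simp only [volumeIntegrand_truncateTo (fun i j z => hHeq c hc k i j t ht z) R]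
    rw [integral_finsetSum]
    · exact Finset.sum_congr rfl fun q _ =>
        (IsHalfSpaceKernel.integral_indicator_slice _ (fun y t => w y t q.1 q.2) x R t).symm
    · intro q _
      rw [integrable_indicator_iff Metric.isOpen_ball.measurableSet]
      exact (hH c hc k q.1 q.2).integrableOn_ball_smul ht (hs q).1 (hs q).2 x R
  · intro x c _ b
    ext p
    exact Finset.sum_congr rfl fun q _ =>
      IsHalfSpaceKernel.latticePeriodic_volumePotential (hw q.1 q.2) _ b x
  · intro c hc p
    have hcont : ∀ q : Fin 3 × Fin 3, Continuous
        (volumePotential L (H c p q.1 q.2) (fun y t => w y t q.1 q.2)) := fun q =>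
      (hH c hc p q.1 q.2).continuous_volumePotential hc hL hm' (hw q.1 q.2)
    have hperV : ∀ q : Fin 3 × Fin 3, LatticePeriodic L
        (volumePotential L (H c p q.1 q.2) (fun y t => w y t q.1 q.2)) := fun q =>
      IsHalfSpaceKernel.latticePeriodic_volumePotential (hw q.1 q.2) _
    have hU : Continuous fun x => ∑ q : Fin 3 × Fin 3,
        volumePotential L (H c p q.1 q.2) (fun y t => w y t q.1 q.2) x :=
      continuous_finsetSum _ fun q _ => hcont q
    have hUc := Complex.continuous_ofReal.comp hU
    have hUp : LatticePeriodic L fun x => ((∑ q : Fin 3 × Fin 3,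
        volumePotential L (H c p q.1 q.2) (fun y t => w y t q.1 q.2) x : ℝ) : ℂ) := fun b x => by
      simp only [hperV _ b x]
    have hcoef : ∀ k : Fin 2 → ℤ, IntegrableOn (modeIntegrand μ ν L w k c p) (Ioi 0) ∧
        cellCoeff L (fun x => ((∑ q : Fin 3 × Fin 3,
          volumePotential L (H c p q.1 q.2) (fun y t => w y t q.1 q.2) x : ℝ) : ℂ)) k
          = modeCoeff μ ν L w k c p := by
      intro k
      have hq := fun q : Fin 3 × Fin 3 =>
        (hH c hc p q.1 q.2).cellCoeff_volumePotential hc hL hm' (hw q.1 q.2) k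
      -- At regular depths the multiplier and `mindlinGradGHat` at `-2π k̄` are limits of the same
      -- disc integrals.
      have hae : (fun t => ∑ q : Fin 3 × Fin 3, kernelPairing L (H c p q.1 q.2) t (cellExp L k) 0
          * cellCoeff L (fun y => (w y t q.1 q.2 : ℂ)) k)
          =ᵐ[volume.restrict (Ioi (0 : ℝ))] modeIntegrand μ ν L w k c p := by
        filter_upwards [ae_regularDepths c] with t ht
        rw [modeIntegrand, Fintype.sum_prod_type]
        refine Finset.sum_congr rfl fun i _ => Finset.sum_congr rfl fun j _ => ?_
        have h1 := (hH c hc p i j).hasPlaneFourier_kbar hc hL ht k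
        rw [← hHeq' c hc t ht p i j] at h1
        rw [h1.mindlinGradGHat_eq]
      refine ⟨(integrable_finsetSum _ fun q _ => (hq q).1).congr hae, ?_⟩
      rw [modeCoeff, ← integral_congr_ae hae, integral_finsetSum _ fun q _ => (hq q).1]
      simp only [Complex.ofReal_sum]
      rw [cellCoeff_finset_sum hL]
      · exact Finset.sum_congr rfl fun q _ => (hq q).2
      · intro q _
        exact LatticePeriodic.integrable_cellMeasure hL
          (fun b x => congrArg _ (hperV q b x)) (Complex.continuous_ofReal.comp (hcont q))
    refine ⟨hU, hcoef, ?_, fun hs x => ?_⟩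
    · have h := hUp.tendsto_eLpNorm_cellCoeff hL hUc
      simpa only [(hcoef _).2] using h
    · have e := funext fun k => (hcoef k).2
      have h := hUp.hasSum_cellCoeff hL hUc (by rw [e]; exact hs) x
      simpa only [(hcoef _).2] using h
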